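/- Let $n\ge 1$, write $X=(x,x_{n+1})\in\mathbb R^{n+1}$ with $x=(x_1,\dots,x_n)$, let $B_\rho=\{X\in\mathbb R^{n+1}:|X|<\rho\}$, and let $$\mathcal P=\{X\in B_1:\ x_{n+1}=0,\ x_n\le 0\},\qquad r=\sqrt{x_n^2+x_{n+1}^2},\qquad U_0=r^{1/2}\cos\frac\theta2=\frac1{\sqrt2}\sqrt{x_n+r},$$ where $\theta\in(-\pi,\pi]$ is the polar angle of $(x_n,x_{n+1})$, that is, $x_n=r\cos\theta$ and $x_{n+1}=r\sin\theta$ (with $\theta=0$ if $r=0$). For every integer $k\ge 0$ there is a constant $C$, depending only on $n$ and $k$, such that the following holds. Let $u\in C(B_1)$ be even in $x_{n+1}$, with $|u|\le 1$ in $B_1$, and suppose that $$\Delta u=0\ \text{ in } B_1\setminus\mathcal P,\qquad u=0\ \text{ on }\mathcal P .$$ Then there is a real polynomial $P_0(x,r)$ in the $n+1$ variables $(x_1,\dots,x_n,r)$, of total degree at most $k$, such that $U_0P_0$ is harmonic in $B_1\setminus\mathcal P$ and $$|u-U_0P_0|\le C\,|X|^{k+1}\,U_0\qquad\text{in } B_{1/2}.$$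 -/

import Mathlib

/-! Points of `ℝ^(n+1)` are written `X = (x, x_{n+1})` with `x = (x₁, …, x_n)`.
With 0-based indices, `x_i` is `X (i-1)`; the flat edge is `Γ = {x_n = 0, x_{n+1} = 0}`. -/

namespace FlatSlit

noncomputable section

/-- The coordinate `x_n` (meaningful for `n ≥ 1`), i.e. the signed distance in `ℝ^n` from `x` to
the hyperplane `{x_n = 0}`, positive in the direction `e_n`. -/
def signedDist {n : ℕ} (X : EuclideanSpace ℝ (Fin (n + 1))) : ℝ := X ⟨n - 1, by omega⟩

/-- The coordinate `x_{n+1}`. -/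
def height {n : ℕ} (X : EuclideanSpace ℝ (Fin (n + 1))) : ℝ := X (Fin.last n)

/-- The distance `r = √(x_{n+1}² + x_n²)` from `X` to the edge `Γ`. -/
def radius {n : ℕ} (X : EuclideanSpace ℝ (Fin (n + 1))) : ℝ :=
  Real.sqrt (height X ^ 2 + signedDist X ^ 2)

/-- The angle `θ ∈ (-π, π]` of `(x_n, x_{n+1})` in polar coordinates. -/
def angle {n : ℕ} (X : EuclideanSpace ℝ (Fin (n + 1))) : ℝ :=
  Complex.arg ⟨signedDist X, height X⟩

/-- `U₀ = r^{1/2} cos (θ / 2)`. -/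
def U₀ {n : ℕ} (X : EuclideanSpace ℝ (Fin (n + 1))) : ℝ :=
  Real.sqrt (radius X) * Real.cos (angle X / 2)

/-- The equivalent formula `U₀ = 2^{-1/2} √(x_n + r)`. -/
theorem U₀_eq {n : ℕ} (X : EuclideanSpace ℝ (Fin (n + 1))) :
    U₀ X = 1 / Real.sqrt 2 * Real.sqrt (signedDist X + radius X) := by
  have hr : radius X = ‖(⟨signedDist X, height X⟩ : ℂ)‖ := by
    rw [Complex.norm_eq_sqrt_sq_add_sq, radius, add_comm]
  have h0 : 0 ≤ radius X := Real.sqrt_nonneg _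
  have hd : radius X * Real.cos (angle X) = signedDist X := by
    rw [hr, angle, Complex.norm_mul_cos_arg]
  have hc : Real.cos (angle X / 2) = Real.sqrt ((1 + Real.cos (angle X)) / 2) :=
    Real.cos_half (Complex.neg_pi_lt_arg _).le (Complex.arg_le_pi _)
  rw [U₀, hc, ← Real.sqrt_mul h0, one_div, ← Real.sqrt_inv, ← Real.sqrt_mul (by norm_num)]
  congr 1
  rw [← hd]
  ring

/-- The slit `𝒫 = {X ∈ B₁ | x_{n+1} = 0, x_n ≤ 0}`. -/
def slit (n : ℕ) : Set (EuclideanSpace ℝ (Fin (n + 1))) :=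
  {X | X ∈ Metric.ball 0 1 ∧ height X = 0 ∧ signedDist X ≤ 0}

/-- The reflection `(x, x_{n+1}) ↦ (x, -x_{n+1})`. -/
def reflect {n : ℕ} (X : EuclideanSpace ℝ (Fin (n + 1))) : EuclideanSpace ℝ (Fin (n + 1)) :=
  WithLp.toLp 2 (Function.update X.ofLp (Fin.last n) (-height X))

/-- The value at `X` of a polynomial `P(x, r)`: the first `n` indeterminates are evaluated at
`x₁, …, x_n` and the last one at `r`. -/
def evalXR {n : ℕ} (P : MvPolynomial (Fin (n + 1)) ℝ) (X : EuclideanSpace ℝ (Fin (n + 1))) : ℝ :=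
  MvPolynomial.eval (Fin.snoc (α := fun _ => ℝ) (fun i : Fin n => X i.castSucc) (radius X)) P

end

end FlatSlit

/-! Put n = m + 1 and split X into tangential coordinates y ∈ ℝ^m and z = x_n + i x_{n+1}. In the
plane, the even harmonic functions vanishing on the slit are spanned near 0 by Re z^(j+1/2)
(`slitHarmonic`), and a Chebyshev recursion makes each of them U₀ times a homogeneous polynomial of
degree j in x_n and r. The slit is invariant in y, so tangential derivatives of a solution are again
solutions, with bounds on smaller balls (`IsSolution.abs_tangential_deriv_le`).

On the slice y = 0 the derivatives f_α(z) = ∂_y^α u(0, z) satisfy Δf_α = -∑ f_{α+2e_l}. Once the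
f_{α+2e_l} are expanded up to O(|z|^s), the functions `chain` give an explicit particular solution.
What is left of f_α has Laplacian O(|z|^s), so it is a combination of the Re z^(j+1/2) up to
O(|z|^(s+2)) (`exists_slitHarmonic_expansion`). A descending induction on |α| expands all f_α
(`exists_chain_expansion`), starting from the mere boundedness of those of highest degree.

Taylor's formula in y reassembles these expansions. After truncation at homogeneity k + 1/2 they
form `jetModel`, a sum of terms `chain i j` (z) · Δ_y^i p_j(y). It is exactly harmonic off the slit,
because the planar Laplacian of layer i + 1 cancels the tangential Laplacian of layer i. It has the
form U₀P₀ (`jetModel_eq_U₀_mul`), and the error is O(|X|^(k+3/2)).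

The error is itself a solution. Comparison with a barrier on a ball of radius 4|X|
(`IsSolution.abs_le_U₀`) trades a factor |X|^(1/2) for U₀, which gives the stated weight. Tangential
smoothness is obtained by mollifying in y. All constants are independent of the mollification, so
the coefficients converge along a subsequence and the estimate passes to the limit. -/

namespace FlatSlit

open Topology Filter Set Laplacian InnerProductSpace Metric MeasureTheory

set_option linter.unusedSectionVars false

/-! ### Second derivatives along lines, the Laplacian, and the weak maximum principle. -/

section Calculus

variable {V : Type*} [NormedAddCommGroup V] [InnerProductSpace ℝ V] [FiniteDimensional ℝ V]
variable {ι : Type*} [Fintype ι]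

theorem laplacian_eq_sum_fderiv (f : V → ℝ) (x : V) (b : OrthonormalBasis ι ℝ V) :
    Δ f x = ∑ i, fderiv ℝ (fderiv ℝ f) x (b i) (b i) := by
  rw [laplacian_eq_iteratedFDeriv_orthonormalBasis f b]
  simp [iteratedFDeriv_two_apply]

theorem hasDerivAt_line {f : V → ℝ} {x v : V} {t : ℝ} (h : DifferentiableAt ℝ f (x + t • v)) :
    HasDerivAt (fun s : ℝ => f (x + s • v)) (fderiv ℝ f (x + t • v) v) t := by
  have h1 : HasDerivAt (fun s : ℝ => x + s • v) v t := by
    simpa using ((hasDerivAt_id t).smul_const v).const_add x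
  exact h.hasFDerivAt.comp_hasDerivAt t h1

theorem _root_.ContDiffAt.differentiableAt_fderiv {f : V → ℝ} {x : V} (h : ContDiffAt ℝ 2 f x) :
    DifferentiableAt ℝ (fderiv ℝ f) x :=
  (h.fderiv_right (m := 1) (by norm_num)).differentiableAt (by norm_num)

theorem _root_.ContDiffAt.eventually_differentiableAt {f : V → ℝ} {x : V}
    (h : ContDiffAt ℝ 2 f x) : ∀ᶠ y in 𝓝 x, DifferentiableAt ℝ f y := by
  filter_upwards [h.eventually (by simp)] with y hy
  exact hy.differentiableAt (by norm_num)

theorem eventually_deriv_line {f : V → ℝ} {x : V} (h : ContDiffAt ℝ 2 f x) (v : V) :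
    deriv (fun t : ℝ => f (x + t • v)) =ᶠ[𝓝 0] fun t => fderiv ℝ f (x + t • v) v := by
  have hc : Tendsto (fun t : ℝ => x + t • v) (𝓝 0) (𝓝 x) := by
    have : Continuous (fun t : ℝ => x + t • v) := by fun_prop
    simpa using this.tendsto 0
  filter_upwards [hc.eventually h.eventually_differentiableAt] with t ht
  exact (hasDerivAt_line ht).deriv

theorem hasDerivAt_fderiv_line {f : V → ℝ} {x : V} (h : ContDiffAt ℝ 2 f x) (v w : V) :
    HasDerivAt (fun t : ℝ => fderiv ℝ f (x + t • v) w) (fderiv ℝ (fderiv ℝ f) x v w) 0 := by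
  have h1 : HasDerivAt (fun s : ℝ => x + s • v) v 0 := by
    simpa using ((hasDerivAt_id (0 : ℝ)).smul_const v).const_add x
  have h2 : HasFDerivAt (fderiv ℝ f) (fderiv ℝ (fderiv ℝ f) x) (x + (0 : ℝ) • v) := by
    simpa using h.differentiableAt_fderiv.hasFDerivAt
  have h3 := h2.comp_hasDerivAt 0 h1
  exact h3.clm_apply (hasDerivAt_const 0 w) |>.congr_deriv (by simp)

theorem hasDerivAt_deriv_line {f : V → ℝ} {x : V} (h : ContDiffAt ℝ 2 f x) (v : V) :
    HasDerivAt (deriv (fun t : ℝ => f (x + t • v))) (fderiv ℝ (fderiv ℝ f) x v v) 0 :=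
  (hasDerivAt_fderiv_line h v v).congr_of_eventuallyEq (eventually_deriv_line h v)

/-- If `f` has first derivative `g` along `v` near `x`, and `g` has derivative `c` along `v` at
`x`, then `c` is the second directional derivative. -/
theorem fderiv_fderiv_eq_of_hasDerivAt {f : V → ℝ} {x v : V} (h : ContDiffAt ℝ 2 f x)
    {g : ℝ → ℝ} {c : ℝ} (h1 : ∀ᶠ t in 𝓝 (0 : ℝ), HasDerivAt (fun t : ℝ => f (x + t • v)) (g t) t)
    (h2 : HasDerivAt g c 0) : fderiv ℝ (fderiv ℝ f) x v v = c := by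
  have e : deriv (fun t : ℝ => f (x + t • v)) =ᶠ[𝓝 0] g := by
    filter_upwards [h1] with t ht using ht.deriv
  exact (hasDerivAt_deriv_line h v).unique (h2.congr_of_eventuallyEq e)

/-- If the second derivative were positive, the second derivative test would make the point a local
minimum along the line as well. The function would then be constant on that line near the point, and
its second derivative would be zero. -/
theorem fderiv_fderiv_nonpos_of_isLocalMax {f : V → ℝ} {x : V} (h : ContDiffAt ℝ 2 f x)
    (hm : IsLocalMax f x) (v : V) : fderiv ℝ (fderiv ℝ f) x v v ≤ 0 := by
  by_contra! hpos
  set g : ℝ → ℝ := fun t => f (x + t • v) with hg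
  have hc : ContinuousAt (fun t : ℝ => x + t • v) 0 := by fun_prop
  have hmax : IsLocalMax g 0 := by
    have : Tendsto (fun t : ℝ => x + t • v) (𝓝 0) (𝓝 x) := by simpa using hc.tendsto
    have := this.eventually hm
    filter_upwards [this] with t ht
    simpa [hg] using ht
  have hd0 : deriv g 0 = 0 := hmax.deriv_eq_zero
  have hgc : ContinuousAt g 0 := by
    have : DifferentiableAt ℝ f (x + (0 : ℝ) • v) := by
      simpa using h.differentiableAt (by norm_num)
    exact (hasDerivAt_line this).continuousAt
  have hdd := hasDerivAt_deriv_line h v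
  have hmin : IsLocalMin g 0 := isLocalMin_of_deriv_deriv_pos (by rw [hdd.deriv]; exact hpos) hd0 hgc
  have hconst : g =ᶠ[𝓝 0] fun _ => g 0 := by
    filter_upwards [hmax, hmin] with t h1 h2
    exact le_antisymm h1 h2
  have hz : deriv g =ᶠ[𝓝 0] fun _ => 0 := by
    filter_upwards [hconst.eventually_nhds] with t ht
    have : g =ᶠ[𝓝 t] fun _ => g 0 := ht
    rw [this.deriv_eq]; simp
  have := hdd.deriv
  rw [hz.deriv_eq] at this
  simp at this
  linarith

theorem laplacian_nonpos_of_isLocalMax {f : V → ℝ} {x : V} (h : ContDiffAt ℝ 2 f x)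
    (hm : IsLocalMax f x) : Δ f x ≤ 0 := by
  rw [laplacian_eq_sum_fderiv f x (stdOrthonormalBasis ℝ V)]
  exact Finset.sum_nonpos fun i _ => fderiv_fderiv_nonpos_of_isLocalMax h hm _

theorem fderiv_fderiv_mul {f g : V → ℝ} {x : V} (hf : ContDiffAt ℝ 2 f x)
    (hg : ContDiffAt ℝ 2 g x) (v : V) :
    fderiv ℝ (fderiv ℝ (fun y => f y * g y)) x v v =
      f x * fderiv ℝ (fderiv ℝ g) x v v + 2 * (fderiv ℝ f x v * fderiv ℝ g x v) +
        g x * fderiv ℝ (fderiv ℝ f) x v v := by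
  have hx : x + (0 : ℝ) • v = x := by simp
  have hc : Tendsto (fun t : ℝ => x + t • v) (𝓝 0) (𝓝 x) := by
    have : Continuous (fun t : ℝ => x + t • v) := by fun_prop
    simpa using this.tendsto 0
  refine fderiv_fderiv_eq_of_hasDerivAt (hf.mul hg)
    (g := fun t => fderiv ℝ f (x + t • v) v * g (x + t • v) +
      f (x + t • v) * fderiv ℝ g (x + t • v) v) ?_ ?_
  · filter_upwards [hc.eventually hf.eventually_differentiableAt,
      hc.eventually hg.eventually_differentiableAt] with t h1 h2
    exact (hasDerivAt_line h1).mul (hasDerivAt_line h2)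
  · have df := hasDerivAt_line (f := f) (x := x) (v := v) (t := 0)
      (by rw [hx]; exact hf.differentiableAt (by norm_num))
    have dg := hasDerivAt_line (f := g) (x := x) (v := v) (t := 0)
      (by rw [hx]; exact hg.differentiableAt (by norm_num))
    refine (((hasDerivAt_fderiv_line hf v v).mul dg).add
      (df.mul (hasDerivAt_fderiv_line hg v v))).congr_deriv ?_
    simp only [hx]
    ring

theorem laplacian_mul {f g : V → ℝ} {x : V} (hf : ContDiffAt ℝ 2 f x)
    (hg : ContDiffAt ℝ 2 g x) (b : OrthonormalBasis ι ℝ V) :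
    Δ (fun y => f y * g y) x = f x * Δ g x +
      2 * ∑ i, fderiv ℝ f x (b i) * fderiv ℝ g x (b i) + g x * Δ f x := by
  simp only [laplacian_eq_sum_fderiv _ x b, fderiv_fderiv_mul hf hg, Finset.sum_add_distrib,
    Finset.mul_sum]

theorem contDiff_norm_sub_sq (y : V) (n : WithTop ℕ∞) : ContDiff ℝ n fun x : V => ‖x - y‖ ^ 2 :=
  (contDiff_id.sub contDiff_const).norm_sq ℝ

theorem hasDerivAt_norm_line_sq (x y v : V) (t : ℝ) :
    HasDerivAt (fun t : ℝ => ‖x + t • v - y‖ ^ 2) (2 * inner ℝ (x + t • v - y) v) t := by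
  have h1 : HasDerivAt (fun s : ℝ => x + s • v - y) v t := by
    simpa using (((hasDerivAt_id t).smul_const v).const_add x).sub_const y
  exact h1.norm_sq

theorem fderiv_norm_sub_sq (x y v : V) :
    fderiv ℝ (fun x : V => ‖x - y‖ ^ 2) x v = 2 * inner ℝ (x - y) v := by
  have h := hasDerivAt_line (f := fun x : V => ‖x - y‖ ^ 2) (x := x) (v := v) (t := 0)
    ((contDiff_norm_sub_sq y 2).contDiffAt.differentiableAt (by norm_num))
  simpa using h.unique (hasDerivAt_norm_line_sq x y v 0)

theorem fderiv_fderiv_norm_sub_sq (x y v : V) :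
    fderiv ℝ (fderiv ℝ (fun x : V => ‖x - y‖ ^ 2)) x v v = 2 * ‖v‖ ^ 2 := by
  refine fderiv_fderiv_eq_of_hasDerivAt (contDiff_norm_sub_sq y 2).contDiffAt
    (Eventually.of_forall fun t => hasDerivAt_norm_line_sq x y v t) ?_
  have h1 : HasDerivAt (fun s : ℝ => x + s • v - y) v 0 := by
    simpa using (((hasDerivAt_id (0 : ℝ)).smul_const v).const_add x).sub_const y
  have := (h1.inner ℝ (hasDerivAt_const (0 : ℝ) v)).const_mul 2
  simpa using this

theorem laplacian_norm_sub_sq (x y : V) :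
    Δ (fun x : V => ‖x - y‖ ^ 2) x = 2 * Module.finrank ℝ V := by
  rw [laplacian_eq_sum_fderiv _ x (stdOrthonormalBasis ℝ V)]
  simp [fderiv_fderiv_norm_sub_sq, mul_comm]

theorem laplacian_add' {f g : V → ℝ} {x : V} (hf : ContDiffAt ℝ 2 f x) (hg : ContDiffAt ℝ 2 g x) :
    Δ (fun y => f y + g y) x = Δ f x + Δ g x := hf.laplacian_add hg

theorem laplacian_sub' {f g : V → ℝ} {x : V} (hf : ContDiffAt ℝ 2 f x) (hg : ContDiffAt ℝ 2 g x) :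
    Δ (fun y => f y - g y) x = Δ f x - Δ g x := hf.laplacian_sub hg

theorem laplacian_const_mul {f : V → ℝ} {x : V} (c : ℝ) (hf : ContDiffAt ℝ 2 f x) :
    Δ (fun y => c * f y) x = c * Δ f x := laplacian_smul c hf

theorem laplacian_finset_sum {κ : Type*} (s : Finset κ) {f : κ → V → ℝ} {x : V}
    (hf : ∀ i ∈ s, ContDiffAt ℝ 2 (f i) x) :
    Δ (fun y => ∑ i ∈ s, f i y) x = ∑ i ∈ s, Δ (f i) x := by
  classical
  induction s using Finset.induction_on with
  | empty => simp
  | insert a s ha ih =>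
    simp only [Finset.sum_insert ha]
    rw [laplacian_add' (hf a (by simp)) (ContDiffAt.sum fun i hi => hf i (by simp [hi])),
      ih fun i hi => hf i (by simp [hi])]

/-- The weak maximum principle for subsolutions on an open subset of a compact set. -/
theorem le_of_laplacian_nonneg [Nontrivial V] {K O : Set V} (hK : IsCompact K) (hO : IsOpen O)
    (hOK : O ⊆ K) {w : V → ℝ} (hw : ContinuousOn w K) (hd : ∀ x ∈ O, ContDiffAt ℝ 2 w x)
    (hl : ∀ x ∈ O, 0 ≤ Δ w x) {M : ℝ} (hM : ∀ x ∈ K \ O, w x ≤ M) : ∀ x ∈ K, w x ≤ M := by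
  intro x hx
  obtain ⟨R, hR⟩ := hK.isBounded.exists_norm_le
  refine le_of_forall_pos_le_add fun ε hε => ?_
  -- Adding δ‖·‖² makes the Laplacian strictly positive on `O`, so a maximum cannot lie there. This
  -- `δ` costs at most `ε` on `K`, and the + 1 keeps the denominator positive when R = 0.
  set δ : ℝ := ε / (R ^ 2 + 1) with hδ
  have hδ0 : 0 < δ := by positivity
  have hsq : ∀ y ∈ K, ‖y - 0‖ ^ 2 ≤ R ^ 2 := fun y hy => by
    rw [sub_zero]; exact pow_le_pow_left₀ (norm_nonneg _) (hR y hy) 2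
  have hwc : ContinuousOn (fun y => w y + δ * ‖y - 0‖ ^ 2) K := by fun_prop
  obtain ⟨z, hz, hmax⟩ := hK.exists_isMaxOn ⟨x, hx⟩ hwc
  have hzO : z ∉ O := by
    intro hzO
    have h2 : ContDiffAt ℝ 2 (fun y : V => ‖y - 0‖ ^ 2) z := (contDiff_norm_sub_sq 0 2).contDiffAt
    have hloc : IsLocalMax (fun y => w y + δ * ‖y - 0‖ ^ 2) z :=
      hmax.isLocalMax (mem_of_superset (hO.mem_nhds hzO) hOK)
    have h3 := laplacian_nonpos_of_isLocalMax ((hd z hzO).add (contDiffAt_const.mul h2)) hloc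
    rw [laplacian_add' (hd z hzO) (contDiffAt_const.mul h2), laplacian_const_mul _ h2,
      laplacian_norm_sub_sq] at h3
    have := hl z hzO
    have hpos : (0 : ℝ) < Module.finrank ℝ V := by exact_mod_cast Module.finrank_pos
    nlinarith [mul_pos hδ0 hpos]
  have h1 : w x + δ * ‖x - 0‖ ^ 2 ≤ w z + δ * ‖z - 0‖ ^ 2 := hmax hx
  have h2 := hM z ⟨hz, hzO⟩
  have h3 : δ * ‖z - 0‖ ^ 2 ≤ δ * R ^ 2 := mul_le_mul_of_nonneg_left (hsq z hz) hδ0.le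
  have h4 : δ * R ^ 2 ≤ ε := by
    rw [hδ, div_mul_eq_mul_div, div_le_iff₀ (by positivity)]
    nlinarith
  have h5 : 0 ≤ δ * ‖x - 0‖ ^ 2 := by positivity
  linarith

end Calculus

/-! ### The planar model functions Re z^(j+1/2) and their chains under the Laplacian. -/

section Planar

/-- The planar harmonic function `r^{j+1/2} cos ((j+1/2) θ)`. -/
noncomputable def slitHarmonic (j : ℕ) (z : ℂ) : ℝ :=
  ‖z‖ ^ j * Real.sqrt ‖z‖ * Real.cos ((j + 1 / 2) * Complex.arg z)

theorem slitHarmonic_eq_re (j : ℕ) {z : ℂ} (hz : z ≠ 0) :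
    slitHarmonic j z = (z ^ ((j : ℂ) + 1 / 2)).re := by
  have hr : 0 < ‖z‖ := norm_pos_iff.2 hz
  have h1 : ((j : ℂ) + 1 / 2) = (((j : ℝ) + 1 / 2 : ℝ) : ℂ) := by push_cast; rfl
  rw [Complex.cpow_def_of_ne_zero hz, h1, Complex.exp_re, Complex.re_mul_ofReal,
    Complex.im_mul_ofReal, Complex.log_re, Complex.log_im, slitHarmonic,
    ← Real.rpow_def_of_pos hr, Real.rpow_add hr, Real.rpow_natCast, Real.sqrt_eq_rpow, mul_comm (Complex.arg z)]

theorem arg_of_notMem_slitPlane {z : ℂ} (hz : z ∉ Complex.slitPlane) (h0 : z ≠ 0) :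
    Complex.arg z = Real.pi := by
  by_contra h
  exact hz (Complex.mem_slitPlane_iff_arg.2 ⟨h, h0⟩)

theorem slitHarmonic_eq_zero (j : ℕ) {z : ℂ} (hz : z ∉ Complex.slitPlane) :
    slitHarmonic j z = 0 := by
  rcases eq_or_ne z 0 with rfl | h0
  · simp [slitHarmonic]
  · rw [slitHarmonic, arg_of_notMem_slitPlane hz h0, add_mul, Real.cos_add]
    have : 1 / 2 * Real.pi = Real.pi / 2 := by ring
    rw [this, Real.cos_pi_div_two, Real.sin_nat_mul_pi]
    ring

theorem slitHarmonic_conj (j : ℕ) (z : ℂ) :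
    slitHarmonic j ((starRingEnd ℂ) z) = slitHarmonic j z := by
  by_cases h : Complex.arg z = Real.pi
  · simp [slitHarmonic, Complex.arg_conj, h]
  · simp [slitHarmonic, Complex.arg_conj, h]

theorem abs_slitHarmonic_le (j : ℕ) (z : ℂ) : |slitHarmonic j z| ≤ ‖z‖ ^ j * Real.sqrt ‖z‖ := by
  rw [slitHarmonic, abs_mul, abs_of_nonneg (by positivity)]
  exact mul_le_of_le_one_right (by positivity) (Real.abs_cos_le_one _)

theorem slitHarmonic_zero_eq (z : ℂ) :
    slitHarmonic 0 z = 1 / Real.sqrt 2 * Real.sqrt (z.re + ‖z‖) := by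
  have hd : ‖z‖ * Real.cos (Complex.arg z) = z.re := Complex.norm_mul_cos_arg z
  have hc : Real.cos (Complex.arg z / 2) = Real.sqrt ((1 + Real.cos (Complex.arg z)) / 2) :=
    Real.cos_half (Complex.neg_pi_lt_arg _).le (Complex.arg_le_pi _)
  have e : ((0 : ℕ) + 1 / 2 : ℝ) * Complex.arg z = Complex.arg z / 2 := by push_cast; ring
  rw [slitHarmonic, e, hc, pow_zero, one_mul, ← Real.sqrt_mul (norm_nonneg z), one_div,
    ← Real.sqrt_inv, ← Real.sqrt_mul (by norm_num)]
  congr 1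
  rw [← hd]
  ring

theorem slitHarmonic_zero_nonneg (z : ℂ) : 0 ≤ slitHarmonic 0 z := by
  rw [slitHarmonic_zero_eq]; positivity

theorem slitHarmonic_one_eq (z : ℂ) :
    slitHarmonic 1 z = (2 * z.re - ‖z‖) * slitHarmonic 0 z := by
  have hd : ‖z‖ * Real.cos (Complex.arg z) = z.re := Complex.norm_mul_cos_arg z
  set φ := Complex.arg z / 2 with hφ
  have e0 : ((0 : ℕ) + 1 / 2 : ℝ) * Complex.arg z = φ := by push_cast; ring
  have e1 : ((1 : ℕ) + 1 / 2 : ℝ) * Complex.arg z = 3 * φ := by push_cast; ring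
  have e2 : Complex.arg z = 2 * φ := by ring
  rw [slitHarmonic, slitHarmonic, e0, e1, ← hd, e2, Real.cos_three_mul, Real.cos_two_mul]
  ring

/-- This is cos(a + θ) + cos(a - θ) = 2 cos θ cos a with the powers of r restored. With the cases j
= 0 and 1 it shows that every `slitHarmonic j` is `slitHarmonic 0` times a polynomial in x_n and r.
-/
theorem slitHarmonic_add_two (j : ℕ) (z : ℂ) :
    slitHarmonic (j + 2) z =
      2 * z.re * slitHarmonic (j + 1) z - ‖z‖ ^ 2 * slitHarmonic j z := by
  have hd : ‖z‖ * Real.cos (Complex.arg z) = z.re := Complex.norm_mul_cos_arg z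
  set θ := Complex.arg z with hθ
  set a := ((j : ℝ) + 1 / 2) * θ with ha
  have e1 : (((j + 1 : ℕ) : ℝ) + 1 / 2) * θ = a + θ := by rw [ha]; push_cast; ring
  have e2 : (((j + 2 : ℕ) : ℝ) + 1 / 2) * θ = (a + θ) + θ := by rw [ha]; push_cast; ring
  have e3 : a = (a + θ) - θ := by ring
  simp only [slitHarmonic, ← hθ, e1, e2, ← hd]
  rw [← ha, e3, Real.cos_add, Real.cos_sub]
  ring_nf

/-- The argument jumps across the slit, so the definition does not show continuity. The recursion
reduces it to j = 0, where the square root formula is visibly continuous. -/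
theorem continuous_slitHarmonic (j : ℕ) : Continuous (slitHarmonic j) := by
  have h0 : Continuous (slitHarmonic 0) := by
    have : slitHarmonic 0 = fun z : ℂ => 1 / Real.sqrt 2 * Real.sqrt (z.re + ‖z‖) :=
      funext slitHarmonic_zero_eq
    rw [this]
    fun_prop
  induction j using Nat.strong_induction_on with
  | _ j ih =>
    match j, ih with
    | 0, _ => exact h0
    | 1, _ => rw [funext slitHarmonic_one_eq]; fun_prop
    | j + 2, ih =>
      have h1 := ih (j + 1) (by omega)
      have h2 := ih j (by omega)
      rw [funext (slitHarmonic_add_two j)]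
      fun_prop

/-- The double angle formula gives r sin θ = 2 √r · (√r cos(θ/2)) · sin(θ/2). The barrier needs this
to absorb its negative x_{n+1}² term into the U₀ term. -/
theorem abs_im_le (z : ℂ) : |z.im| ≤ 2 * Real.sqrt ‖z‖ * slitHarmonic 0 z := by
  have hd : ‖z‖ * Real.sin (Complex.arg z) = z.im := Complex.norm_mul_sin_arg z
  set φ := Complex.arg z / 2 with hφ
  have e0 : ((0 : ℕ) + 1 / 2 : ℝ) * Complex.arg z = φ := by push_cast; ring
  have e2 : Complex.arg z = 2 * φ := by ring
  have hp := slitHarmonic_zero_nonneg z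
  have hs : ‖z‖ = Real.sqrt ‖z‖ * Real.sqrt ‖z‖ := (Real.mul_self_sqrt (norm_nonneg z)).symm
  have h1 : z.im = 2 * Real.sqrt ‖z‖ * slitHarmonic 0 z * Real.sin φ := by
    rw [← hd, slitHarmonic, e0, e2, Real.sin_two_mul]
    nth_rewrite 1 [hs]
    ring
  rw [h1, abs_mul, abs_of_nonneg (by positivity)]
  exact mul_le_of_le_one_right (by positivity) (Real.abs_sin_le_one _)

theorem analyticAt_cpow_half (j : ℕ) {z : ℂ} (hz : z ∈ Complex.slitPlane) :
    AnalyticAt ℂ (fun z : ℂ => z ^ ((j : ℂ) + 1 / 2)) z :=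
  analyticAt_id.cpow analyticAt_const hz

theorem slitHarmonic_eventuallyEq (j : ℕ) {z : ℂ} (hz : z ∈ Complex.slitPlane) :
    slitHarmonic j =ᶠ[𝓝 z] fun z : ℂ => (z ^ ((j : ℂ) + 1 / 2)).re := by
  filter_upwards [Complex.isOpen_slitPlane.mem_nhds hz] with w hw
  exact slitHarmonic_eq_re j (Complex.slitPlane_ne_zero hw)

theorem harmonicAt_slitHarmonic (j : ℕ) {z : ℂ} (hz : z ∈ Complex.slitPlane) :
    HarmonicAt (slitHarmonic j) z :=
  (harmonicAt_congr_nhds (slitHarmonic_eventuallyEq j hz)).2 (analyticAt_cpow_half j hz).harmonicAt_re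

theorem contDiffAt_slitHarmonic (j : ℕ) {z : ℂ} (hz : z ∈ Complex.slitPlane) :
    ContDiffAt ℝ 2 (slitHarmonic j) z := (harmonicAt_slitHarmonic j hz).1

/-- Euler's identity for homogeneity j + 1/2, read off from z · d/dz z^a = a z^a. -/
theorem fderiv_slitHarmonic_self (j : ℕ) {z : ℂ} (hz : z ∈ Complex.slitPlane) :
    fderiv ℝ (slitHarmonic j) z z = (j + 1 / 2) * slitHarmonic j z := by
  have h0 := Complex.slitPlane_ne_zero hz
  have h1 : HasDerivAt (fun z : ℂ => z ^ ((j : ℂ) + 1 / 2))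
      (((j : ℂ) + 1 / 2) * z ^ ((j : ℂ) + 1 / 2 - 1) * 1) z :=
    (hasDerivAt_id z).cpow_const hz
  have h2 := (Complex.reCLM.hasFDerivAt.comp z (h1.hasFDerivAt.restrictScalars ℝ))
  rw [(slitHarmonic_eventuallyEq j hz).fderiv_eq, slitHarmonic_eq_re j h0]
  have h3 : fderiv ℝ (fun z : ℂ => (z ^ ((j : ℂ) + 1 / 2)).re) z = _ := h2.fderiv
  rw [h3]
  have h4 : z * (((j : ℂ) + 1 / 2) * z ^ ((j : ℂ) + 1 / 2 - 1)) =
      (((j : ℝ) + 1 / 2 : ℝ) : ℂ) * z ^ ((j : ℂ) + 1 / 2) := by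
    rw [Complex.cpow_sub _ _ h0, Complex.cpow_one]
    push_cast
    field_simp
  simp only [ContinuousLinearMap.comp_apply, ContinuousLinearMap.coe_restrictScalars',
    ContinuousLinearMap.toSpanSingleton_apply, smul_eq_mul, mul_one, Complex.reCLM_apply]
  rw [h4, Complex.re_ofReal_mul]

/-- Coefficients with which the functions `r^{2i} h_j` form a chain under `-Δ`. -/
noncomputable def chainCoeff (j : ℕ) : ℕ → ℝ
  | 0 => 1
  | i + 1 => -chainCoeff j i / (2 * (i + 1) * (2 * (i + 1) + 2 * j + 1))

/-- The chain of planar functions with `Δ (chain (i+1) j) = -chain i j` and `Δ (chain 0 j) = 0`. -/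
noncomputable def chain (i j : ℕ) (z : ℂ) : ℝ := chainCoeff j i * ((‖z‖ ^ 2) ^ i * slitHarmonic j z)

theorem contDiffAt_normSq_pow_mul (i j : ℕ) {z : ℂ} (hz : z ∈ Complex.slitPlane) :
    ContDiffAt ℝ 2 (fun z : ℂ => (‖z‖ ^ 2) ^ i * slitHarmonic j z) z :=
  ((contDiff_norm_sq ℝ).contDiffAt.pow i).mul (contDiffAt_slitHarmonic j hz)

theorem fderiv_normSq_pow_mul_self (i j : ℕ) {z : ℂ} (hz : z ∈ Complex.slitPlane) :
    fderiv ℝ (fun z : ℂ => (‖z‖ ^ 2) ^ i * slitHarmonic j z) z z =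
      (2 * i + j + 1 / 2) * ((‖z‖ ^ 2) ^ i * slitHarmonic j z) := by
  have hN : fderiv ℝ (fun z : ℂ => ‖z‖ ^ 2) z z = 2 * ‖z‖ ^ 2 := by
    simp
  have hd : ∀ i, DifferentiableAt ℝ (fun z : ℂ => (‖z‖ ^ 2) ^ i * slitHarmonic j z) z := fun i =>
    (contDiffAt_normSq_pow_mul i j hz).differentiableAt (by norm_num)
  have hNd : DifferentiableAt ℝ (fun z : ℂ => ‖z‖ ^ 2) z :=
    ((contDiff_norm_sq ℝ (n := 1)).differentiable (by norm_num)) z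
  induction i with
  | zero => simp [fderiv_slitHarmonic_self j hz]
  | succ i ih =>
    have e : (fun z : ℂ => (‖z‖ ^ 2) ^ (i + 1) * slitHarmonic j z) =
        fun z : ℂ => ‖z‖ ^ 2 * ((‖z‖ ^ 2) ^ i * slitHarmonic j z) := by
      ext w; ring
    rw [e, fderiv_fun_mul hNd (hd i)]
    simp only [add_apply, smul_apply, smul_eq_mul, hN, ih]
    push_cast
    ring

theorem sum_fderiv_normSq_mul (f : ℂ → ℝ) (z : ℂ) :
    ∑ i, fderiv ℝ (fun z : ℂ => ‖z‖ ^ 2) z (Complex.orthonormalBasisOneI i) *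
      fderiv ℝ f z (Complex.orthonormalBasisOneI i) = 2 * fderiv ℝ f z z := by
  have hz : z = z.re • (1 : ℂ) + z.im • Complex.I := by simp
  have h2 : fderiv ℝ f z z = z.re * fderiv ℝ f z 1 + z.im * fderiv ℝ f z Complex.I := by
    nth_rewrite 2 [hz]
    rw [map_add, map_smul, map_smul]; rfl
  simp [h2, Complex.inner]
  ring

/-- In polar coordinates Δ(r^a cos bθ) = (a² - b²) r^(a-2) cos bθ. With a = 2(i+1) + j + 1/2 and b =
j + 1/2 this is the constant shown. The proof peels off one factor |z|² at a time, the cross term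
being a radial derivative given by Euler's identity. -/
theorem laplacian_normSq_pow_mul (i j : ℕ) {z : ℂ} (hz : z ∈ Complex.slitPlane) :
    Δ (fun z : ℂ => (‖z‖ ^ 2) ^ (i + 1) * slitHarmonic j z) z =
      2 * (i + 1) * (2 * (i + 1) + 2 * j + 1) * ((‖z‖ ^ 2) ^ i * slitHarmonic j z) := by
  have hN : ContDiffAt ℝ 2 (fun z : ℂ => ‖z‖ ^ 2) z := (contDiff_norm_sq ℝ).contDiffAt
  have hΔN : Δ (fun z : ℂ => ‖z‖ ^ 2) z = 4 := by
    have := laplacian_norm_sub_sq z 0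
    simp only [sub_zero, Complex.finrank_real_complex] at this
    rw [this]; norm_num
  have key : ∀ i : ℕ, Δ (fun z : ℂ => (‖z‖ ^ 2) ^ (i + 1) * slitHarmonic j z) z =
      ‖z‖ ^ 2 * Δ (fun z : ℂ => (‖z‖ ^ 2) ^ i * slitHarmonic j z) z +
        4 * ((2 * i + j + 1 / 2) * ((‖z‖ ^ 2) ^ i * slitHarmonic j z)) +
        4 * ((‖z‖ ^ 2) ^ i * slitHarmonic j z) := fun i => by
    have e : (fun z : ℂ => (‖z‖ ^ 2) ^ (i + 1) * slitHarmonic j z) =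
        fun z : ℂ => ‖z‖ ^ 2 * ((‖z‖ ^ 2) ^ i * slitHarmonic j z) := by
      ext w; ring
    rw [e, laplacian_mul hN (contDiffAt_normSq_pow_mul i j hz) Complex.orthonormalBasisOneI,
      sum_fderiv_normSq_mul, fderiv_normSq_pow_mul_self i j hz, hΔN]
    ring
  induction i with
  | zero =>
    rw [key]
    have : Δ (slitHarmonic j) z = 0 := (harmonicAt_slitHarmonic j hz).2.self_of_nhds
    simp only [pow_zero, one_mul, this]
    push_cast
    ring
  | succ i ih =>
    rw [key, ih]
    push_cast
    ring

theorem contDiffAt_chain (i j : ℕ) {z : ℂ} (hz : z ∈ Complex.slitPlane) :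
    ContDiffAt ℝ 2 (chain i j) z := contDiffAt_const.mul (contDiffAt_normSq_pow_mul i j hz)

theorem laplacian_chain_zero (j : ℕ) {z : ℂ} (hz : z ∈ Complex.slitPlane) :
    Δ (chain 0 j) z = 0 := by
  have : chain 0 j = slitHarmonic j := by ext w; simp [chain, chainCoeff]
  rw [this]
  exact (harmonicAt_slitHarmonic j hz).2.self_of_nhds

theorem laplacian_chain_succ (i j : ℕ) {z : ℂ} (hz : z ∈ Complex.slitPlane) :
    Δ (chain (i + 1) j) z = -chain i j z := by
  have h := laplacian_const_mul (chainCoeff j (i + 1)) (contDiffAt_normSq_pow_mul (i + 1) j hz)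
  have e : chain (i + 1) j =
      fun z : ℂ => chainCoeff j (i + 1) * ((‖z‖ ^ 2) ^ (i + 1) * slitHarmonic j z) := rfl
  rw [e, h, laplacian_normSq_pow_mul i j hz, chain, chainCoeff]
  have : (2 * ((i : ℝ) + 1) * (2 * (i + 1) + 2 * j + 1)) ≠ 0 := by positivity
  field_simp

theorem continuous_chain (i j : ℕ) : Continuous (chain i j) := by
  have := continuous_slitHarmonic j
  unfold chain
  fun_prop

theorem chain_eq_zero (i j : ℕ) {z : ℂ} (hz : z ∉ Complex.slitPlane) : chain i j z = 0 := by
  simp [chain, slitHarmonic_eq_zero j hz]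

theorem chain_conj (i j : ℕ) (z : ℂ) : chain i j ((starRingEnd ℂ) z) = chain i j z := by
  simp [chain, slitHarmonic_conj]

theorem abs_chain_le (i j : ℕ) (z : ℂ) :
    |chain i j z| ≤ |chainCoeff j i| * (‖z‖ ^ (2 * i + j) * Real.sqrt ‖z‖) := by
  rw [chain, abs_mul, abs_mul, abs_of_nonneg (by positivity : (0 : ℝ) ≤ (‖z‖ ^ 2) ^ i), pow_add,
    pow_mul, mul_assoc]
  gcongr
  exact abs_slitHarmonic_le j z

end Planar

/-! ### Coordinates ℝ^m × ℂ, solutions vanishing on the slit, and the barrier giving the bound by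
U₀. -/

section Slit

/-- The ambient space `ℝ^m × ℝ²`. -/
abbrev Space (m : ℕ) := EuclideanSpace ℝ (Fin (m + 1 + 1))

variable {m : ℕ}

/-- The planar variable `x_n + i x_{n+1}`. -/
noncomputable def planar : Space m →L[ℝ] ℂ :=
  LinearMap.toContinuousLinearMap
    { toFun := fun X => ⟨signedDist X, height X⟩
      map_add' := fun X Y => by apply Complex.ext <;> simp [signedDist, height]
      map_smul' := fun c X => by apply Complex.ext <;> simp [signedDist, height] }

theorem planar_re (X : Space m) : (planar X).re = signedDist X := rfl
theorem planar_im (X : Space m) : (planar X).im = height X := rfl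

/-- The tangential unit vectors. -/
noncomputable def tangent (l : Fin m) : Space m := EuclideanSpace.single l.castSucc.castSucc 1

/-- The tangential coordinates. -/
noncomputable def tang : Space m →L[ℝ] (Fin m → ℝ) :=
  ContinuousLinearMap.pi fun l => EuclideanSpace.proj l.castSucc.castSucc

theorem tang_apply (X : Space m) (l : Fin m) : tang X l = X l.castSucc.castSucc := rfl

/-- The point with given tangential and planar coordinates. -/
noncomputable def point : (Fin m → ℝ) × ℂ →L[ℝ] Space m :=
  LinearMap.toContinuousLinearMap
    { toFun := fun p => WithLp.toLp 2
        (Fin.snoc (α := fun _ => ℝ) (Fin.snoc (α := fun _ => ℝ) p.1 p.2.re) p.2.im)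
      map_add' := fun p q => by
        ext i
        refine Fin.lastCases ?_ (fun i => ?_) i
        · simp
        · refine Fin.lastCases ?_ (fun i => ?_) i <;> simp
      map_smul' := fun c p => by
        ext i
        refine Fin.lastCases ?_ (fun i => ?_) i
        · simp
        · refine Fin.lastCases ?_ (fun i => ?_) i <;> simp }

theorem signedDist_eq (X : Space m) : signedDist X = X (Fin.last m).castSucc := rfl

theorem height_eq (X : Space m) : height X = X (Fin.last (m + 1)) := rfl

@[simp] theorem tang_point (p : (Fin m → ℝ) × ℂ) : tang (point p) = p.1 := by
  ext l; simp [tang_apply, point]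

@[simp] theorem planar_point (p : (Fin m → ℝ) × ℂ) : planar (point p) = p.2 := by
  apply Complex.ext <;> simp [point, planar_re, planar_im, signedDist_eq, height_eq]

theorem space_ext {X Y : Space m} (h1 : tang X = tang Y) (h2 : planar X = planar Y) : X = Y := by
  ext i
  refine Fin.lastCases ?_ (fun i => ?_) i
  · exact congrArg Complex.im h2
  · refine Fin.lastCases ?_ (fun i => ?_) i
    · exact congrArg Complex.re h2
    · exact congrFun h1 i

theorem norm_sq_eq (X : Space m) : ‖X‖ ^ 2 = ∑ l, tang X l ^ 2 + ‖planar X‖ ^ 2 := by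
  rw [EuclideanSpace.norm_sq_eq, Fin.sum_univ_castSucc, Fin.sum_univ_castSucc,
    ← Complex.normSq_eq_norm_sq, Complex.normSq_apply]
  simp [tang_apply, planar_re, planar_im, signedDist_eq, height_eq]
  ring

theorem norm_planar_le (X : Space m) : ‖planar X‖ ≤ ‖X‖ := by
  have h := norm_sq_eq X
  have : 0 ≤ ∑ l, tang X l ^ 2 := Finset.sum_nonneg fun _ _ => sq_nonneg _
  exact abs_le_of_sq_le_sq' (by linarith) (norm_nonneg _) |>.2

theorem abs_tang_le (X : Space m) (l : Fin m) : |tang X l| ≤ ‖X‖ := by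
  have := EuclideanSpace.norm_sq_eq X
  have h2 : ‖X l.castSucc.castSucc‖ ≤ ‖X‖ := PiLp.norm_apply_le X _
  simpa [tang_apply] using h2

@[simp] theorem planar_tangent (l : Fin m) : planar (tangent l) = 0 := by
  apply Complex.ext
  · simp only [planar_re, signedDist_eq, tangent, Complex.zero_re, PiLp.single_apply]
    rw [if_neg]
    intro h
    exact (Fin.castSucc_lt_last l).ne' (Fin.castSucc_injective _ h)
  · simp only [planar_im, height_eq, tangent, Complex.zero_im, PiLp.single_apply]
    rw [if_neg]
    exact (Fin.castSucc_lt_last _).ne'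

@[simp] theorem tang_tangent (l : Fin m) : tang (tangent l) = Pi.single l 1 := by
  ext i
  simp [tang_apply, tangent, Pi.single_apply]

theorem basisFun_tangent (l : Fin m) :
    EuclideanSpace.basisFun (Fin (m + 1 + 1)) ℝ l.castSucc.castSucc = tangent l := by
  simp [tangent]

theorem basisFun_signedDist :
    EuclideanSpace.basisFun (Fin (m + 1 + 1)) ℝ (Fin.last m).castSucc = point (0, 1) := by
  ext i
  refine Fin.lastCases ?_ (fun i => ?_) i
  · simp [point, Fin.ext_iff]
  · refine Fin.lastCases ?_ (fun i => ?_) i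
    · simp [point]
    · simp [point, Fin.ext_iff, i.2.ne]

theorem basisFun_height :
    EuclideanSpace.basisFun (Fin (m + 1 + 1)) ℝ (Fin.last (m + 1)) = point (0, Complex.I) := by
  ext i
  refine Fin.lastCases ?_ (fun i => ?_) i
  · simp [point]
  · refine Fin.lastCases ?_ (fun i => ?_) i
    · simp [point, Fin.ext_iff]
    · have := i.2
      simp [point, Fin.ext_iff]
      omega

theorem laplacian_space (f : Space m → ℝ) (X : Space m) :
    Δ f X = ∑ l, fderiv ℝ (fderiv ℝ f) X (tangent l) (tangent l) +
      fderiv ℝ (fderiv ℝ f) X (point (0, 1)) (point (0, 1)) +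
      fderiv ℝ (fderiv ℝ f) X (point (0, Complex.I)) (point (0, Complex.I)) := by
  rw [laplacian_eq_sum_fderiv f X (EuclideanSpace.basisFun _ ℝ), Fin.sum_univ_castSucc,
    Fin.sum_univ_castSucc]
  simp only [basisFun_tangent, basisFun_signedDist, basisFun_height]

theorem laplacian_complex (f : ℂ → ℝ) (z : ℂ) :
    Δ f z = fderiv ℝ (fderiv ℝ f) z 1 1 + fderiv ℝ (fderiv ℝ f) z Complex.I Complex.I := by
  rw [laplacian_eq_sum_fderiv f z Complex.orthonormalBasisOneI]
  simp

theorem fderiv_fderiv_comp {V W : Type*} [NormedAddCommGroup V] [InnerProductSpace ℝ V]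
    [FiniteDimensional ℝ V] [NormedAddCommGroup W] [InnerProductSpace ℝ W] [FiniteDimensional ℝ W]
    {f : W → ℝ} (L : V →L[ℝ] W) {x : V}
    (hf : ContDiffAt ℝ 2 f (L x)) (v : V) :
    fderiv ℝ (fderiv ℝ (fun y => f (L y))) x v v = fderiv ℝ (fderiv ℝ f) (L x) (L v) (L v) := by
  have hc : Tendsto (fun t : ℝ => L x + t • L v) (𝓝 0) (𝓝 (L x)) := by
    have : Continuous (fun t : ℝ => L x + t • L v) := by fun_prop
    simpa using this.tendsto 0
  refine fderiv_fderiv_eq_of_hasDerivAt (hf.comp x L.contDiff.contDiffAt)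
    (g := fun t => fderiv ℝ f (L x + t • L v) (L v)) ?_ (hasDerivAt_fderiv_line hf _ _)
  filter_upwards [hc.eventually hf.eventually_differentiableAt] with t ht
  simpa using hasDerivAt_line ht

theorem laplacian_comp_planar {f : ℂ → ℝ} {X : Space m} (hf : ContDiffAt ℝ 2 f (planar X)) :
    Δ (fun Y => f (planar Y)) X = Δ f (planar X) := by
  rw [laplacian_space, laplacian_complex]
  simp [fderiv_fderiv_comp planar hf]

theorem contDiffAt_comp_planar {f : ℂ → ℝ} {X : Space m} (hf : ContDiffAt ℝ 2 f (planar X)) :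
    ContDiffAt ℝ 2 (fun Y => f (planar Y)) X := hf.comp X planar.contDiff.contDiffAt

/-- The embedding of the plane orthogonal to the edge. -/
noncomputable def slice : ℂ →L[ℝ] Space m := point.comp (ContinuousLinearMap.inr ℝ (Fin m → ℝ) ℂ)

theorem slice_apply (z : ℂ) : (slice z : Space m) = point (0, z) := rfl

@[simp] theorem planar_slice (z : ℂ) : planar (slice z : Space m) = z := by simp [slice_apply]

@[simp] theorem tang_slice (z : ℂ) : tang (slice z : Space m) = 0 := by simp [slice_apply]

@[simp] theorem norm_slice (z : ℂ) : ‖(slice z : Space m)‖ = ‖z‖ := by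
  have := norm_sq_eq (slice z : Space m)
  simp only [planar_slice, tang_slice, Pi.zero_apply, ne_eq, OfNat.ofNat_ne_zero, not_false_eq_true,
    zero_pow, Finset.sum_const_zero, zero_add] at this
  exact (pow_left_inj₀ (norm_nonneg _) (norm_nonneg _) two_ne_zero).1 this

/-- For harmonic `f` the right side is minus the tangential Laplacian. This turns harmonicity in
space into a planar equation with a source. -/
theorem laplacian_comp_slice {f : Space m → ℝ} {z : ℂ} (hf : ContDiffAt ℝ 2 f (slice z)) :
    Δ (fun w => f (slice w)) z =
      Δ f (slice z) - ∑ l, fderiv ℝ (fderiv ℝ f) (slice z) (tangent l) (tangent l) := by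
  rw [laplacian_space, laplacian_complex]
  simp only [fderiv_fderiv_comp slice hf, ← slice_apply]
  ring

theorem planar_reflect (X : Space m) : planar (reflect X) = (starRingEnd ℂ) (planar X) := by
  apply Complex.ext
  · simp [reflect, planar_re, signedDist_eq, Fin.ext_iff]
  · simp [reflect, planar_im, height_eq]

theorem tang_reflect (X : Space m) : tang (reflect X) = tang X := by
  ext l
  simp only [tang_apply, reflect]
  rw [Function.update_of_ne (Fin.castSucc_lt_last _).ne]

theorem radius_eq (X : Space m) : radius X = ‖planar X‖ := by
  rw [Complex.norm_eq_sqrt_sq_add_sq, radius, add_comm]; rfl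

theorem U₀_eq_slitHarmonic (X : Space m) : U₀ X = slitHarmonic 0 (planar X) := by
  rw [slitHarmonic_zero_eq, U₀_eq, radius_eq]; rfl

theorem mem_slit_iff (X : Space m) :
    X ∈ slit (m + 1) ↔ X ∈ ball (0 : Space m) 1 ∧ planar X ∉ Complex.slitPlane := by
  rw [Complex.mem_slitPlane_iff]
  simp only [slit, mem_ofPred_eq, planar_re, planar_im]
  constructor
  · rintro ⟨h, h1, h2⟩
    exact ⟨h, by simp [h1, h2]⟩
  · rintro ⟨h, h1⟩
    push Not at h1
    exact ⟨h, h1.2, h1.1⟩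

/-- `u` is a solution in the ball of radius `R`: continuous, harmonic off the slit and zero on it. -/
structure IsSolution (R : ℝ) (u : Space m → ℝ) : Prop where
  cont : ContinuousOn u (ball 0 R)
  even : ∀ X ∈ ball (0 : Space m) R, u (reflect X) = u X
  harm : ∀ X ∈ ball (0 : Space m) R, planar X ∈ Complex.slitPlane → HarmonicAt u X
  zero : ∀ X ∈ ball (0 : Space m) R, planar X ∉ Complex.slitPlane → u X = 0

theorem IsSolution.mono {R R' : ℝ} {u : Space m → ℝ} (h : IsSolution R u) (hR : R' ≤ R) :
    IsSolution R' u where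
  cont := h.cont.mono (ball_subset_ball hR)
  even := fun X hX => h.even X (ball_subset_ball hR hX)
  harm := fun X hX => h.harm X (ball_subset_ball hR hX)
  zero := fun X hX => h.zero X (ball_subset_ball hR hX)

theorem IsSolution.sub {R : ℝ} {u v : Space m → ℝ} (hu : IsSolution R u) (hv : IsSolution R v) :
    IsSolution R (fun X => u X - v X) where
  cont := hu.cont.sub hv.cont
  even := fun X hX => by rw [hu.even X hX, hv.even X hX]
  harm := fun X hX h => (hu.harm X hX h).sub (hv.harm X hX h)
  zero := fun X hX h => by rw [hu.zero X hX h, hv.zero X hX h, sub_zero]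

theorem IsSolution.neg {R : ℝ} {u : Space m → ℝ} (hu : IsSolution R u) :
    IsSolution R (fun X => -u X) where
  cont := hu.cont.neg
  even := fun X hX => by rw [hu.even X hX]
  harm := fun X hX h => (hu.harm X hX h).neg
  zero := fun X hX h => by rw [hu.zero X hX h, neg_zero]

theorem isOpen_planar_slitPlane : IsOpen {X : Space m | planar X ∈ Complex.slitPlane} :=
  Complex.isOpen_slitPlane.preimage planar.continuous

/-- The barrier at scale `ρ` around the projection of `Y` to `{x_{n+1} = 0}`. -/
noncomputable def barrier (ρ : ℝ) (Y X : Space m) : ℝ :=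
  (‖X - point (tang Y, ((planar Y).re : ℂ))‖ ^ 2 - (m + 2) * (planar X).im ^ 2) / ρ ^ 2 +
    2 * (m + 2) / Real.sqrt ρ * slitHarmonic 0 (planar X)

theorem continuous_barrier (ρ : ℝ) (Y : Space m) : Continuous (barrier ρ Y) := by
  have h1 := (continuous_slitHarmonic 0).comp (planar (m := m)).continuous
  have h2 := Complex.continuous_im.comp (planar (m := m)).continuous
  simp only [Function.comp_def] at h1 h2
  unfold barrier
  fun_prop

theorem im_sq_laplacian (z : ℂ) : Δ (fun z : ℂ => z.im ^ 2) z = 2 := by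
  have hc : ContDiff ℝ 2 (fun z : ℂ => z.im ^ 2) := Complex.imCLM.contDiff.pow 2
  rw [laplacian_complex]
  have h1 : fderiv ℝ (fderiv ℝ (fun z : ℂ => z.im ^ 2)) z 1 1 = 0 :=
    fderiv_fderiv_eq_of_hasDerivAt hc.contDiffAt (g := fun _ => 0)
      (Eventually.of_forall fun t => by simpa using hasDerivAt_const t (z.im ^ 2))
      (hasDerivAt_const _ _)
  have h2 : fderiv ℝ (fderiv ℝ (fun z : ℂ => z.im ^ 2)) z Complex.I Complex.I = 2 := by
    refine fderiv_fderiv_eq_of_hasDerivAt hc.contDiffAt (g := fun t => 2 * (z.im + t))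
      (Eventually.of_forall fun t => ?_) ?_
    · have := ((hasDerivAt_id t).const_add z.im).fun_pow 2
      simpa using this
    · simpa using ((hasDerivAt_id (0 : ℝ)).const_add z.im).const_mul 2
  rw [h1, h2, zero_add]

theorem contDiffAt_barrier (ρ : ℝ) (Y : Space m) {X : Space m}
    (hX : planar X ∈ Complex.slitPlane) : ContDiffAt ℝ 2 (barrier ρ Y) X := by
  have h1 : ContDiffAt ℝ 2 (fun X : Space m => slitHarmonic 0 (planar X)) X :=
    contDiffAt_comp_planar (contDiffAt_slitHarmonic 0 hX)
  have h2 : ContDiffAt ℝ 2 (fun X : Space m => (planar X).im ^ 2) X :=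
    ((Complex.imCLM.contDiff.comp planar.contDiff).pow 2).contDiffAt
  have h3 := (contDiff_norm_sub_sq (point (tang Y, ((planar Y).re : ℂ))) 2).contDiffAt (x := X)
  exact ((h3.sub (contDiffAt_const.mul h2)).div_const _).add (contDiffAt_const.mul h1)

/-- Both |X - Y₀|² and (m + 2) x_{n+1}² have Laplacian 2(m + 2), since the dimension is m + 2, and
they cancel. The remaining term is a multiple of the harmonic function U₀. -/
theorem laplacian_barrier (ρ : ℝ) (Y : Space m) {X : Space m}
    (hX : planar X ∈ Complex.slitPlane) : Δ (barrier ρ Y) X = 0 := by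
  have h1 : ContDiffAt ℝ 2 (fun X : Space m => slitHarmonic 0 (planar X)) X :=
    contDiffAt_comp_planar (contDiffAt_slitHarmonic 0 hX)
  have h2' : ContDiffAt ℝ 2 (fun z : ℂ => z.im ^ 2) (planar X) :=
    (Complex.imCLM.contDiff.pow 2).contDiffAt
  have h2 : ContDiffAt ℝ 2 (fun X : Space m => (planar X).im ^ 2) X := contDiffAt_comp_planar h2'
  have h3 := (contDiff_norm_sub_sq (point (tang Y, ((planar Y).re : ℂ))) 2).contDiffAt (x := X)
  have e : barrier ρ Y = fun X => (ρ ^ 2)⁻¹ * (‖X - point (tang Y, ((planar Y).re : ℂ))‖ ^ 2 -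
      (m + 2) * (planar X).im ^ 2) + 2 * (m + 2) / Real.sqrt ρ * slitHarmonic 0 (planar X) := by
    ext Z; rw [barrier]; ring
  rw [e, laplacian_add' (contDiffAt_const.mul (h3.sub (contDiffAt_const.mul h2)))
    (contDiffAt_const.mul h1), laplacian_const_mul _ (h3.sub (contDiffAt_const.mul h2)),
    laplacian_sub' h3 (contDiffAt_const.mul h2), laplacian_const_mul _ h2,
    laplacian_const_mul _ h1, laplacian_norm_sub_sq,
    laplacian_comp_planar (contDiffAt_slitHarmonic 0 hX), laplacian_comp_planar h2',
    im_sq_laplacian, (harmonicAt_slitHarmonic 0 hX).2.self_of_nhds]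
  simp only [finrank_euclideanSpace, Fintype.card_fin, Pi.zero_apply]
  push_cast
  ring

theorem height_sq_le {ρ : ℝ} (hρ : 0 < ρ) {X : Space m} (hX : ‖X‖ ≤ ρ) :
    (planar X).im ^ 2 / ρ ^ 2 ≤ 2 / Real.sqrt ρ * slitHarmonic 0 (planar X) := by
  have h1 := abs_im_le (planar X)
  have h2 : |(planar X).im| ≤ ρ := (Complex.abs_im_le_norm _).trans ((norm_planar_le X).trans hX)
  have h3 : Real.sqrt ‖planar X‖ ≤ Real.sqrt ρ := Real.sqrt_le_sqrt ((norm_planar_le X).trans hX)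
  have h4 := slitHarmonic_zero_nonneg (planar X)
  have h5 : Real.sqrt ρ * Real.sqrt ρ = ρ := Real.mul_self_sqrt hρ.le
  have h6 : 0 < Real.sqrt ρ := Real.sqrt_pos.2 hρ
  have h7 : |(planar X).im| ≤ 2 * Real.sqrt ρ * slitHarmonic 0 (planar X) :=
    h1.trans (by gcongr)
  rw [div_le_iff₀ (by positivity)]
  calc (planar X).im ^ 2 = |(planar X).im| * |(planar X).im| := by rw [← sq, sq_abs]
    _ ≤ (2 * Real.sqrt ρ * slitHarmonic 0 (planar X)) * ρ := by gcongr
    _ = 2 / Real.sqrt ρ * slitHarmonic 0 (planar X) * ρ ^ 2 := by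
      have h8 : ρ ^ 2 = Real.sqrt ρ * Real.sqrt ρ * ρ := by rw [h5, sq]
      rw [h8]
      field_simp

/-- The U₀ term dominates the subtracted x_{n+1}² term. The barrier is therefore nonnegative and is
bounded below away from its centre. -/
theorem le_barrier {ρ : ℝ} (hρ : 0 < ρ) (Y : Space m) {X : Space m} (hX : ‖X‖ ≤ ρ) :
    ‖X - point (tang Y, ((planar Y).re : ℂ))‖ ^ 2 / ρ ^ 2 ≤ barrier ρ Y X := by
  have h := height_sq_le hρ hX
  have hm : (0 : ℝ) ≤ m + 2 := by positivity
  have h' := mul_le_mul_of_nonneg_left h hm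
  rw [barrier, sub_div]
  have e1 : (m + 2 : ℝ) * (planar X).im ^ 2 / ρ ^ 2 = (m + 2) * ((planar X).im ^ 2 / ρ ^ 2) := by ring
  have e2 : 2 * ((m : ℝ) + 2) / Real.sqrt ρ * slitHarmonic 0 (planar X) =
    (m + 2) * (2 / Real.sqrt ρ * slitHarmonic 0 (planar X)) := by ring
  rw [e1, e2]
  linarith

/-- The distance from `Y` to its projection is |y_{n+1}|, so the quadratic part at `Y` is (1 - (m +
2)) y_{n+1}² / ρ² ≤ 0 and only the U₀ term survives. -/
theorem barrier_self_le {ρ : ℝ} (hρ : 0 < ρ) (Y : Space m) :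
    barrier ρ Y Y ≤ 2 * (m + 2) / Real.sqrt ρ * slitHarmonic 0 (planar Y) := by
  have : ‖Y - point (tang Y, ((planar Y).re : ℂ))‖ ^ 2 = (planar Y).im ^ 2 := by
    rw [norm_sq_eq, ← Complex.normSq_eq_norm_sq, Complex.normSq_apply]
    simp [sq]
  rw [barrier, this, add_le_iff_nonpos_left]
  apply div_nonpos_of_nonpos_of_nonneg _ (by positivity)
  have : (0 : ℝ) ≤ m := by positivity
  nlinarith [sq_nonneg (planar Y).im]

theorem norm_projection_le (Y : Space m) : ‖point (tang Y, ((planar Y).re : ℂ))‖ ≤ ‖Y‖ := by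
  refine abs_le_of_sq_le_sq' ?_ (norm_nonneg _) |>.2
  rw [norm_sq_eq, norm_sq_eq Y]
  simp only [tang_point, planar_point, Complex.norm_real, Real.norm_eq_abs, sq_abs]
  have := Complex.abs_re_le_norm (planar Y)
  have h2 : (planar Y).re ^ 2 ≤ ‖planar Y‖ ^ 2 := by
    rw [← sq_abs]
    gcongr
  linarith

/-- A bounded solution is controlled by `U₀` in a smaller ball. -/
theorem IsSolution.le_U₀ {ρ M : ℝ} (hρ : 0 < ρ) {v : Space m → ℝ} (hv : IsSolution ρ v)
    (hM : ∀ X ∈ ball (0 : Space m) ρ, |v X| ≤ M) {Y : Space m} (hY : ‖Y‖ < ρ / 2) :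
    v Y ≤ 32 * (m + 2) * M / Real.sqrt ρ * U₀ Y := by
  set Y₀ : Space m := point (tang Y, ((planar Y).re : ℂ)) with hY₀
  have hY₀n : ‖Y₀‖ < ρ / 2 := (norm_projection_le Y).trans_lt hY
  have hM0 : 0 ≤ M := (abs_nonneg _).trans (hM 0 (by simpa using hρ))
  have hsub : ∀ X ∈ closedBall Y₀ (ρ / 4), ‖X‖ < ρ := fun X hX => by
    have h1 : ‖X - Y₀‖ ≤ ρ / 4 := by simpa [dist_eq_norm] using hX
    have h2 : ‖X‖ ≤ ‖X - Y₀‖ + ‖Y₀‖ := by simpa using norm_add_le (X - Y₀) Y₀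
    linarith
  have hmem : ∀ X ∈ closedBall Y₀ (ρ / 4), X ∈ ball (0 : Space m) ρ := fun X hX => by
    simpa using hsub X hX
  have hlow : ∀ X ∈ closedBall Y₀ (ρ / 4), ‖X - Y₀‖ ^ 2 / ρ ^ 2 ≤ barrier ρ Y X := fun X hX =>
    le_barrier hρ Y (hsub X hX).le
  have hb0 : ∀ {X : Space m}, planar X ∈ Complex.slitPlane → ContDiffAt ℝ 2 (barrier ρ Y) X :=
    contDiffAt_barrier ρ Y
  -- On the sphere of radius ρ/4 about `Y₀` the barrier is at least 1/16, so 16M times it dominates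
  -- `v`. On the slit `v` vanishes and the barrier is nonnegative. If `Y` is farther than ρ/4 from
  -- `Y₀`, the same lower bound applies at `Y` directly.
  have hfin : v Y ≤ 16 * M * barrier ρ Y Y := by
    by_cases hin : ‖Y - Y₀‖ ≤ ρ / 4
    · have key := le_of_laplacian_nonneg (isCompact_closedBall Y₀ (ρ / 4))
        (O := ball Y₀ (ρ / 4) ∩ {X | planar X ∈ Complex.slitPlane})
        (isOpen_ball.inter isOpen_planar_slitPlane)
        (inter_subset_left.trans ball_subset_closedBall)
        (w := fun X => v X - 16 * M * barrier ρ Y X) (M := 0)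
        ((hv.cont.mono hmem).sub (continuous_const.mul (continuous_barrier ρ Y)).continuousOn)
        (fun X hX => (hv.harm X (hmem X (ball_subset_closedBall hX.1)) hX.2).1.sub
          (contDiffAt_const.mul (hb0 hX.2)))
        (fun X hX => by
          have hh := hv.harm X (hmem X (ball_subset_closedBall hX.1)) hX.2
          rw [laplacian_sub' hh.1 (contDiffAt_const.mul (hb0 hX.2)), laplacian_const_mul _ (hb0 hX.2),
            laplacian_barrier ρ Y hX.2, hh.2.self_of_nhds]
          simp)
        (fun X hX => by
          obtain ⟨hX1, hX2⟩ := hX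
          have hlX := hlow X hX1
          by_cases hs : planar X ∈ Complex.slitPlane
          · have hd : ρ / 4 ≤ ‖X - Y₀‖ := by
              by_contra! h
              exact hX2 ⟨by simpa [dist_eq_norm] using h, hs⟩
            have h16 : 1 / 16 ≤ ‖X - Y₀‖ ^ 2 / ρ ^ 2 := by
              rw [le_div_iff₀ (by positivity)]
              nlinarith
            have := hM X (hmem X hX1)
            have := le_abs_self (v X)
            nlinarith
          · rw [hv.zero X (hmem X hX1) hs]
            have : 0 ≤ barrier ρ Y X := le_trans (by positivity) hlX
            have : 0 ≤ 16 * M * barrier ρ Y X := by positivity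
            linarith)
        Y (by simpa [dist_eq_norm] using hin)
      linarith
    · push Not at hin
      have h16 : 1 / 16 ≤ ‖Y - Y₀‖ ^ 2 / ρ ^ 2 := by
        rw [le_div_iff₀ (by positivity)]
        nlinarith
      have h2 := le_barrier hρ Y (X := Y) (by linarith)
      have := hM Y (by simp; linarith)
      have := le_abs_self (v Y)
      nlinarith
  refine hfin.trans ?_
  rw [U₀_eq_slitHarmonic]
  calc 16 * M * barrier ρ Y Y
      ≤ 16 * M * (2 * (m + 2) / Real.sqrt ρ * slitHarmonic 0 (planar Y)) := by
        gcongr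
        exact barrier_self_le hρ Y
    _ = _ := by ring

theorem IsSolution.abs_le_U₀ {ρ M : ℝ} (hρ : 0 < ρ) {v : Space m → ℝ} (hv : IsSolution ρ v)
    (hM : ∀ X ∈ ball (0 : Space m) ρ, |v X| ≤ M) {Y : Space m} (hY : ‖Y‖ < ρ / 2) :
    |v Y| ≤ 32 * (m + 2) * M / Real.sqrt ρ * U₀ Y := by
  refine abs_le'.2 ⟨hv.le_U₀ hρ hM hY, hv.neg.le_U₀ hρ (fun X hX => ?_) hY⟩
  rw [abs_neg]
  exact hM X hX

end Slit

/-! ### Bernstein's differential inequality for a cutoff times a harmonic function. -/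

section Bernstein

variable {V : Type*} [NormedAddCommGroup V] [InnerProductSpace ℝ V] [FiniteDimensional ℝ V]
variable {ι : Type*} [Fintype ι]

theorem laplacian_sq {f : V → ℝ} {x : V} (hf : ContDiffAt ℝ 2 f x) (b : OrthonormalBasis ι ℝ V) :
    Δ (fun y => f y * f y) x = 2 * ∑ i, fderiv ℝ f x (b i) ^ 2 + 2 * f x * Δ f x := by
  rw [laplacian_mul hf hf b]
  simp only [sq]
  ring

/-- Bernstein's computation: a lower bound for the Laplacian of `(ζ g)²` with
`ζ = R² - |x|²` and `g` harmonic. -/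
theorem le_laplacian_cutoff_mul_sq {g : V → ℝ} {x : V} {R : ℝ} (hg : HarmonicAt g x)
    (hx : ‖x‖ ≤ R) (b : OrthonormalBasis ι ℝ V) :
    -(24 + 4 * Module.finrank ℝ V) * R ^ 2 * g x ^ 2 ≤
      Δ (fun y => ((R ^ 2 - ‖y - 0‖ ^ 2) * g y) * ((R ^ 2 - ‖y - 0‖ ^ 2) * g y)) x := by
  set ζ : V → ℝ := fun y => R ^ 2 - ‖y - 0‖ ^ 2 with hζ
  have hN : ContDiffAt ℝ 2 (fun y : V => ‖y - 0‖ ^ 2) x := (contDiff_norm_sub_sq 0 2).contDiffAt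
  have hζc : ContDiffAt ℝ 2 ζ x := contDiffAt_const.sub hN
  have hgc := hg.1
  have hζΔ : Δ ζ x = -(2 * Module.finrank ℝ V) := by
    rw [hζ, laplacian_sub' contDiffAt_const hN, laplacian_norm_sub_sq]
    simp
  have ha : ∀ i, fderiv ℝ ζ x (b i) = -(2 * inner ℝ x (b i)) := fun i => by
    have h := fderiv_norm_sub_sq x 0 (b i)
    rw [hζ, fderiv_const_sub]
    simp only [sub_zero] at h ⊢
    rw [neg_apply, h]
  have hsum : ∑ i, fderiv ℝ ζ x (b i) ^ 2 = 4 * ‖x‖ ^ 2 := by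
    simp only [ha, neg_sq, mul_pow]
    rw [← Finset.mul_sum, ← b.sum_sq_inner_left x]
    norm_num
  have hy : ∀ i, fderiv ℝ (fun y => ζ y * g y) x (b i) =
      ζ x * fderiv ℝ g x (b i) + g x * fderiv ℝ ζ x (b i) := fun i => by
    rw [fderiv_fun_mul (hζc.differentiableAt (by norm_num)) (hgc.differentiableAt (by norm_num))]
    simp
  rw [laplacian_sq (hζc.mul hgc) b, laplacian_mul hζc hgc b, hζΔ, hg.2.self_of_nhds]
  simp only [hy, Pi.zero_apply]
  -- With a = ζ ∂_i g and b = g ∂_i ζ, the difference of the two summands is 2(a + b)² + 4ab + 6b² =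
  -- 2(a + 2b)². Summing 6b² gives the 24 of the statement, since |∇ζ|² = 4|x|².
  have hb : ∑ i, (-6 * g x ^ 2 * fderiv ℝ ζ x (b i) ^ 2) ≤
      ∑ i, (2 * (ζ x * fderiv ℝ g x (b i) + g x * fderiv ℝ ζ x (b i)) ^ 2 +
        4 * (ζ x * g x) * (fderiv ℝ ζ x (b i) * fderiv ℝ g x (b i))) := by
    refine Finset.sum_le_sum fun i _ => ?_
    nlinarith [sq_nonneg (ζ x * fderiv ℝ g x (b i) + 2 * g x * fderiv ℝ ζ x (b i))]
  rw [Finset.sum_add_distrib, ← Finset.mul_sum, ← Finset.mul_sum, ← Finset.mul_sum, hsum] at hb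
  have hxR : ‖x‖ ^ 2 ≤ R ^ 2 := pow_le_pow_left₀ (norm_nonneg _) hx 2
  have hζR : ζ x ≤ R ^ 2 := by simp only [hζ, sub_zero]; nlinarith [sq_nonneg ‖x‖]
  have hd : (0 : ℝ) ≤ Module.finrank ℝ V := Nat.cast_nonneg _
  have h1 : g x ^ 2 * ‖x‖ ^ 2 ≤ g x ^ 2 * R ^ 2 := by gcongr
  have h2 : g x ^ 2 * Module.finrank ℝ V * ζ x ≤ g x ^ 2 * Module.finrank ℝ V * R ^ 2 := by gcongr
  nlinarith

end Bernstein

/-! ### Gradient estimate in the tangential directions, up to the slit. -/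

section Slit

variable {m : ℕ}

/-- The tangential gradient estimate. -/
theorem IsSolution.abs_tangential_deriv_le {R R' M : ℝ} (hR : 0 < R) (hRR : R < R')
    {u g : Space m → ℝ} (hu : IsSolution R' u) (hg : IsSolution R' g) (l : Fin m)
    (hd : ∀ X ∈ ball (0 : Space m) R', planar X ∈ Complex.slitPlane →
      fderiv ℝ u X (tangent l) = g X)
    (hM : ∀ X ∈ ball (0 : Space m) R', |u X| ≤ M) {X : Space m} (hX : ‖X‖ ≤ R / 2) :
    |g X| ≤ 2 * (m + 8) * M / R := by
  have hM0 : 0 ≤ M := (abs_nonneg _).trans (hM 0 (by simp; linarith))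
  have hmem : ∀ X ∈ closedBall (0 : Space m) R, X ∈ ball (0 : Space m) R' :=
    fun X hX => closedBall_subset_ball hRR hX
  -- Since Δ(u²) = 2|∇u|² ≥ 2g², the term lam · u² contributes at least (4m + 32) R² g². This
  -- exactly offsets the loss (24 + 4(m + 2)) R² g² in Bernstein's inequality.
  set lam : ℝ := (2 * m + 16) * R ^ 2 with hlam
  have hlam0 : 0 ≤ lam := by positivity
  have hsqM : ∀ X ∈ closedBall (0 : Space m) R, u X * u X ≤ M ^ 2 := fun X hX => by
    rw [← sq, ← sq_abs]
    exact pow_le_pow_left₀ (abs_nonneg _) (hM X (hmem X hX)) 2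
  have hN : ∀ X : Space m, ContDiffAt ℝ 2 (fun y : Space m => R ^ 2 - ‖y - 0‖ ^ 2) X :=
    fun X => contDiffAt_const.sub (contDiff_norm_sub_sq 0 2).contDiffAt
  have hNc : Continuous (fun y : Space m => R ^ 2 - ‖y - 0‖ ^ 2) := by fun_prop
  have hgK := hg.cont.mono hmem
  have huK := hu.cont.mono hmem
  have key := le_of_laplacian_nonneg (isCompact_closedBall (0 : Space m) R)
    (O := ball 0 R ∩ {X | planar X ∈ Complex.slitPlane})
    (isOpen_ball.inter isOpen_planar_slitPlane)
    (inter_subset_left.trans ball_subset_closedBall)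
    (w := fun X => ((R ^ 2 - ‖X - 0‖ ^ 2) * g X) * ((R ^ 2 - ‖X - 0‖ ^ 2) * g X) +
      lam * (u X * u X)) (M := lam * M ^ 2)
    (((hNc.continuousOn.mul hgK).mul (hNc.continuousOn.mul hgK)).add
      (continuousOn_const.mul (huK.mul huK)))
    (fun X hX => by
      have h1 := (hg.harm X (hmem X (ball_subset_closedBall hX.1)) hX.2).1
      have h2 := (hu.harm X (hmem X (ball_subset_closedBall hX.1)) hX.2).1
      exact (((hN X).mul h1).mul ((hN X).mul h1)).add (contDiffAt_const.mul (h2.mul h2)))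
    (fun X hX => by
      have hXm := hmem X (ball_subset_closedBall hX.1)
      have h1 := hg.harm X hXm hX.2
      have h2 := hu.harm X hXm hX.2
      rw [laplacian_add' (((hN X).mul h1.1).mul ((hN X).mul h1.1))
        (contDiffAt_const.mul (h2.1.mul h2.1)), laplacian_const_mul _ (h2.1.mul h2.1),
        laplacian_sq h2.1 (EuclideanSpace.basisFun (Fin (m + 1 + 1)) ℝ), h2.2.self_of_nhds]
      have h3 := le_laplacian_cutoff_mul_sq (R := R) h1 (mem_ball_zero_iff.1 hX.1).le
        (EuclideanSpace.basisFun (Fin (m + 1 + 1)) ℝ)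
      have h4 : g X ^ 2 ≤ ∑ i, fderiv ℝ u X (EuclideanSpace.basisFun (Fin (m + 1 + 1)) ℝ i) ^ 2 := by
        rw [← hd X hXm hX.2, ← basisFun_tangent]
        exact Finset.single_le_sum (f := fun i => fderiv ℝ u X
          (EuclideanSpace.basisFun (Fin (m + 1 + 1)) ℝ i) ^ 2) (fun i _ => sq_nonneg _)
          (Finset.mem_univ _)
      have h5 := mul_le_mul_of_nonneg_left h4 hlam0
      simp only [finrank_euclideanSpace, Fintype.card_fin, Pi.zero_apply, mul_zero, add_zero] at h3 ⊢
      push_cast at h3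
      rw [hlam] at h5 ⊢
      nlinarith)
    (fun X hX => by
      obtain ⟨hX1, hX2⟩ := hX
      have h1 := hsqM X hX1
      -- The cutoff vanishes on the sphere. On the slit `g` vanishes because it is itself a
      -- solution, so no cutoff is needed there.
      have hz : (R ^ 2 - ‖X - 0‖ ^ 2) * g X = 0 := by
        by_cases hs : planar X ∈ Complex.slitPlane
        · have hd : ‖X‖ = R := by
            refine le_antisymm (by simpa using hX1) ?_
            by_contra! h
            exact hX2 ⟨by simpa using h, hs⟩
          simp [hd]
        · rw [hg.zero X (hmem X hX1) hs, mul_zero]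
      simp only [hz]
      nlinarith)
    X (by simp; linarith)
  have hz : 3 / 4 * R ^ 2 ≤ R ^ 2 - ‖X - 0‖ ^ 2 := by
    have := pow_le_pow_left₀ (norm_nonneg _) hX 2
    simp only [sub_zero]
    nlinarith
  have h1 : (3 / 4 * R ^ 2) ^ 2 * g X ^ 2 ≤ lam * M ^ 2 := by
    have h2 : (3 / 4 * R ^ 2) ^ 2 ≤ (R ^ 2 - ‖X - 0‖ ^ 2) ^ 2 :=
      pow_le_pow_left₀ (by positivity) hz 2
    have h3 := mul_le_mul_of_nonneg_right h2 (sq_nonneg (g X))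
    have h4 : 0 ≤ lam * (u X * u X) := mul_nonneg hlam0 (mul_self_nonneg _)
    nlinarith
  have h2 : R ^ 2 * g X ^ 2 ≤ (2 * (m + 8) * M) ^ 2 := by
    have h3 : R ^ 2 * (9 / 16 * R ^ 2 * g X ^ 2) ≤ R ^ 2 * ((2 * m + 16) * M ^ 2) := by
      rw [hlam] at h1; nlinarith
    have h4 := le_of_mul_le_mul_left h3 (by positivity)
    have h5 : (0 : ℝ) ≤ m := Nat.cast_nonneg m
    have h6 : (2 * (m : ℝ) + 16) * M ^ 2 ≤ 9 / 16 * (2 * (m + 8) * M) ^ 2 := by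
      have : (2 * (m : ℝ) + 16) ≤ 9 / 16 * (2 * (m + 8)) ^ 2 := by nlinarith
      nlinarith [sq_nonneg M]
    nlinarith
  rw [le_div_iff₀ hR]
  refine abs_le_of_sq_le_sq' (a := |g X| * R) ?_ (by positivity) |>.2
  rw [mul_pow, sq_abs]
  linarith

end Slit

/-! ### Density and orthogonality of cos((j + 1/2)θ) on [0, π]. -/

section HalfIntegerCosines

/-- The functions `φ ↦ cos ((2j+1) φ)`. -/
noncomputable def oddCos (j : ℕ) (φ : ℝ) : ℝ := Real.cos ((2 * j + 1) * φ)

/-- The product formula shifts the frequency 2j + 1 by ±2. For j = 0 the frequency -1 folds back to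
1 because cosine is even. -/
theorem cos_sq_mul_oddCos_mem (j : ℕ) :
    (fun φ => Real.cos φ ^ 2 * oddCos j φ) ∈ Submodule.span ℝ (range oddCos) := by
  have hmem : ∀ i, oddCos i ∈ Submodule.span ℝ (range oddCos) :=
    fun i => Submodule.subset_span ⟨i, rfl⟩
  have key : ∀ a φ : ℝ, Real.cos φ ^ 2 * Real.cos a =
      1 / 2 * Real.cos a + 1 / 4 * Real.cos (a + 2 * φ) + 1 / 4 * Real.cos (a - 2 * φ) := by
    intro a φ
    rw [Real.cos_add, Real.cos_sub, Real.cos_sq]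
    ring
  have hk : ∀ k : ℕ, (fun φ => Real.cos ((2 * j + 1) * φ - 2 * φ)) = oddCos k →
      (fun φ => Real.cos φ ^ 2 * oddCos j φ) ∈ Submodule.span ℝ (range oddCos) := by
    intro k hk
    have e : (fun φ => Real.cos φ ^ 2 * oddCos j φ) =
        (1 / 2 : ℝ) • oddCos j + (1 / 4 : ℝ) • oddCos (j + 1) + (1 / 4 : ℝ) • oddCos k := by
      rw [← hk]
      ext φ
      simp only [oddCos, Pi.add_apply, Pi.smul_apply, smul_eq_mul, key]
      have : (2 * ((j + 1 : ℕ) : ℝ) + 1) * φ = (2 * j + 1) * φ + 2 * φ := by push_cast; ring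
      rw [this]
    rw [e]
    exact add_mem (add_mem (Submodule.smul_mem _ _ (hmem _)) (Submodule.smul_mem _ _ (hmem _)))
      (Submodule.smul_mem _ _ (hmem _))
  rcases j with _ | j
  · refine hk 0 ?_
    ext φ
    rw [oddCos, ← Real.cos_neg]
    congr 1
    push_cast
    ring
  · refine hk j ?_
    ext φ
    rw [oddCos]
    congr 1
    push_cast
    ring

theorem cos_pow_odd_mem (i : ℕ) :
    (fun φ => Real.cos φ ^ (2 * i + 1)) ∈ Submodule.span ℝ (range oddCos) := by
  induction i with
  | zero =>
    have : (fun φ => Real.cos φ ^ (2 * 0 + 1)) = oddCos 0 := by ext φ; simp [oddCos]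
    rw [this]
    exact Submodule.subset_span ⟨0, rfl⟩
  | succ i ih =>
    have hm : ∀ g ∈ Submodule.span ℝ (range oddCos),
        (fun φ => Real.cos φ ^ 2 * g φ) ∈ Submodule.span ℝ (range oddCos) := by
      intro g hg
      induction hg using Submodule.span_induction with
      | mem x hx => obtain ⟨j, rfl⟩ := hx; exact cos_sq_mul_oddCos_mem j
      | zero =>
        have := Submodule.zero_mem (Submodule.span ℝ (range oddCos))
        convert this using 1
        ext φ; simp
      | add x y _ _ h1 h2 =>
        have := add_mem h1 h2
        convert this using 1
        ext φ; simp only [Pi.add_apply]; ring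
      | smul a x _ h1 =>
        have := Submodule.smul_mem _ a h1
        convert this using 1
        ext φ; simp only [Pi.smul_apply, smul_eq_mul]; ring
    have := hm _ ih
    convert this using 1
    ext φ; ring

/-- The difference is twice the odd part of `p`, and odd powers of the cosine are combinations of
odd-frequency cosines. -/
theorem eval_cos_sub_eval_neg_cos_mem (p : Polynomial ℝ) :
    (fun φ => p.eval (Real.cos φ) - p.eval (-Real.cos φ)) ∈ Submodule.span ℝ (range oddCos) := by
  induction p using Polynomial.induction_on' with
  | add p q hp hq =>
    have := add_mem hp hq
    convert this using 1
    ext φ; simp only [Polynomial.eval_add, Pi.add_apply]; ring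
  | monomial n a =>
    rcases Nat.even_or_odd n with hn | hn
    · have : (fun φ => (Polynomial.monomial n a).eval (Real.cos φ) -
          (Polynomial.monomial n a).eval (-Real.cos φ)) = 0 := by
        ext φ; simp [hn.neg_pow]
      rw [this]; exact Submodule.zero_mem _
    · obtain ⟨i, rfl⟩ := hn
      have := Submodule.smul_mem _ (2 * a) (cos_pow_odd_mem i)
      convert this using 1
      ext φ
      have ho : Odd (2 * i + 1) := ⟨i, rfl⟩
      simp only [Polynomial.eval_monomial, ho.neg_pow, Pi.smul_apply, smul_eq_mul]
      ring

/-- Functions on `[0, π]` vanishing at `π` are uniform limits of combinations of the functions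
`cos ((j+1/2) θ)`. -/
theorem exists_halfInteger_cos_approx {g : ℝ → ℝ} (hg : ContinuousOn g (Icc 0 Real.pi))
    (h0 : g Real.pi = 0) {ε : ℝ} (hε : 0 < ε) :
    ∃ (N : ℕ) (c : ℕ → ℝ), ∀ θ ∈ Icc 0 Real.pi,
      |g θ - ∑ j ∈ Finset.range N, c j * Real.cos ((j + 1 / 2) * θ)| ≤ ε := by
  -- This is `g` as a function of c = cos(θ/2), extended by zero to c ≤ 0, continuously because g(π)
  -- = 0. If `p` approximates Φ within ε/2 on [-1, 1], then p(c) - p(-c) approximates g(θ) - 0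
  -- within ε and is a combination of the required cosines.
  set Φ : ℝ → ℝ := fun c => g (2 * Real.arccos (max c 0)) with hΦ
  have hmaps : ∀ c : ℝ, 2 * Real.arccos (max c 0) ∈ Icc 0 Real.pi := fun c => by
    refine ⟨by have := Real.arccos_nonneg (max c 0); linarith, ?_⟩
    have : Real.arccos (max c 0) ≤ Real.arccos 0 := Real.antitone_arccos (le_max_right _ _)
    rw [Real.arccos_zero] at this
    linarith
  have hΦc : Continuous Φ := hg.comp_continuous
    (continuous_const.mul (Real.continuous_arccos.comp (continuous_id.max continuous_const))) hmaps
  have hΦneg : ∀ c ≤ 0, Φ c = 0 := fun c hc => by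
    simp only [hΦ, max_eq_right hc, Real.arccos_zero]
    rw [mul_div_cancel₀ _ (by norm_num : (2 : ℝ) ≠ 0), h0]
  obtain ⟨p, hp⟩ := exists_polynomial_near_of_continuousOn (-1) 1 Φ hΦc.continuousOn (ε / 2)
    (by linarith)
  obtain ⟨c, hc⟩ := Finsupp.mem_span_range_iff_exists_finsupp.1 (eval_cos_sub_eval_neg_cos_mem p)
  obtain ⟨N, hN⟩ := c.support.exists_nat_subset_range
  refine ⟨N, c, fun θ hθ => ?_⟩
  have hcos0 : 0 ≤ Real.cos (θ / 2) :=
    Real.cos_nonneg_of_neg_pi_div_two_le_of_le (by linarith [hθ.1, Real.pi_pos]) (by linarith [hθ.2])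
  have hcos1 := Real.cos_le_one (θ / 2)
  have hval : Φ (Real.cos (θ / 2)) = g θ := by
    simp only [hΦ, max_eq_left hcos0]
    rw [Real.arccos_cos (by linarith [hθ.1]) (by linarith [hθ.2, Real.pi_pos, hθ.1])]
    congr 1; ring
  have hval2 : Φ (-Real.cos (θ / 2)) = 0 := hΦneg _ (by linarith)
  have h1 := hp (Real.cos (θ / 2)) ⟨by linarith, hcos1⟩
  have h2 := hp (-Real.cos (θ / 2)) ⟨by linarith, by linarith⟩
  rw [hval] at h1
  rw [hval2] at h2
  have h3 := congrFun hc (θ / 2)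
  rw [Finsupp.sum_of_support_subset _ hN _ (by simp)] at h3
  simp only [Finset.sum_apply, Pi.smul_apply, smul_eq_mul] at h3
  have h4 : ∑ j ∈ Finset.range N, c j * Real.cos ((j + 1 / 2) * θ) =
      ∑ j ∈ Finset.range N, c j * oddCos j (θ / 2) := by
    refine Finset.sum_congr rfl fun j _ => ?_
    rw [oddCos]
    congr 2; ring
  rw [h4, h3]
  rw [abs_lt] at h1 h2
  rw [abs_le]
  constructor <;> linarith

theorem integral_cos_int_mul {k : ℤ} (hk : k ≠ 0) : ∫ θ in (0 : ℝ)..Real.pi, Real.cos (k * θ) = 0 := by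
  have hk' : (k : ℝ) ≠ 0 := by exact_mod_cast hk
  rw [intervalIntegral.integral_comp_mul_left _ hk', integral_cos]
  simp [Real.sin_int_mul_pi]

theorem integral_halfInteger_cos_mul (i j : ℕ) :
    ∫ θ in (0 : ℝ)..Real.pi, Real.cos ((i + 1 / 2) * θ) * Real.cos ((j + 1 / 2) * θ) =
      if i = j then Real.pi / 2 else 0 := by
  have e : ∀ θ : ℝ, Real.cos ((i + 1 / 2) * θ) * Real.cos ((j + 1 / 2) * θ) =
      1 / 2 * (Real.cos (((i - j : ℤ) : ℝ) * θ) + Real.cos (((i + j + 1 : ℤ) : ℝ) * θ)) := by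
    intro θ
    have e1 : (((i : ℤ) - j : ℤ) : ℝ) * θ = (i + 1 / 2) * θ - (j + 1 / 2) * θ := by push_cast; ring
    have e2 : (((i : ℤ) + j + 1 : ℤ) : ℝ) * θ = (i + 1 / 2) * θ + (j + 1 / 2) * θ := by
      push_cast; ring
    rw [e1, e2, Real.cos_add, Real.cos_sub]
    ring
  have hint : ∀ k : ℤ, IntervalIntegrable (fun θ : ℝ => Real.cos (k * θ)) MeasureTheory.volume 0
      Real.pi := fun k => (by fun_prop : Continuous fun θ : ℝ => Real.cos (k * θ)).intervalIntegrable _ _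
  simp only [e]
  rw [intervalIntegral.integral_const_mul, intervalIntegral.integral_add (hint _) (hint _),
    integral_cos_int_mul (k := (i : ℤ) + j + 1) (by positivity)]
  split_ifs with h
  · subst h; simp; ring
  · rw [integral_cos_int_mul (by omega)]; simp

/-- Pair the sum with the i-th cosine: orthogonality leaves c_i π/2, and the integral is at most πB.
The bound depends neither on the number of terms nor on `i`. -/
theorem abs_coeff_le_of_halfInteger_cos_sum_le {N : ℕ} {c : ℕ → ℝ} {B : ℝ}
    (hB : ∀ θ ∈ Icc 0 Real.pi, |∑ j ∈ Finset.range N, c j * Real.cos ((j + 1 / 2) * θ)| ≤ B)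
    {i : ℕ} (hi : i < N) : |c i| ≤ 2 * B := by
  have hint : ∀ j : ℕ, IntervalIntegrable (fun θ : ℝ => c j * (Real.cos ((j + 1 / 2) * θ) *
      Real.cos ((i + 1 / 2) * θ))) MeasureTheory.volume 0 Real.pi := fun j =>
    (by fun_prop : Continuous fun θ : ℝ => c j * (Real.cos ((j + 1 / 2) * θ) *
      Real.cos ((i + 1 / 2) * θ))).intervalIntegrable _ _
  have h1 : ∫ θ in (0 : ℝ)..Real.pi, (∑ j ∈ Finset.range N, c j * Real.cos ((j + 1 / 2) * θ)) *
      Real.cos ((i + 1 / 2) * θ) = c i * (Real.pi / 2) := by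
    simp only [Finset.sum_mul, mul_assoc]
    rw [intervalIntegral.integral_finsetSum fun j _ => hint j]
    simp only [intervalIntegral.integral_const_mul, integral_halfInteger_cos_mul]
    simp [hi]
  have h2 := intervalIntegral.norm_integral_le_of_norm_le_const (a := 0) (b := Real.pi) (C := B)
    (f := fun θ => (∑ j ∈ Finset.range N, c j * Real.cos ((j + 1 / 2) * θ)) *
      Real.cos ((i + 1 / 2) * θ)) (fun θ hθ => by
      rw [uIoc_of_le Real.pi_pos.le] at hθ
      rw [norm_mul]
      have h3 := hB θ ⟨hθ.1.le, hθ.2⟩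
      exact (mul_le_of_le_one_right (norm_nonneg _) (Real.abs_cos_le_one _)).trans h3)
  rw [h1, sub_zero, abs_of_pos Real.pi_pos, Real.norm_eq_abs, abs_mul,
    abs_of_pos (by linarith [Real.pi_pos] : 0 < Real.pi / 2)] at h2
  have := Real.pi_pos
  nlinarith

end HalfIntegerCosines

/-! ### Planar approximation when the Laplacian is small. -/

section Planar

theorem slitHarmonic_eq_abs_arg (j : ℕ) (z : ℂ) :
    slitHarmonic j z = ‖z‖ ^ j * Real.sqrt ‖z‖ * Real.cos ((j + 1 / 2) * |Complex.arg z|) := by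
  rw [slitHarmonic]
  rcases abs_choice (Complex.arg z) with h | h
  · rw [h]
  · rw [h, mul_neg, Real.cos_neg]

theorem eq_of_conj_invariant {f : ℂ → ℝ} {z : ℂ} (h : f ((starRingEnd ℂ) z) = f z) :
    f z = f (‖z‖ * Complex.exp (|Complex.arg z| * Complex.I)) := by
  rcases abs_choice (Complex.arg z) with h1 | h1
  · rw [h1, Complex.norm_mul_exp_arg_mul_I]
  · rw [h1, ← h]
    congr 1
    nth_rewrite 1 [← Complex.norm_mul_exp_arg_mul_I z]
    rw [map_mul, Complex.conj_ofReal, ← Complex.exp_conj, map_mul, Complex.conj_ofReal,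
      Complex.conj_I]
    push_cast
    ring_nf

/-- Adding K|z|², whose Laplacian is 4K, gives a subsolution; the maximum principle then costs at
most Kρ². -/
theorem le_of_neg_le_laplacian {ρ K ε : ℝ} {f : ℂ → ℝ}
    (hf : ContinuousOn f (closedBall 0 ρ))
    (hzero : ∀ z ∈ closedBall (0 : ℂ) ρ, z ∉ Complex.slitPlane → f z = 0)
    (hd : ∀ z ∈ ball (0 : ℂ) ρ, z ∈ Complex.slitPlane → ContDiffAt ℝ 2 f z ∧ -K ≤ Δ f z)
    (hK : 0 ≤ K) (hε0 : 0 ≤ ε)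
    (hε : ∀ z ∈ sphere (0 : ℂ) ρ, f z ≤ ε) : ∀ z ∈ closedBall (0 : ℂ) ρ, f z ≤ ε + K * ρ ^ 2 := by
  intro z hz
  have hN : ∀ z : ℂ, ContDiffAt ℝ 2 (fun y : ℂ => ‖y - 0‖ ^ 2) z :=
    fun z => (contDiff_norm_sub_sq 0 2).contDiffAt
  have hNle : ∀ z ∈ closedBall (0 : ℂ) ρ, ‖z - 0‖ ^ 2 ≤ ρ ^ 2 := fun z hz =>
    pow_le_pow_left₀ (norm_nonneg _) (by simpa using hz) 2
  have key := le_of_laplacian_nonneg (isCompact_closedBall (0 : ℂ) ρ)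
    (O := ball 0 ρ ∩ Complex.slitPlane) (isOpen_ball.inter Complex.isOpen_slitPlane)
    (inter_subset_left.trans ball_subset_closedBall)
    (w := fun z => f z + K * ‖z - 0‖ ^ 2) (M := ε + K * ρ ^ 2)
    (hf.add (by fun_prop))
    (fun z hz => (hd z hz.1 hz.2).1.add (contDiffAt_const.mul (hN z)))
    (fun z hz => by
      obtain ⟨h1, h2⟩ := hd z hz.1 hz.2
      rw [laplacian_add' h1 (contDiffAt_const.mul (hN z)), laplacian_const_mul _ (hN z),
        laplacian_norm_sub_sq, Complex.finrank_real_complex]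
      push_cast
      linarith)
    (fun z hz => by
      obtain ⟨hz1, hz2⟩ := hz
      have h1 := mul_le_mul_of_nonneg_left (hNle z hz1) hK
      by_cases hs : z ∈ Complex.slitPlane
      · have : z ∈ sphere (0 : ℂ) ρ := by
          rw [mem_sphere]
          refine le_antisymm hz1 ?_
          by_contra! h
          exact hz2 ⟨h, hs⟩
        have := hε z this
        linarith
      · rw [hzero z hz1 hs]; linarith)
    z hz
  have : 0 ≤ K * ‖z - 0‖ ^ 2 := by positivity
  linarith

/-- Approximation of a function with small Laplacian by planar harmonic functions. -/
theorem exists_slitHarmonic_sum_near {ρ K M : ℝ} (hρ : 0 < ρ) (hK : 0 < K) {f : ℂ → ℝ}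
    (hf : ContinuousOn f (closedBall 0 ρ))
    (heven : ∀ z ∈ closedBall (0 : ℂ) ρ, f ((starRingEnd ℂ) z) = f z)
    (hzero : ∀ z ∈ closedBall (0 : ℂ) ρ, z ∉ Complex.slitPlane → f z = 0)
    (hd : ∀ z ∈ ball (0 : ℂ) ρ, z ∈ Complex.slitPlane → ContDiffAt ℝ 2 f z ∧ |Δ f z| ≤ K)
    (hM : ∀ z ∈ closedBall (0 : ℂ) ρ, |f z| ≤ M) :
    ∃ (N : ℕ) (c : ℕ → ℝ), (∀ j < N, |c j| * (ρ ^ j * Real.sqrt ρ) ≤ 2 * (M + K * ρ ^ 2)) ∧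
      ∀ z ∈ closedBall (0 : ℂ) ρ,
        |f z - ∑ j ∈ Finset.range N, c j * slitHarmonic j z| ≤ 2 * (K * ρ ^ 2) := by
  have hcirc : ∀ θ : ℝ, (ρ * Complex.exp (θ * Complex.I) : ℂ) ∈ closedBall (0 : ℂ) ρ := fun θ => by
    simp [Complex.norm_exp_ofReal_mul_I, abs_of_pos hρ]
  set g : ℝ → ℝ := fun θ => f (ρ * Complex.exp (θ * Complex.I)) with hg
  have hgc : Continuous g := hf.comp_continuous (by fun_prop) hcirc
  have hg0 : g Real.pi = 0 := by
    refine hzero _ (hcirc _) ?_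
    rw [Complex.exp_pi_mul_I, Complex.mem_slitPlane_iff]
    simp [hρ.le]
  have hε : 0 < K * ρ ^ 2 := by positivity
  -- The boundary values on the circle are matched within Kρ², the same size as the error the
  -- Laplacian causes inside. Together they make 2Kρ². Conjugation symmetry makes θ ∈ [0, π]
  -- sufficient.
  obtain ⟨N, a, ha⟩ := exists_halfInteger_cos_approx hgc.continuousOn hg0 hε
  have hs0 : 0 < Real.sqrt ρ := Real.sqrt_pos.2 hρ
  have hca : ∀ j, a j / (ρ ^ j * Real.sqrt ρ) * (ρ ^ j * Real.sqrt ρ) = a j := fun j =>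
    div_mul_cancel₀ _ (by positivity)
  refine ⟨N, fun j => a j / (ρ ^ j * Real.sqrt ρ), fun j hj => ?_, ?_⟩
  · have h1 : |a j| ≤ 2 * (M + K * ρ ^ 2) := by
      refine abs_coeff_le_of_halfInteger_cos_sum_le (fun θ hθ => ?_) hj
      have h2 := ha θ hθ
      have h3 : |g θ| ≤ M := hM _ (hcirc θ)
      rw [abs_le] at h2 h3 ⊢
      constructor <;> linarith
    have h2 := congrArg abs (hca j)
    rw [abs_mul, abs_of_pos (by positivity : 0 < ρ ^ j * Real.sqrt ρ)] at h2
    rw [h2]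
    exact h1
  · set H : ℂ → ℝ := fun z => ∑ j ∈ Finset.range N, a j / (ρ ^ j * Real.sqrt ρ) * slitHarmonic j z
      with hH
    have hHc : Continuous H := by
      refine continuous_finsetSum _ fun j _ => ?_
      exact continuous_const.mul (continuous_slitHarmonic j)
    have hH0 : ∀ z ∉ Complex.slitPlane, H z = 0 := fun z hz => by
      simp [hH, slitHarmonic_eq_zero _ hz]
    have hHd : ∀ z ∈ Complex.slitPlane, ContDiffAt ℝ 2 H z := fun z hz =>
      ContDiffAt.sum fun j _ => contDiffAt_const.mul (contDiffAt_slitHarmonic j hz)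
    have hHΔ : ∀ z ∈ Complex.slitPlane, Δ H z = 0 := fun z hz => by
      rw [hH, laplacian_finset_sum _ fun j _ => contDiffAt_const.mul (contDiffAt_slitHarmonic j hz)]
      refine Finset.sum_eq_zero fun j _ => ?_
      rw [laplacian_const_mul _ (contDiffAt_slitHarmonic j hz),
        (harmonicAt_slitHarmonic j hz).2.self_of_nhds, Pi.zero_apply, mul_zero]
    have hsph : ∀ z ∈ sphere (0 : ℂ) ρ, |f z - H z| ≤ K * ρ ^ 2 := by
      intro z hz
      have hzn : ‖z‖ = ρ := by simpa using hz
      have h1 := ha |Complex.arg z| ⟨abs_nonneg _, Complex.abs_arg_le_pi z⟩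
      have h2 : f z = g |Complex.arg z| := by
        rw [eq_of_conj_invariant (heven z (sphere_subset_closedBall hz)), hg, hzn]
      have h3 : H z = ∑ j ∈ Finset.range N, a j * Real.cos ((j + 1 / 2) * |Complex.arg z|) := by
        refine Finset.sum_congr rfl fun j _ => ?_
        rw [slitHarmonic_eq_abs_arg, hzn, ← mul_assoc, hca]
      rw [h2, h3]
      exact h1
    intro z hz
    rw [abs_le']
    constructor
    · have := le_of_neg_le_laplacian (f := fun z => f z - H z) (hf.sub hHc.continuousOn)
        (fun z hz hs => by rw [hzero z hz hs, hH0 z hs, sub_zero])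
        (fun z hz hs => by
          obtain ⟨h1, h2⟩ := hd z hz hs
          refine ⟨h1.sub (hHd z hs), ?_⟩
          rw [laplacian_sub' h1 (hHd z hs), hHΔ z hs, sub_zero]
          exact (abs_le.1 h2).1) hK.le hε.le (fun z hz => (abs_le.1 (hsph z hz)).2) z hz
      linarith
    · have := le_of_neg_le_laplacian (f := fun z => H z - f z) (hHc.continuousOn.sub hf)
        (fun z hz hs => by rw [hzero z hz hs, hH0 z hs, sub_zero])
        (fun z hz hs => by
          obtain ⟨h1, h2⟩ := hd z hz hs
          refine ⟨(hHd z hs).sub h1, ?_⟩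
          rw [laplacian_sub' (hHd z hs) h1, hHΔ z hs, zero_sub]
          exact neg_le_neg (abs_le.1 h2).2) hK.le hε.le
        (fun z hz => by linarith [(abs_le.1 (hsph z hz)).1]) z hz
      linarith

end Planar

/-! ### Planar expansion of bounded degree by iteration over geometric scales. -/

section Planar

/-- One step of the approximation by planar harmonic functions of bounded degree. -/
theorem exists_slitHarmonic_sum_near_half (J : ℕ) {ρ K M : ℝ} (hρ : 0 < ρ) (hK : 0 < K)
    {f : ℂ → ℝ} (hf : ContinuousOn f (closedBall 0 ρ))
    (heven : ∀ z ∈ closedBall (0 : ℂ) ρ, f ((starRingEnd ℂ) z) = f z)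
    (hzero : ∀ z ∈ closedBall (0 : ℂ) ρ, z ∉ Complex.slitPlane → f z = 0)
    (hd : ∀ z ∈ ball (0 : ℂ) ρ, z ∈ Complex.slitPlane → ContDiffAt ℝ 2 f z ∧ |Δ f z| ≤ K)
    (hM : ∀ z ∈ closedBall (0 : ℂ) ρ, |f z| ≤ M) :
    ∃ c : ℕ → ℝ, (∀ j, |c j| * (ρ ^ j * Real.sqrt ρ) ≤ 2 * (M + K * ρ ^ 2)) ∧
      ∀ z : ℂ, ‖z‖ ≤ ρ / 2 → |f z - ∑ j ∈ Finset.range J, c j * slitHarmonic j z| ≤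
        6 * (K * ρ ^ 2) + 4 * M * ((‖z‖ / ρ) ^ J * Real.sqrt (‖z‖ / ρ)) := by
  obtain ⟨N, a, ha, hfa⟩ := exists_slitHarmonic_sum_near hρ hK hf heven hzero hd hM
  have hM0 : 0 ≤ M := (abs_nonneg _).trans (hM 0 (by simpa using hρ.le))
  set D := 2 * (M + K * ρ ^ 2) with hD
  have hD0 : 0 ≤ D := by positivity
  set c : ℕ → ℝ := fun j => if j < N then a j else 0 with hc
  have hcD : ∀ j, |c j| * (ρ ^ j * Real.sqrt ρ) ≤ D := fun j => by
    by_cases h : j < N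
    · simpa [hc, h] using ha j h
    · simpa [hc, h] using hD0
  refine ⟨c, hcD, fun z hz => ?_⟩
  have hzρ : z ∈ closedBall (0 : ℂ) ρ := by
    rw [mem_closedBall_zero_iff]; linarith
  have h1 := hfa z hzρ
  set t := ‖z‖ / ρ with ht
  have ht0 : 0 ≤ t := by positivity
  have ht2 : t ≤ 1 / 2 := by rw [ht, div_le_iff₀ hρ]; linarith
  have hzt : ‖z‖ = t * ρ := by rw [ht, div_mul_cancel₀ _ hρ.ne']
  have hterm : ∀ j, |c j * slitHarmonic j z| ≤ D * (t ^ j * Real.sqrt t) := fun j => by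
    rw [abs_mul]
    calc |c j| * |slitHarmonic j z| ≤ |c j| * (‖z‖ ^ j * Real.sqrt ‖z‖) := by
          gcongr; exact abs_slitHarmonic_le j z
      _ = |c j| * (ρ ^ j * Real.sqrt ρ) * (t ^ j * Real.sqrt t) := by
          rw [hzt, mul_pow, Real.sqrt_mul ht0]; ring
      _ ≤ D * (t ^ j * Real.sqrt t) := by gcongr; exact hcD j
  -- Padding the coefficients with zeros beyond `N` lets the sum run to J + N, so it splits at `J`
  -- whichever of the two is larger. The tail is geometric with ratio at most 1/2.
  have hsum : ∑ j ∈ Finset.range N, a j * slitHarmonic j z =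
      ∑ j ∈ Finset.range (J + N), c j * slitHarmonic j z := by
    have h2 : ∑ j ∈ Finset.range N, a j * slitHarmonic j z =
        ∑ j ∈ Finset.range N, c j * slitHarmonic j z :=
      Finset.sum_congr rfl fun j hj => by simp [hc, Finset.mem_range.1 hj]
    rw [h2]
    refine Finset.sum_subset (by simp) fun j _ hj => ?_
    have : ¬ j < N := by simpa using hj
    simp [hc, this]
  have htail : |∑ j ∈ Finset.range N, c (J + j) * slitHarmonic (J + j) z| ≤
      2 * D * (t ^ J * Real.sqrt t) := by
    calc |∑ j ∈ Finset.range N, c (J + j) * slitHarmonic (J + j) z|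
        ≤ ∑ j ∈ Finset.range N, D * (t ^ J * Real.sqrt t) * (1 / 2) ^ j := by
          refine (Finset.abs_sum_le_sum_abs _ _).trans (Finset.sum_le_sum fun j _ => ?_)
          refine (hterm (J + j)).trans ?_
          rw [pow_add]
          have : t ^ j ≤ (1 / 2) ^ j := pow_le_pow_left₀ ht0 ht2 j
          calc D * (t ^ J * t ^ j * Real.sqrt t) = D * (t ^ J * Real.sqrt t) * t ^ j := by ring
            _ ≤ _ := by gcongr
      _ = D * (t ^ J * Real.sqrt t) * ∑ j ∈ Finset.range N, (1 / 2 : ℝ) ^ j := by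
          rw [Finset.mul_sum]
      _ ≤ D * (t ^ J * Real.sqrt t) * 2 := by gcongr; exact sum_geometric_two_le N
      _ = _ := by ring
  have ht1 : t ^ J * Real.sqrt t ≤ 1 := by
    have h2 : t ^ J ≤ 1 := pow_le_one₀ ht0 (by linarith)
    have h3 : Real.sqrt t ≤ 1 := Real.sqrt_le_one.2 (by linarith)
    exact mul_le_one₀ h2 (Real.sqrt_nonneg _) h3
  have h5 : 2 * D * (t ^ J * Real.sqrt t) ≤ 4 * M * (t ^ J * Real.sqrt t) + 4 * (K * ρ ^ 2) := by
    have : K * ρ ^ 2 * (t ^ J * Real.sqrt t) ≤ K * ρ ^ 2 := mul_le_of_le_one_right (by positivity) ht1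
    rw [hD]
    linarith
  rw [hsum, Finset.sum_range_add] at h1
  rw [abs_le] at h1 htail ⊢
  constructor <;> linarith

/-- A function whose Laplacian is `O(|z|^s)` has an expansion in planar harmonic functions up to
order `|z|^(s+2)`. -/
theorem exists_slitHarmonic_expansion (s : ℕ) {R : ℝ} (hR : 0 < R) (hR1 : R ≤ 1) :
    ∃ C : ℝ, 0 ≤ C ∧ ∀ A : ℝ, 0 < A → ∀ f : ℂ → ℝ, ContinuousOn f (closedBall 0 R) →
      (∀ z ∈ closedBall (0 : ℂ) R, f ((starRingEnd ℂ) z) = f z) →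
      (∀ z ∈ closedBall (0 : ℂ) R, z ∉ Complex.slitPlane → f z = 0) →
      (∀ z ∈ ball (0 : ℂ) R, z ∈ Complex.slitPlane →
        ContDiffAt ℝ 2 f z ∧ |Δ f z| ≤ A * ‖z‖ ^ s) →
      (∀ z ∈ closedBall (0 : ℂ) R, |f z| ≤ A) →
      ∃ c : ℕ → ℝ, (∀ j, |c j| ≤ C * A) ∧ (∀ j, s + 2 ≤ j → c j = 0) ∧
        ∀ z ∈ closedBall (0 : ℂ) R,
          |f z - ∑ j ∈ Finset.range (s + 2), c j * slitHarmonic j z| ≤ C * A * ‖z‖ ^ (s + 2) := by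
  -- With B = bA, the factor 12 · 64^(s+2) ensures 12A ≤ B / 64^(s+2), so that 6A is absorbed in the
  -- passage to the next scale. The factor R^(-(s+2)) makes zero coefficients admissible at the
  -- first scale.
  set b : ℝ := 12 * 64 ^ (s + 2) / R ^ (s + 2) with hb
  have hRp : R ^ (s + 2) ≤ 1 := pow_le_one₀ hR.le hR1
  have hRp0 : 0 < R ^ (s + 2) := by positivity
  have hb12 : 12 * 64 ^ (s + 2) ≤ b := by
    rw [hb, le_div_iff₀ hRp0]
    exact mul_le_of_le_one_right (by positivity) hRp
  have h64 : (1 : ℝ) ≤ 64 ^ (s + 2) := one_le_pow₀ (by norm_num)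
  have hb1 : 12 ≤ b := by linarith
  refine ⟨(b + 4 * (b + 1) * (s + 2)) * 64 ^ (s + 2), by positivity, ?_⟩
  intro A hA f hf heven hzero hd hfA
  set B : ℝ := b * A with hB
  set D : ℝ := 2 * (B + A) with hD
  have hB0 : 0 < B := by positivity
  have hD0 : 0 < D := by positivity
  -- The half power of the ratio is 1/8. It turns the factor 4 of the one-step estimate into 1/2,
  -- leaving the other half of the bound for the error from the Laplacian.
  set ρ : ℕ → ℝ := fun i => R * (1 / 64) ^ i with hρ
  have hρ0 : ∀ i, 0 < ρ i := fun i => by positivity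
  have hρR : ∀ i, ρ i ≤ R := fun i =>
    mul_le_of_le_one_right hR.le (pow_le_one₀ (by norm_num) (by norm_num))
  have hρs : ∀ i, ρ (i + 1) = ρ i / 64 := fun i => by simp only [hρ, pow_succ]; ring
  have hsqρ : ∀ i, Real.sqrt (ρ i) = Real.sqrt R * (1 / 8) ^ i := fun i => by
    have : (1 / 64 : ℝ) ^ i = ((1 / 8) ^ i) ^ 2 := by rw [← pow_mul, mul_comm, pow_mul]; norm_num
    rw [hρ, Real.sqrt_mul hR.le]
    simp only [this]
    rw [Real.sqrt_sq (by positivity)]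
  set P : ℕ → (ℕ → ℝ) → Prop := fun i c => ∀ z ∈ closedBall (0 : ℂ) (ρ i),
    |f z - ∑ j ∈ Finset.range (s + 2), c j * slitHarmonic j z| ≤ B * ρ i ^ (s + 2) with hP
  have hP0 : P 0 0 := fun z hz => by
    have h1 : |f z| ≤ A := hfA z (closedBall_subset_closedBall (hρR 0) hz)
    have h2 : A ≤ B * ρ 0 ^ (s + 2) := by
      have : B * ρ 0 ^ (s + 2) = A * (12 * 64 ^ (s + 2)) := by
        simp only [hρ, hB, hb, pow_zero, mul_one]
        field_simp
      rw [this]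
      nlinarith
    simpa using h1.trans h2
  have step : ∀ i (c : {c // P i c}), ∃ c' : {c // P (i + 1) c}, ∀ j,
      |c'.1 j - c.1 j| * (ρ i ^ j * Real.sqrt (ρ i)) ≤ D * ρ i ^ (s + 2) := by
    rintro i ⟨c, hc⟩
    have hsub : closedBall (0 : ℂ) (ρ i) ⊆ closedBall 0 R := closedBall_subset_closedBall (hρR i)
    have hHd : ∀ z ∈ Complex.slitPlane, ∀ j ∈ Finset.range (s + 2),
        ContDiffAt ℝ 2 (fun z => c j * slitHarmonic j z) z := fun z hz j _ =>
      contDiffAt_const.mul (contDiffAt_slitHarmonic j hz)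
    have hHΔ : ∀ z ∈ Complex.slitPlane,
        Δ (fun z => ∑ j ∈ Finset.range (s + 2), c j * slitHarmonic j z) z = 0 := fun z hz => by
      rw [laplacian_finset_sum _ (hHd z hz)]
      refine Finset.sum_eq_zero fun j _ => ?_
      rw [laplacian_const_mul _ (contDiffAt_slitHarmonic j hz),
        (harmonicAt_slitHarmonic j hz).2.self_of_nhds, Pi.zero_apply, mul_zero]
    obtain ⟨a, ha, hfa⟩ := exists_slitHarmonic_sum_near_half (s + 2) (hρ0 i)
      (K := A * ρ i ^ s) (M := B * ρ i ^ (s + 2)) (by have := hρ0 i; positivity)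
      (f := fun z => f z - ∑ j ∈ Finset.range (s + 2), c j * slitHarmonic j z)
      ((hf.mono hsub).sub (continuous_finsetSum _ fun j _ =>
        continuous_const.mul (continuous_slitHarmonic j)).continuousOn)
      (fun z hz => by simp only [heven z (hsub hz), slitHarmonic_conj])
      (fun z hz hs => by simp [hzero z (hsub hz) hs, slitHarmonic_eq_zero _ hs])
      (fun z hz hs => by
        obtain ⟨h1, h2⟩ := hd z (ball_subset_ball (hρR i) hz) hs
        refine ⟨h1.sub (ContDiffAt.sum (hHd z hs)), ?_⟩
        rw [laplacian_sub' h1 (ContDiffAt.sum (hHd z hs)), hHΔ z hs, sub_zero]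
        refine h2.trans ?_
        have : ‖z‖ ≤ ρ i := (mem_ball_zero_iff.1 hz).le
        gcongr)
      hc
    have e2 : A * ρ i ^ s * ρ i ^ 2 = A * ρ i ^ (s + 2) := by ring
    rw [e2] at ha hfa
    refine ⟨⟨fun j => c j + a j, fun z hz => ?_⟩, fun j => ?_⟩
    · have hzn : ‖z‖ ≤ ρ i / 64 := by rw [← hρs]; exact mem_closedBall_zero_iff.1 hz
      have h1 := hfa z (by have := hρ0 i; linarith)
      have e3 : f z - ∑ j ∈ Finset.range (s + 2), (c j + a j) * slitHarmonic j z =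
          f z - ∑ j ∈ Finset.range (s + 2), c j * slitHarmonic j z -
            ∑ j ∈ Finset.range (s + 2), a j * slitHarmonic j z := by
        simp only [add_mul, Finset.sum_add_distrib]; ring
      rw [e3]
      refine h1.trans ?_
      have ht : ‖z‖ / ρ i ≤ 1 / 64 := by rw [div_le_iff₀ (hρ0 i)]; linarith
      have ht0 : 0 ≤ ‖z‖ / ρ i := div_nonneg (norm_nonneg _) (hρ0 i).le
      have h3 : Real.sqrt (‖z‖ / ρ i) ≤ 1 / 8 := by
        rw [Real.sqrt_le_left (by norm_num)]; linarith
      have h4 : (‖z‖ / ρ i) ^ (s + 2) ≤ (1 / 64) ^ (s + 2) := pow_le_pow_left₀ ht0 ht _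
      have h5 : (‖z‖ / ρ i) ^ (s + 2) * Real.sqrt (‖z‖ / ρ i) ≤ (1 / 64) ^ (s + 2) * (1 / 8) := by
        gcongr
      have hpos : 0 < ρ i ^ (s + 2) := pow_pos (hρ0 i) _
      have h6 : 12 * A ≤ B * (1 / 64) ^ (s + 2) := by
        rw [one_div, inv_pow, ← div_eq_mul_inv, le_div_iff₀ (by positivity), hB]
        nlinarith
      have h7 : ρ (i + 1) ^ (s + 2) = (1 / 64) ^ (s + 2) * ρ i ^ (s + 2) := by
        rw [hρs, ← mul_pow]; ring
      rw [h7]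
      have h8 := mul_le_mul_of_nonneg_left h5 (by positivity : 0 ≤ 4 * (B * ρ i ^ (s + 2)))
      nlinarith
    · have : c j + a j - c j = a j := by ring
      simp only [this]
      refine (ha j).trans (le_of_eq ?_)
      rw [hD]; ring
  choose nxt hnxt using step
  let seq : ∀ i, {c // P i c} := fun i => Nat.rec ⟨0, hP0⟩ (fun i c => nxt i c) i
  have hseq : ∀ i j, |(seq (i + 1)).1 j - (seq i).1 j| * (ρ i ^ j * Real.sqrt (ρ i)) ≤
      D * ρ i ^ (s + 2) := fun i j => hnxt i (seq i) j
  -- The change of the j-th coefficient at scale i is O(ρ_i^(s+1-j) √ρ_i). The exponent is at least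
  -- 1/2 even for j = s + 1, so these changes are summable and the coefficients converge.
  have hdecay : ∀ i, ∀ j < s + 2, D * ρ i ^ (s + 2) =
      D * (ρ i ^ (s + 1 - j) * Real.sqrt (ρ i)) * (ρ i ^ j * Real.sqrt (ρ i)) := fun i j hj => by
    have h1 : ρ i ^ (s + 2) = ρ i ^ (s + 1 - j) * ρ i ^ j * ρ i := by
      rw [← pow_add, ← pow_succ]; congr 1; omega
    rw [h1]
    nth_rewrite 3 [← Real.mul_self_sqrt (hρ0 i).le]
    ring
  have hdist : ∀ j < s + 2, ∀ i, dist ((seq i).1 j) ((seq (i + 1)).1 j) ≤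
      D * (R ^ (s + 1 - j) * Real.sqrt R) * ((1 / 64) ^ (s + 1 - j) * (1 / 8)) ^ i := by
    intro j hj i
    have h1 := hseq i j
    rw [hdecay i j hj] at h1
    have h2 := le_of_mul_le_mul_right h1
      (mul_pos (pow_pos (hρ0 i) j) (Real.sqrt_pos.2 (hρ0 i)))
    rw [dist_comm, Real.dist_eq]
    refine h2.trans (le_of_eq ?_)
    rw [hsqρ, hρ]
    simp only
    rw [mul_pow, mul_pow, ← pow_mul, ← pow_mul, mul_comm i]
    ring
  have hq : ∀ j, (1 / 64 : ℝ) ^ (s + 1 - j) * (1 / 8) ≤ 1 / 8 := fun j =>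
    mul_le_of_le_one_left (by norm_num) (pow_le_one₀ (by norm_num) (by norm_num))
  have hlim : ∀ j, ∃ a : ℝ, j < s + 2 → Tendsto (fun i => (seq i).1 j) atTop (𝓝 a) := fun j => by
    by_cases hj : j < s + 2
    · obtain ⟨a, ha⟩ := cauchySeq_tendsto_of_complete
        (cauchySeq_of_le_geometric _ _ (by linarith [hq j]) (hdist j hj))
      exact ⟨a, fun _ => ha⟩
    · exact ⟨0, fun h => absurd h hj⟩
  choose c hc using hlim
  have hclose : ∀ j < s + 2, ∀ i, |(seq i).1 j - c j| ≤
      2 * D * (ρ i ^ (s + 1 - j) * Real.sqrt (ρ i)) := by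
    intro j hj i
    have h1 := dist_le_of_le_geometric_of_tendsto _ _ (by linarith [hq j]) (hdist j hj) (hc j hj) i
    rw [Real.dist_eq] at h1
    refine h1.trans ?_
    have h2 : D * (R ^ (s + 1 - j) * Real.sqrt R) * ((1 / 64) ^ (s + 1 - j) * (1 / 8)) ^ i =
        D * (ρ i ^ (s + 1 - j) * Real.sqrt (ρ i)) := by
      rw [hsqρ, hρ]
      simp only
      rw [mul_pow, mul_pow, ← pow_mul, ← pow_mul, mul_comm i]
      ring
    rw [h2, div_le_iff₀ (by linarith [hq j])]
    have h3 : 0 ≤ D * (ρ i ^ (s + 1 - j) * Real.sqrt (ρ i)) := by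
      have := hρ0 i; positivity
    nlinarith [hq j]
  refine ⟨fun j => if j < s + 2 then c j else 0, fun j => ?_, fun j hj => ?_, fun z hz => ?_⟩
  · by_cases hj : j < s + 2
    · simp only [hj, if_true]
      have h1 := hclose j hj 0
      have h2 : (seq 0).1 j = 0 := rfl
      rw [h2, zero_sub, abs_neg] at h1
      have h3 : ρ 0 ^ (s + 1 - j) * Real.sqrt (ρ 0) ≤ 1 :=
        mul_le_one₀ (pow_le_one₀ (hρ0 0).le ((hρR 0).trans hR1)) (Real.sqrt_nonneg _)
          (Real.sqrt_le_one.2 ((hρR 0).trans hR1))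
      have h4 : |c j| ≤ 4 * (b + 1) * A := by
        refine h1.trans ((mul_le_of_le_one_right (by positivity) h3).trans (le_of_eq ?_))
        rw [hD, hB]; ring
      refine h4.trans (mul_le_mul_of_nonneg_right ?_ hA.le)
      have h5 : 4 * (b + 1) ≤ b + 4 * (b + 1) * (s + 2) := by
        have : (0 : ℝ) ≤ s := Nat.cast_nonneg s
        nlinarith
      exact h5.trans (le_mul_of_one_le_right (by positivity) h64)
    · simp only [hj, if_false, abs_zero]
      positivity
  · simp [not_lt.2 hj]
  · have e : ∑ j ∈ Finset.range (s + 2), (if j < s + 2 then c j else 0) * slitHarmonic j z =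
        ∑ j ∈ Finset.range (s + 2), c j * slitHarmonic j z :=
      Finset.sum_congr rfl fun j hj => by rw [if_pos (Finset.mem_range.1 hj)]
    rw [e]
    have hscale : ∀ i, ‖z‖ ≤ ρ i →
        |f z - ∑ j ∈ Finset.range (s + 2), c j * slitHarmonic j z| ≤
          (b + 4 * (b + 1) * (s + 2)) * A * ρ i ^ (s + 2) := by
      intro i hzi
      have h1 := (seq i).2 z (mem_closedBall_zero_iff.2 hzi)
      have h2 : |∑ j ∈ Finset.range (s + 2), ((seq i).1 j - c j) * slitHarmonic j z| ≤
          (s + 2) * (2 * D * ρ i ^ (s + 2)) := by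
        refine (Finset.abs_sum_le_sum_abs _ _).trans ?_
        refine (Finset.sum_le_card_nsmul _ _ (2 * D * ρ i ^ (s + 2)) fun j hj => ?_).trans
          (le_of_eq (by simp))
        have hj' := Finset.mem_range.1 hj
        rw [abs_mul]
        have h3 : |slitHarmonic j z| ≤ ρ i ^ j * Real.sqrt (ρ i) :=
          (abs_slitHarmonic_le j z).trans (by gcongr)
        calc |(seq i).1 j - c j| * |slitHarmonic j z|
            ≤ 2 * D * (ρ i ^ (s + 1 - j) * Real.sqrt (ρ i)) * (ρ i ^ j * Real.sqrt (ρ i)) := by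
              have := hρ0 i
              exact mul_le_mul (hclose j hj' i) h3 (abs_nonneg _) (by positivity)
          _ = 2 * (D * (ρ i ^ (s + 1 - j) * Real.sqrt (ρ i)) * (ρ i ^ j * Real.sqrt (ρ i))) := by ring
          _ = 2 * D * ρ i ^ (s + 2) := by rw [← hdecay i j hj']; ring
      have h4 : f z - ∑ j ∈ Finset.range (s + 2), c j * slitHarmonic j z =
          (f z - ∑ j ∈ Finset.range (s + 2), (seq i).1 j * slitHarmonic j z) +
            ∑ j ∈ Finset.range (s + 2), ((seq i).1 j - c j) * slitHarmonic j z := by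
        simp only [sub_mul, Finset.sum_sub_distrib]; ring
      rw [h4]
      refine (abs_add_le _ _).trans ((add_le_add h1 h2).trans (le_of_eq ?_))
      rw [hD, hB]; ring
    rcases eq_or_ne z 0 with rfl | hz0
    · have h0 : (0 : ℂ) ∉ Complex.slitPlane := Complex.zero_notMem_slitPlane
      simp [hzero 0 hz h0, slitHarmonic_eq_zero _ h0]
    · have hzpos : 0 < ‖z‖ := norm_pos_iff.2 hz0
      have hzR : ‖z‖ ≤ R := mem_closedBall_zero_iff.1 hz
      -- Choosing `i` with ρ_{i+1} < |z| ≤ ρ_i replaces ρ_i by 64|z|, which costs the factor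
      -- 64^(s+2).
      obtain ⟨i, hi1, hi2⟩ := exists_nat_pow_near_of_lt_one (x := ‖z‖ / R) (y := (1 / 64 : ℝ))
        (by positivity) (by rw [div_le_one hR]; exact hzR) (by norm_num) (by norm_num)
      rw [lt_div_iff₀ hR] at hi1
      rw [div_le_iff₀ hR] at hi2
      have h1 := hscale i (by simp only [hρ]; linarith)
      refine h1.trans ?_
      have h2 : ρ i ≤ 64 * ‖z‖ := by
        simp only [hρ]
        rw [pow_succ] at hi1
        linarith
      have h3 : ρ i ^ (s + 2) ≤ 64 ^ (s + 2) * ‖z‖ ^ (s + 2) := by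
        rw [← mul_pow]
        exact pow_le_pow_left₀ (hρ0 i).le h2 _
      calc (b + 4 * (b + 1) * (s + 2)) * A * ρ i ^ (s + 2)
          ≤ (b + 4 * (b + 1) * (s + 2)) * A * (64 ^ (s + 2) * ‖z‖ ^ (s + 2)) := by gcongr
        _ = _ := by ring

end Planar

/-! ### Averages of translates: continuity, differentiation under the integral, harmonicity. -/

section Average

variable {V : Type*} [NormedAddCommGroup V] [InnerProductSpace ℝ V] [FiniteDimensional ℝ V]
variable {G : Type*} [NormedAddCommGroup G] [NormedSpace ℝ G]
variable {m : ℕ}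

/-- Weighted average of the translates of `u` along `s y`, `y ∈ K`. -/
noncomputable def avg (K : Set (Fin m → ℝ)) (φ : (Fin m → ℝ) → ℝ) (s : (Fin m → ℝ) → V)
    (u : V → G) (X : V) : G := ∫ y in K, φ y • u (X - s y)

variable {K : Set (Fin m → ℝ)} {φ : (Fin m → ℝ) → ℝ} {s : (Fin m → ℝ) → V} {Ω : Set V} {X₀ : V}

theorem exists_closedBall_tube (hK : IsCompact K) (hs : Continuous s) (hΩ : IsOpen Ω)
    (h : ∀ y ∈ K, X₀ - s y ∈ Ω) :
    ∃ ε > 0, ∀ X ∈ closedBall X₀ ε, ∀ y ∈ K, X - s y ∈ Ω := by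
  have h1 : ∀ᶠ X in 𝓝 X₀, ∀ y ∈ K, X - s y ∈ Ω := by
    refine hK.eventually_forall_of_forall_eventually fun y hy => ?_
    have hc : Continuous fun p : V × (Fin m → ℝ) => p.1 - s p.2 := by fun_prop
    exact hc.continuousAt.eventually (hΩ.mem_nhds (h y hy))
  obtain ⟨ε, hε, h2⟩ := Metric.nhds_basis_closedBall.eventually_iff.1 h1
  exact ⟨ε, hε, fun X hX => h2 hX⟩

theorem exists_bound_tube (hK : IsCompact K) (hs : Continuous s) (hφ : ContinuousOn φ K)
    {u : V → G} (hu : ContinuousOn u Ω) {ε : ℝ}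
    (h : ∀ X ∈ closedBall X₀ ε, ∀ y ∈ K, X - s y ∈ Ω) :
    ∃ C, ∀ X ∈ closedBall X₀ ε, ∀ y ∈ K, ‖φ y • u (X - s y)‖ ≤ C := by
  have hc : ContinuousOn (fun p : V × (Fin m → ℝ) => φ p.2 • u (p.1 - s p.2))
      (closedBall X₀ ε ×ˢ K) := by
    refine (hφ.comp continuousOn_snd fun p hp => hp.2).smul ?_
    refine hu.comp (by fun_prop) fun p hp => h p.1 hp.1 p.2 hp.2
  obtain ⟨C, hC⟩ := ((isCompact_closedBall X₀ ε).prod hK).exists_bound_of_continuousOn hc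
  exact ⟨C, fun X hX y hy => hC (X, y) ⟨hX, hy⟩⟩

theorem continuousOn_avg_integrand (hs : Continuous s) (hφ : ContinuousOn φ K)
    {u : V → G} (hu : ContinuousOn u Ω) {X : V} (h : ∀ y ∈ K, X - s y ∈ Ω) :
    ContinuousOn (fun y => φ y • u (X - s y)) K :=
  hφ.smul (hu.comp (by fun_prop) h)

theorem continuousAt_avg (hK : IsCompact K) (hs : Continuous s) (hΩ : IsOpen Ω)
    (hφ : ContinuousOn φ K) (h : ∀ y ∈ K, X₀ - s y ∈ Ω) {u : V → G} (hu : ContinuousOn u Ω) :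
    ContinuousAt (avg K φ s u) X₀ := by
  obtain ⟨ε, hε, htube⟩ := exists_closedBall_tube hK hs hΩ h
  obtain ⟨C, hC⟩ := exists_bound_tube hK hs hφ hu htube
  have hnb := closedBall_mem_nhds X₀ hε
  have hfin : volume K ≠ ⊤ := hK.measure_lt_top.ne
  refine continuousAt_of_dominated (bound := fun _ => C) ?_ ?_ (integrableOn_const hfin) ?_
  · filter_upwards [hnb] with X hX
    exact (continuousOn_avg_integrand hs hφ hu (htube X hX)).aestronglyMeasurable_of_isCompact hK
      hK.measurableSet
  · filter_upwards [hnb] with X hX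
    exact (ae_restrict_mem hK.measurableSet).mono fun y hy => hC X hX y hy
  · refine (ae_restrict_mem hK.measurableSet).mono fun y hy => ?_
    have h1 : ContinuousAt u (X₀ - s y) := hu.continuousAt (hΩ.mem_nhds (h y hy))
    have h2 : ContinuousAt (fun X => u (X - s y)) X₀ :=
      ContinuousAt.comp (f := fun X => X - s y) h1 (by fun_prop)
    exact h2.const_smul (φ y)

theorem hasFDerivAt_avg (hK : IsCompact K) (hs : Continuous s) (hΩ : IsOpen Ω)
    (hφ : ContinuousOn φ K) (h : ∀ y ∈ K, X₀ - s y ∈ Ω) {u : V → G} {u' : V → V →L[ℝ] G}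
    (hu : ∀ X ∈ Ω, HasFDerivAt u (u' X) X) (hu' : ContinuousOn u' Ω) :
    HasFDerivAt (avg K φ s u) (avg K φ s u' X₀) X₀ := by
  have huc : ContinuousOn u Ω := fun X hX => (hu X hX).continuousAt.continuousWithinAt
  obtain ⟨ε, hε, htube⟩ := exists_closedBall_tube hK hs hΩ h
  obtain ⟨C, hC⟩ := exists_bound_tube hK hs hφ hu' htube
  have hnb := closedBall_mem_nhds X₀ hε
  have hfin : volume K ≠ ⊤ := hK.measure_lt_top.ne
  refine hasFDerivAt_integral_of_dominated_of_fderiv_le (𝕜 := ℝ) (bound := fun _ => C)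
    (F' := fun X y => φ y • u' (X - s y)) hnb ?_ ?_ ?_ ?_ (integrableOn_const hfin) ?_
  · filter_upwards [hnb] with X hX
    exact (continuousOn_avg_integrand hs hφ huc (htube X hX)).aestronglyMeasurable_of_isCompact hK
      hK.measurableSet
  · exact (continuousOn_avg_integrand hs hφ huc h).integrableOn_compact hK
  · exact (continuousOn_avg_integrand hs hφ hu' h).aestronglyMeasurable_of_isCompact hK
      hK.measurableSet
  · exact (ae_restrict_mem hK.measurableSet).mono fun y hy X hX => hC X hX y hy
  · refine (ae_restrict_mem hK.measurableSet).mono fun y hy X hX => ?_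
    have h1 := hu _ (htube X hX y hy)
    have h2 : HasFDerivAt (fun X => u (X - s y)) (u' (X - s y)) X := by
      have := h1.comp X ((hasFDerivAt_id X).sub_const (s y))
      simpa using! this
    exact h2.const_smul (φ y)

/-- The tube lemma keeps all translates in `Ω` for X near X₀, and compactness bounds the integrands.
Both derivatives then pass under the integral, and the Laplacian of each translate is zero. -/
theorem harmonicAt_avg (hK : IsCompact K) (hs : Continuous s) (hΩ : IsOpen Ω)
    (hφ : ContinuousOn φ K) (h : ∀ y ∈ K, X₀ - s y ∈ Ω) {u : V → ℝ}
    (hu : ∀ X ∈ Ω, HarmonicAt u X) : HarmonicAt (avg K φ s u) X₀ := by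
  have h1 : ∀ X ∈ Ω, HasFDerivAt u (fderiv ℝ u X) X := fun X hX =>
    ((hu X hX).1.differentiableAt (by norm_num)).hasFDerivAt
  have h2 : ∀ X ∈ Ω, HasFDerivAt (fderiv ℝ u) (fderiv ℝ (fderiv ℝ u) X) X := fun X hX =>
    (hu X hX).1.differentiableAt_fderiv.hasFDerivAt
  have hc1 : ContinuousOn (fderiv ℝ u) Ω := fun X hX =>
    (h2 X hX).continuousAt.continuousWithinAt
  have hc2 : ContinuousOn (fderiv ℝ (fderiv ℝ u)) Ω := fun X hX => by
    have h3 : ContDiffAt ℝ 1 (fderiv ℝ u) X := (hu X hX).1.fderiv_right (by norm_num)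
    have h4 : ContDiffAt ℝ 0 (fderiv ℝ (fderiv ℝ u)) X := h3.fderiv_right (by norm_num)
    exact h4.continuousAt.continuousWithinAt
  obtain ⟨ε, hε, htube⟩ := exists_closedBall_tube hK hs hΩ h
  have hd1 : ∀ X ∈ closedBall X₀ ε, HasFDerivAt (avg K φ s u) (avg K φ s (fderiv ℝ u) X) X :=
    fun X hX => hasFDerivAt_avg hK hs hΩ hφ (htube X hX) h1 hc1
  have hd2 : ∀ X ∈ closedBall X₀ ε, HasFDerivAt (avg K φ s (fderiv ℝ u))
      (avg K φ s (fderiv ℝ (fderiv ℝ u)) X) X :=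
    fun X hX => hasFDerivAt_avg hK hs hΩ hφ (htube X hX) h2 hc2
  have hcd : ∀ X ∈ ball X₀ ε, ContDiffAt ℝ 2 (avg K φ s u) X := fun X hX => by
    have hnb : closedBall X₀ ε ∈ 𝓝 X := mem_of_superset (isOpen_ball.mem_nhds hX) ball_subset_closedBall
    have h3 : ContDiffAt ℝ 1 (avg K φ s (fderiv ℝ u)) X :=
      contDiffAt_one_iff.2 ⟨avg K φ s (fderiv ℝ (fderiv ℝ u)), closedBall X₀ ε, hnb, fun Y hY =>
        (continuousAt_avg hK hs hΩ hφ (htube Y hY) hc2).continuousWithinAt, hd2⟩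
    have := (contDiffAt_succ_iff_hasFDerivAt (n := 1)).2
      ⟨avg K φ s (fderiv ℝ u), ⟨closedBall X₀ ε, hnb, hd1⟩, h3⟩
    exact this
  refine ⟨hcd X₀ (mem_ball_self hε), ?_⟩
  filter_upwards [ball_mem_nhds X₀ hε] with X hX
  have hXc := ball_subset_closedBall hX
  have hnb : ball X₀ ε ∈ 𝓝 X := isOpen_ball.mem_nhds hX
  have e1 : fderiv ℝ (avg K φ s u) =ᶠ[𝓝 X] avg K φ s (fderiv ℝ u) := by
    filter_upwards [hnb] with Y hY using (hd1 Y (ball_subset_closedBall hY)).fderiv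
  set b := stdOrthonormalBasis ℝ V
  rw [laplacian_eq_sum_fderiv _ _ b, e1.fderiv_eq, (hd2 X hXc).fderiv, avg]
  have hint := (continuousOn_avg_integrand (G := V →L[ℝ] V →L[ℝ] ℝ) hs hφ hc2
    (htube X hXc)).integrableOn_compact hK
    (μ := volume)
  have hT : ∀ i, (∫ y in K, φ y • fderiv ℝ (fderiv ℝ u) (X - s y)) (b i) (b i) =
      ∫ y in K, φ y • (fderiv ℝ (fderiv ℝ u) (X - s y) (b i) (b i)) := fun i => by
    rw [ContinuousLinearMap.integral_apply hint, ContinuousLinearMap.integral_apply]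
    · rfl
    · exact hint.apply_continuousLinearMap (b i)
  simp only [hT]
  rw [← integral_finsetSum]
  · rw [Pi.zero_apply]
    refine setIntegral_eq_zero_of_forall_eq_zero fun y hy => ?_
    rw [← Finset.smul_sum, ← laplacian_eq_sum_fderiv, (hu _ (htube X hXc y hy)).2.self_of_nhds]
    simp
  · intro i _
    exact (hint.apply_continuousLinearMap (b i)).apply_continuousLinearMap (b i)

end Average

/-! ### Tangential mollification and bounds on all tangential derivatives. -/

section Mollify

variable {m : ℕ}

/-- Embedding of the tangential space. -/
noncomputable def shift : (Fin m → ℝ) →L[ℝ] Space m :=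
  point.comp (ContinuousLinearMap.inl ℝ (Fin m → ℝ) ℂ)

theorem shift_apply (y : Fin m → ℝ) : shift y = point (y, 0) := rfl

@[simp] theorem planar_shift (y : Fin m → ℝ) : planar (shift y) = 0 := by simp [shift_apply]

@[simp] theorem tang_shift (y : Fin m → ℝ) : tang (shift y) = y := by simp [shift_apply]

theorem shift_single (l : Fin m) : shift (Pi.single l 1) = tangent l :=
  space_ext (by simp) (by simp)

theorem norm_shift_le (y : Fin m → ℝ) : ‖shift y‖ ≤ (m + 1) * ‖y‖ := by
  refine abs_le_of_sq_le_sq' ?_ (by positivity) |>.2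
  rw [norm_sq_eq]
  simp only [tang_shift, planar_shift, norm_zero, ne_eq, OfNat.ofNat_ne_zero, not_false_eq_true,
    zero_pow, add_zero]
  have h1 : ∑ l, y l ^ 2 ≤ ∑ _l : Fin m, ‖y‖ ^ 2 := Finset.sum_le_sum fun l _ => by
    rw [← sq_abs]
    exact pow_le_pow_left₀ (abs_nonneg _) (norm_le_pi_norm y l) 2
  refine h1.trans ?_
  simp only [Finset.sum_const, Finset.card_univ, Fintype.card_fin, nsmul_eq_mul, mul_pow]
  have : (0 : ℝ) ≤ m := Nat.cast_nonneg m
  gcongr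
  nlinarith

theorem reflect_sub_shift (X : Space m) (y : Fin m → ℝ) :
    reflect X - shift y = reflect (X - shift y) :=
  space_ext (by simp [tang_reflect]) (by simp [planar_reflect])

/-- Averaging a solution in the tangential directions gives a solution. -/
theorem IsSolution.avg {R h : ℝ} {u : Space m → ℝ} (hu : IsSolution R u)
    {φ : (Fin m → ℝ) → ℝ} (hφ : Continuous φ) {R' : ℝ} (hR : R' + (m + 1) * h ≤ R) :
    IsSolution R' (avg (closedBall 0 h) φ shift u) := by
  have hK : IsCompact (closedBall (0 : Fin m → ℝ) h) := isCompact_closedBall 0 h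
  have hmem : ∀ X ∈ ball (0 : Space m) R', ∀ y ∈ closedBall (0 : Fin m → ℝ) h,
      X - shift y ∈ ball (0 : Space m) R := fun X hX y hy => by
    rw [mem_ball_zero_iff] at hX ⊢
    have h1 := norm_sub_le X (shift y)
    have h2 := norm_shift_le y
    have h3 : (m + 1) * ‖y‖ ≤ (m + 1) * h := by
      gcongr; simpa using hy
    linarith
  refine ⟨fun X hX => ?_, fun X hX => ?_, fun X hX hs => ?_, fun X hX hs => ?_⟩
  · exact (continuousAt_avg hK shift.continuous isOpen_ball hφ.continuousOn (hmem X hX)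
      hu.cont).continuousWithinAt
  · unfold FlatSlit.avg
    refine setIntegral_congr_fun hK.measurableSet fun y hy => ?_
    simp only [reflect_sub_shift, hu.even _ (hmem X hX y hy)]
  · exact harmonicAt_avg (Ω := ball 0 R ∩ {X | planar X ∈ Complex.slitPlane}) hK shift.continuous
      (isOpen_ball.inter isOpen_planar_slitPlane) hφ.continuousOn
      (fun y hy => ⟨hmem X hX y hy, by simpa using hs⟩) fun Y hY => hu.harm Y hY.1 hY.2
  · unfold FlatSlit.avg
    refine setIntegral_eq_zero_of_forall_eq_zero fun y hy => ?_
    rw [hu.zero _ (hmem X hX y hy) (by simpa using hs), smul_zero]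

/-- Derivatives of the product kernel `∏ η(y_l)`. -/
noncomputable def kernel (η : ℝ → ℝ) (α : Fin m →₀ ℕ) (y : Fin m → ℝ) : ℝ :=
  ∏ l, iteratedDeriv (α l) η (y l)

theorem continuous_kernel {η : ℝ → ℝ} (hη : ∀ n : ℕ, ContDiff ℝ n η) (α : Fin m →₀ ℕ) :
    Continuous (kernel η α) :=
  continuous_finsetProd _ fun l _ =>
    ((hη (α l)).continuous_iteratedDeriv (α l) le_rfl).comp (continuous_apply l)

theorem kernel_eq_zero {η : ℝ → ℝ} {h : ℝ} (hη : ∀ x, h < |x| → η x = 0) (α : Fin m →₀ ℕ)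
    {y : Fin m → ℝ} (hh : 0 ≤ h) (hy : y ∉ closedBall 0 h) : kernel η α y = 0 := by
  have h1 : ¬ ∀ l, ‖y l‖ ≤ h := fun h2 =>
    hy (mem_closedBall_zero_iff.2 ((pi_norm_le_iff_of_nonneg hh).2 h2))
  push Not at h1
  obtain ⟨l, hl⟩ := h1
  refine Finset.prod_eq_zero (Finset.mem_univ l) ?_
  have h3 : η =ᶠ[𝓝 (y l)] fun _ => (0 : ℝ) := by
    have : {x : ℝ | h < |x|} ∈ 𝓝 (y l) := (isOpen_lt continuous_const continuous_abs).mem_nhds hl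
    filter_upwards [this] with x hx using hη x hx
  rw [h3.iteratedDeriv_eq]
  simp

theorem hasDerivAt_kernel {η : ℝ → ℝ} (hη : ∀ n : ℕ, ContDiff ℝ n η) (α : Fin m →₀ ℕ)
    (l : Fin m) (y : Fin m → ℝ) (t : ℝ) :
    HasDerivAt (fun t : ℝ => kernel η α (y + t • Pi.single l 1))
      (kernel η (α + Finsupp.single l 1) (y + t • Pi.single l 1)) t := by
  have hsplit : ∀ (β : Fin m →₀ ℕ) (t : ℝ), kernel η β (y + t • Pi.single l 1) =
      iteratedDeriv (β l) η (y l + t) *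
        ∏ i ∈ Finset.univ.erase l, iteratedDeriv (β i) η (y i) := fun β t => by
    rw [kernel, ← Finset.mul_prod_erase _ _ (Finset.mem_univ l)]
    congr 1
    · simp
    · refine Finset.prod_congr rfl fun i hi => ?_
      simp [Finset.ne_of_mem_erase hi]
  simp only [hsplit]
  have h1 : HasDerivAt (fun t : ℝ => iteratedDeriv (α l) η (y l + t))
      (iteratedDeriv (α l + 1) η (y l + t)) t := by
    have h2 : HasDerivAt (iteratedDeriv (α l) η) (iteratedDeriv (α l + 1) η (y l + t)) (y l + t) := by
      rw [iteratedDeriv_succ]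
      exact ((hη (α l + 1)).differentiable_iteratedDeriv (α l)
        (by exact_mod_cast Nat.lt_succ_self _) _).hasDerivAt
    simpa using h2.comp_const_add (y l) t
  have h3 : ∏ i ∈ Finset.univ.erase l, iteratedDeriv ((α + Finsupp.single l 1 : Fin m →₀ ℕ) i) η (y i) =
      ∏ i ∈ Finset.univ.erase l, iteratedDeriv (α i) η (y i) :=
    Finset.prod_congr rfl fun i hi => by
      simp [(Finset.ne_of_mem_erase hi).symm]
  rw [h3]
  simpa using h1.mul_const _

theorem hasDerivAt_integral_kernel {η : ℝ → ℝ} (hη : ∀ n : ℕ, ContDiff ℝ n η)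
    {K : Set (Fin m → ℝ)} (hK : IsCompact K) {g : (Fin m → ℝ) → ℝ} (hg : ContinuousOn g K)
    (α : Fin m →₀ ℕ) (l : Fin m) :
    HasDerivAt (fun t : ℝ => ∫ y in K, kernel η α (y + t • Pi.single l 1) * g y)
      (∫ y in K, kernel η (α + Finsupp.single l 1) (y + (0 : ℝ) • Pi.single l 1) * g y) 0 := by
  have hkc : ∀ β : Fin m →₀ ℕ, Continuous fun p : (Fin m → ℝ) × ℝ =>
      kernel η β (p.1 + p.2 • Pi.single l 1) := fun β =>
    (continuous_kernel hη β).comp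
      (continuous_fst.add (continuous_snd.smul continuous_const))
  generalize hF : (fun (t : ℝ) (y : Fin m → ℝ) => kernel η α (y + t • Pi.single l 1) * g y) = F
  generalize hF' : (fun (t : ℝ) (y : Fin m → ℝ) =>
    kernel η (α + Finsupp.single l 1) (y + t • Pi.single l 1) * g y) = F'
  have hcF : ∀ t, ContinuousOn (F t) K := fun t => by
    rw [← hF]
    exact ((hkc α).comp (continuous_id.prodMk continuous_const)).continuousOn.mul hg
  have hcF' : ContinuousOn (fun p : (Fin m → ℝ) × ℝ => F' p.2 p.1) (K ×ˢ Icc (-1) 1) := by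
    rw [← hF']
    exact (hkc _).continuousOn.mul (hg.comp continuousOn_fst fun p hp => hp.1)
  have hcF0 : ContinuousOn (F' 0) K := by
    rw [← hF']
    exact ((hkc _).comp (continuous_id.prodMk continuous_const)).continuousOn.mul hg
  have hd : ∀ t y, HasDerivAt (fun t => F t y) (F' t y) t := fun t y => by
    rw [← hF, ← hF']
    exact (hasDerivAt_kernel hη α l y t).mul_const _
  obtain ⟨C, hC⟩ := (hK.prod isCompact_Icc).exists_bound_of_continuousOn hcF'
  have key := (hasDerivAt_integral_of_dominated_loc_of_deriv_le (μ := volume.restrict K)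
    (F := F) (F' := F') (x₀ := 0)
    (s := Icc (-1 : ℝ) 1) (bound := fun _ => C)
    (Icc_mem_nhds (by norm_num) (by norm_num))
    (Eventually.of_forall fun t => (hcF t).aestronglyMeasurable_of_isCompact hK
      hK.measurableSet)
    ((hcF 0).integrableOn_compact hK)
    (hcF0.aestronglyMeasurable_of_isCompact hK hK.measurableSet)
    ((ae_restrict_mem hK.measurableSet).mono fun y hy t ht => hC (y, t) ⟨hy, ht⟩)
    (integrableOn_const hK.measure_lt_top.ne)
    (Eventually.of_forall fun y t _ => hd t y)).2
  rw [← hF, ← hF'] at key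
  exact key

/-- A change of variables moves the translation from `u`, which is only continuous, to the smooth
kernel. The doubled radius contains every shifted support with |t| ≤ h. -/
theorem avg_kernel_eq {η : ℝ → ℝ} {h : ℝ} (hh : 0 < h) (hη0 : ∀ x, h < |x| → η x = 0)
    (u : Space m → ℝ) (β : Fin m →₀ ℕ) (l : Fin m) (X : Space m) {t : ℝ} (ht : |t| ≤ h) :
    avg (closedBall 0 h) (kernel η β) shift u (X + t • tangent l) =
      ∫ y in closedBall 0 (2 * h), kernel η β (y + t • Pi.single l 1) * u (X - shift y) := by
  have hzero : ∀ y ∉ closedBall (0 : Fin m → ℝ) (2 * h),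
      kernel η β (y + t • Pi.single l 1) = 0 := fun y hy => by
    refine kernel_eq_zero hη0 β hh.le fun h1 => hy ?_
    rw [mem_closedBall_zero_iff] at h1 ⊢
    have h2 : ‖t • (Pi.single l 1 : Fin m → ℝ)‖ ≤ h := by
      rw [norm_smul, Pi.norm_single, norm_one, mul_one]; exact ht
    have h3 := norm_sub_le (y + t • Pi.single l 1) (t • (Pi.single l 1 : Fin m → ℝ))
    rw [add_sub_cancel_right] at h3
    linarith
  have e1 : avg (closedBall 0 h) (kernel η β) shift u (X + t • tangent l) =
      ∫ y, kernel η β y * u (X + t • tangent l - shift y) :=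
    setIntegral_eq_integral_of_forall_compl_eq_zero fun y hy => by
      rw [kernel_eq_zero hη0 β hh.le hy, zero_smul]
  have e2 : ∫ y in closedBall 0 (2 * h), kernel η β (y + t • Pi.single l 1) * u (X - shift y) =
      ∫ y, kernel η β (y + t • Pi.single l 1) * u (X - shift y) :=
    setIntegral_eq_integral_of_forall_compl_eq_zero fun y hy => by
      rw [hzero y hy, zero_mul]
  rw [e1, e2, ← integral_add_right_eq_self (fun y => kernel η β y * u (X + t • tangent l - shift y))
    (t • (Pi.single l 1 : Fin m → ℝ))]
  congr 1
  funext y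
  congr 2
  rw [map_add, map_smul, shift_single]
  abel

/-- The derivative falls on the kernel, so the formula also holds at points of the slit, where `u`
need not be differentiable. -/
theorem hasDerivAt_avg_kernel {η : ℝ → ℝ} {h : ℝ} (hh : 0 < h) (hη : ∀ n : ℕ, ContDiff ℝ n η)
    (hη0 : ∀ x, h < |x| → η x = 0) {R R' : ℝ} (hR : R' + 2 * (m + 1) * h ≤ R) {u : Space m → ℝ}
    (hu : ContinuousOn u (ball 0 R)) (α : Fin m →₀ ℕ) (l : Fin m) {X : Space m}
    (hX : X ∈ ball (0 : Space m) R') :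
    HasDerivAt (fun t : ℝ => avg (closedBall 0 h) (kernel η α) shift u (X + t • tangent l))
      (avg (closedBall 0 h) (kernel η (α + Finsupp.single l 1)) shift u X) 0 := by
  have hmem : ∀ y ∈ closedBall (0 : Fin m → ℝ) (2 * h), X - shift y ∈ ball (0 : Space m) R :=
    fun y hy => by
    rw [mem_ball_zero_iff] at hX ⊢
    have h1 := norm_sub_le X (shift y)
    have h2 := norm_shift_le y
    have h3 : (m + 1) * ‖y‖ ≤ (m + 1) * (2 * h) := by
      gcongr; simpa using hy
    linarith
  have huK : ContinuousOn (fun y => u (X - shift y)) (closedBall (0 : Fin m → ℝ) (2 * h)) :=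
    hu.comp (by fun_prop) hmem
  have h3 := avg_kernel_eq hh hη0 u (α + Finsupp.single l 1) l X (t := 0) (by simpa using hh.le)
  have h2 := hasDerivAt_integral_kernel hη (isCompact_closedBall 0 (2 * h)) huK α l
  rw [← h3, zero_smul, add_zero] at h2
  refine h2.congr_of_eventuallyEq ?_
  filter_upwards [Icc_mem_nhds (by linarith : -h < 0) hh] with t ht
  exact avg_kernel_eq hh hη0 u α l X (abs_le.2 ht)

/-- A family of solutions consisting of all tangential derivatives of its first member. -/
structure IsTangentialJet (R : ℝ) (D : (Fin m →₀ ℕ) → Space m → ℝ) : Prop where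
  sol : ∀ α, IsSolution R (D α)
  deriv : ∀ α l, ∀ X ∈ ball (0 : Space m) R,
    HasDerivAt (fun t : ℝ => D α (X + t • tangent l)) (D (α + Finsupp.single l 1) X) 0

theorem IsTangentialJet.mono {R R' : ℝ} {D : (Fin m →₀ ℕ) → Space m → ℝ}
    (hD : IsTangentialJet R D) (h : R' ≤ R) : IsTangentialJet R' D :=
  ⟨fun α => (hD.sol α).mono h, fun α l X hX => hD.deriv α l X (ball_subset_ball h hX)⟩

/-- Solutions can be approximated by solutions which are smooth in the tangential directions. -/
theorem exists_isTangentialJet {u : Space m → ℝ} (hu : IsSolution 1 u) {h : ℝ} (hh : 0 < h)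
    (hh2 : 2 * (m + 1) * h ≤ 1 / 2) :
    ∃ D : (Fin m →₀ ℕ) → Space m → ℝ, IsTangentialJet (1 / 2) D ∧
      ∀ X ∈ ball (0 : Space m) (1 / 2), ∀ a ε : ℝ,
        (∀ y ∈ closedBall (0 : Fin m → ℝ) h, |u (X - shift y) - a| ≤ ε) → |D 0 X - a| ≤ ε := by
  let ψ : ContDiffBump (0 : ℝ) := ⟨h / 2, h, by linarith, by linarith⟩
  set η : ℝ → ℝ := ψ.normed volume with hη
  have hηc : ∀ n : ℕ, ContDiff ℝ n η := fun n => ψ.contDiff_normed (n := n)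
  have hη0 : ∀ x, h < |x| → η x = 0 := fun x hx => by
    by_contra h1
    have h2 : x ∈ Function.support η := h1
    rw [hη, ψ.support_normed_eq, mem_ball_zero_iff, Real.norm_eq_abs] at h2
    exact absurd h2 (not_lt.2 hx.le)
  set K := closedBall (0 : Fin m → ℝ) h with hKdef
  have hK : IsCompact K := isCompact_closedBall 0 _
  have hm : (0 : ℝ) ≤ (m + 1) * h := by positivity
  refine ⟨fun α => avg K (kernel η α) shift u, ⟨fun α =>
    hu.avg (continuous_kernel hηc α) (by linarith), fun α l X hX =>
    hasDerivAt_avg_kernel hh hηc hη0 (R := 1) (by linarith) hu.cont α l hX⟩, ?_⟩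
  intro X hX a ε hε
  have hmem : ∀ y ∈ K, X - shift y ∈ ball (0 : Space m) 1 := fun y hy => by
    rw [mem_ball_zero_iff] at hX ⊢
    have h1 := norm_sub_le X (shift y)
    have h2 := norm_shift_le y
    have h3 : (m + 1) * ‖y‖ ≤ (m + 1) * h := by
      gcongr; simpa [hKdef] using hy
    linarith
  have hk0 : ∀ y, 0 ≤ kernel η (0 : Fin m →₀ ℕ) y := fun y =>
    Finset.prod_nonneg fun l _ => by simpa using ψ.nonneg_normed (μ := volume) (y l)
  have hkint : ∫ y in K, kernel η (0 : Fin m →₀ ℕ) y = 1 := by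
    rw [setIntegral_eq_integral_of_forall_compl_eq_zero fun y hy => kernel_eq_zero hη0 0 hh.le hy]
    simp only [kernel, Finsupp.coe_zero, Pi.zero_apply, iteratedDeriv_zero]
    rw [integral_fintype_prod_volume_eq_prod fun _ => η]
    simp [hη, ψ.integral_normed]
  have hkc := continuous_kernel hηc (0 : Fin m →₀ ℕ)
  have hki : IntegrableOn (kernel η (0 : Fin m →₀ ℕ)) K := hkc.continuousOn.integrableOn_compact hK
  have huK : ContinuousOn (fun y => u (X - shift y)) K := hu.cont.comp (by fun_prop) hmem
  have h1 : avg K (kernel η (0 : Fin m →₀ ℕ)) shift u X - a =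
      ∫ y in K, kernel η (0 : Fin m →₀ ℕ) y * (u (X - shift y) - a) := by
    have hi : IntegrableOn (fun y => kernel η (0 : Fin m →₀ ℕ) y * u (X - shift y)) K :=
      (hkc.continuousOn.mul huK).integrableOn_compact hK
    simp only [mul_sub]
    rw [integral_sub hi (hki.mul_const a),
      integral_mul_const, hkint, one_mul]
    rfl
  rw [h1]
  calc |∫ y in K, kernel η (0 : Fin m →₀ ℕ) y * (u (X - shift y) - a)|
      ≤ ∫ y in K, kernel η (0 : Fin m →₀ ℕ) y * ε := by
        rw [← Real.norm_eq_abs]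
        refine norm_integral_le_of_norm_le (hki.mul_const ε) ?_
        refine (ae_restrict_mem hK.measurableSet).mono fun y hy => ?_
        rw [Real.norm_eq_abs, abs_mul, abs_of_nonneg (hk0 y)]
        exact mul_le_mul_of_nonneg_left (hε y hy) (hk0 y)
    _ = ε := by rw [integral_mul_const, hkint, one_mul]

theorem exists_add_single_of_degree_eq_succ {α : Fin m →₀ ℕ} {s : ℕ} (h : α.degree = s + 1) :
    ∃ (β : Fin m →₀ ℕ) (l : Fin m), β.degree = s ∧ α = β + Finsupp.single l 1 := by
  have hne : α ≠ 0 := fun h0 => by simp [h0] at h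
  obtain ⟨l, hl⟩ := Finsupp.ne_iff.1 hne
  have hle : Finsupp.single l 1 ≤ α := by
    rw [Finsupp.single_le_iff]; exact Nat.one_le_iff_ne_zero.2 hl
  have e : α - Finsupp.single l 1 + Finsupp.single l 1 = α := tsub_add_cancel_of_le hle
  refine ⟨α - Finsupp.single l 1, l, ?_, e.symm⟩
  have := congrArg Finsupp.degree e
  rw [map_add, Finsupp.degree_single, h] at this
  omega

/-- Tangential derivatives of every order are bounded on smaller balls. -/
theorem exists_bound_jet (m s : ℕ) : ∃ C : ℝ, 0 ≤ C ∧ ∀ D : (Fin m →₀ ℕ) → Space m → ℝ,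
    IsTangentialJet (1 / 2) D → (∀ X ∈ ball (0 : Space m) (1 / 2), |D 0 X| ≤ 1) →
    ∀ α, α.degree ≤ s → ∀ X ∈ ball (0 : Space m) (1 / 2 * (1 / 8) ^ s), |D α X| ≤ C := by
  induction s with
  | zero =>
    refine ⟨1, zero_le_one, fun D _ h α hα X hX => ?_⟩
    have h0 : α = 0 := (Finsupp.degree_eq_zero_iff α).1 (by omega)
    rw [h0]
    exact h X (by simpa using hX)
  | succ s ih =>
    obtain ⟨C, hC0, hC⟩ := ih
    set R : ℝ := 1 / 2 * (1 / 8) ^ s with hR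
    have hR0 : 0 < R := by positivity
    have hR12 : R ≤ 1 / 2 := mul_le_of_le_one_right (by norm_num) (pow_le_one₀ (by norm_num) (by norm_num))
    have hR' : 1 / 2 * (1 / 8 : ℝ) ^ (s + 1) = R / 8 := by rw [hR, pow_succ]; ring
    refine ⟨max C (2 * (m + 8) * C / (R / 2)), le_max_of_le_left hC0, fun D hD h α hα X hX => ?_⟩
    rw [hR', mem_ball_zero_iff] at hX
    rcases Nat.lt_or_ge α.degree (s + 1) with h1 | h1
    · exact (hC D hD h α (by omega) X (by rw [mem_ball_zero_iff]; linarith)).trans (le_max_left _ _)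
    · obtain ⟨β, l, hβ, rfl⟩ := exists_add_single_of_degree_eq_succ (le_antisymm hα h1)
      have hD' := hD.mono hR12
      -- The gradient estimate needs the closed ball of radius R/2 inside the ball of radius `R` and
      -- bounds the derivative for ‖X‖ ≤ R/4. One division by 8 per derivative leaves room.
      refine ((hD'.sol β).abs_tangential_deriv_le (R := R / 2) (by linarith) (by linarith)
        (hD'.sol (β + Finsupp.single l 1)) l (fun Y hY hs => ?_)
        (fun Y hY => hC D hD h β hβ.le Y hY) (by linarith)).trans (le_max_right _ _)
      have h2 := hasDerivAt_line (f := D β) (x := Y) (v := tangent l) (t := 0) (by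
        simpa using ((hD'.sol β).harm Y hY hs).1.differentiableAt (by norm_num))
      simpa using h2.unique (hD'.deriv β l Y hY)

end Mollify

/-! ### Descending induction on the tangential order: expansion of the slice functions. -/

section ChainExpansion

variable {m : ℕ}

/-- The action of the tangential Laplacian on arrays of Taylor coefficients. -/
noncomputable def lapSeq (c : (Fin m →₀ ℕ) → ℝ) (α : Fin m →₀ ℕ) : ℝ := ∑ l, c (α + Finsupp.single l 2)

theorem lapSeq_iterate_succ (i : ℕ) (c : (Fin m →₀ ℕ) → ℝ) (α : Fin m →₀ ℕ) :
    lapSeq^[i + 1] c α = ∑ l, lapSeq^[i] c (α + Finsupp.single l 2) := by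
  rw [Function.iterate_succ_apply', lapSeq]

theorem degree_add_single (α : Fin m →₀ ℕ) (l : Fin m) (a : ℕ) :
    (α + Finsupp.single l a).degree = α.degree + a := by
  rw [map_add, Finsupp.degree_single]

theorem lapSeq_iterate_congr {c c' : (Fin m →₀ ℕ) → ℝ} (i : ℕ) {α : Fin m →₀ ℕ}
    (h : ∀ β, β.degree = α.degree + 2 * i → c β = c' β) :
    lapSeq^[i] c α = lapSeq^[i] c' α := by
  induction i generalizing α with
  | zero => exact h α (by simp)
  | succ i ih =>
    rw [lapSeq_iterate_succ, lapSeq_iterate_succ]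
    refine Finset.sum_congr rfl fun l _ => ih fun β hβ => h β ?_
    rw [hβ, degree_add_single]; ring

theorem lapSeq_iterate_zero (i : ℕ) (α : Fin m →₀ ℕ) :
    lapSeq^[i] (fun _ => (0 : ℝ)) α = 0 := by
  induction i generalizing α with
  | zero => rfl
  | succ i ih => rw [lapSeq_iterate_succ]; exact Finset.sum_eq_zero fun l _ => ih _

theorem lapSeq_iterate_eq_zero {c : (Fin m →₀ ℕ) → ℝ} (i : ℕ) {α : Fin m →₀ ℕ}
    (h : ∀ β, β.degree = α.degree + 2 * i → c β = 0) : lapSeq^[i] c α = 0 := by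
  rw [lapSeq_iterate_congr i (c' := fun _ => 0) h, lapSeq_iterate_zero]

theorem abs_lapSeq_iterate_le {c : (Fin m →₀ ℕ) → ℝ} {C : ℝ} (h : ∀ β, |c β| ≤ C) (i : ℕ)
    (α : Fin m →₀ ℕ) : |lapSeq^[i] c α| ≤ m ^ i * C := by
  induction i generalizing α with
  | zero => simpa using h α
  | succ i ih =>
    rw [lapSeq_iterate_succ]
    refine (Finset.abs_sum_le_sum_abs _ _).trans ((Finset.sum_le_sum fun l _ => ih _).trans ?_)
    simp [pow_succ]
    linarith

/-- Solution of the chain of planar equations `Δ f_α = -∑ f_{α + 2 e_l}` with coefficients `c`. -/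
noncomputable def chainSum (S : ℕ) (c : ℕ → (Fin m →₀ ℕ) → ℝ) (I : ℕ) (α : Fin m →₀ ℕ) (z : ℂ) :
    ℝ :=
  ∑ i ∈ Finset.range I, ∑ j ∈ Finset.range S, lapSeq^[i] (c j) α * chain i j z

/-- The part of `chainSum` produced by coefficients of higher degree. -/
noncomputable def chainTail (S : ℕ) (c : ℕ → (Fin m →₀ ℕ) → ℝ) (I : ℕ) (α : Fin m →₀ ℕ) (z : ℂ) :
    ℝ :=
  ∑ i ∈ Finset.range I, ∑ j ∈ Finset.range S, lapSeq^[i + 1] (c j) α * chain (i + 1) j z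

theorem chainSum_succ (S : ℕ) (c : ℕ → (Fin m →₀ ℕ) → ℝ) (I : ℕ) (α : Fin m →₀ ℕ) (z : ℂ) :
    chainSum S c (I + 1) α z =
      chainTail S c I α z + ∑ j ∈ Finset.range S, c j α * chain 0 j z := by
  rw [chainSum, Finset.sum_range_succ']
  rfl

theorem continuous_chainTail (S : ℕ) (c : ℕ → (Fin m →₀ ℕ) → ℝ) (I : ℕ) (α : Fin m →₀ ℕ) :
    Continuous (chainTail S c I α) :=
  continuous_finsetSum _ fun i _ => continuous_finsetSum _ fun j _ =>
    continuous_const.mul (continuous_chain (i + 1) j)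

theorem contDiffAt_chainTail (S : ℕ) (c : ℕ → (Fin m →₀ ℕ) → ℝ) (I : ℕ) (α : Fin m →₀ ℕ) {z : ℂ}
    (hz : z ∈ Complex.slitPlane) : ContDiffAt ℝ 2 (chainTail S c I α) z :=
  ContDiffAt.sum fun i _ => ContDiffAt.sum fun j _ =>
    contDiffAt_const.mul (contDiffAt_chain (i + 1) j hz)

/-- The Laplacian sends `chain (i + 1) j` to `-chain i j`, and the outermost `lapSeq` unfolds into
the sum over l. The tail thus solves the equation of f_α with the expansions of the f_{α+2e_l} as
source. -/
theorem laplacian_chainTail (S : ℕ) (c : ℕ → (Fin m →₀ ℕ) → ℝ) (I : ℕ) (α : Fin m →₀ ℕ) {z : ℂ}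
    (hz : z ∈ Complex.slitPlane) :
    Δ (chainTail S c I α) z = -∑ l, chainSum S c I (α + Finsupp.single l 2) z := by
  unfold chainTail
  rw [laplacian_finset_sum _ fun i _ => ContDiffAt.sum fun j _ =>
    contDiffAt_const.mul (contDiffAt_chain (i + 1) j hz)]
  simp only [chainSum]
  rw [Finset.sum_comm, ← Finset.sum_neg_distrib]
  refine Finset.sum_congr rfl fun i _ => ?_
  rw [laplacian_finset_sum _ fun j _ => contDiffAt_const.mul (contDiffAt_chain (i + 1) j hz),
    Finset.sum_comm, ← Finset.sum_neg_distrib]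
  refine Finset.sum_congr rfl fun j _ => ?_
  rw [laplacian_const_mul _ (contDiffAt_chain (i + 1) j hz), laplacian_chain_succ i j hz,
    lapSeq_iterate_succ, ← Finset.sum_mul]
  ring

theorem abs_chain_le_coeff (i j : ℕ) {z : ℂ} (hz : ‖z‖ ≤ 1) : |chain i j z| ≤ |chainCoeff j i| := by
  refine (abs_chain_le i j z).trans (mul_le_of_le_one_right (abs_nonneg _) ?_)
  exact mul_le_one₀ (pow_le_one₀ (norm_nonneg _) hz) (Real.sqrt_nonneg _)
    (Real.sqrt_le_one.2 hz)

theorem abs_chainTail_le (S : ℕ) {c : ℕ → (Fin m →₀ ℕ) → ℝ} {C : ℝ} (hC : ∀ j α, |c j α| ≤ C)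
    (I : ℕ) (α : Fin m →₀ ℕ) {z : ℂ} (hz : ‖z‖ ≤ 1) :
    |chainTail S c I α z| ≤ (∑ i ∈ Finset.range I, ∑ j ∈ Finset.range S,
      (m : ℝ) ^ (i + 1) * |chainCoeff j (i + 1)|) * C := by
  have hC0 : 0 ≤ C := (abs_nonneg _).trans (hC 0 0)
  simp only [Finset.sum_mul]
  refine (Finset.abs_sum_le_sum_abs _ _).trans (Finset.sum_le_sum fun i _ => ?_)
  refine (Finset.abs_sum_le_sum_abs _ _).trans (Finset.sum_le_sum fun j _ => ?_)
  rw [abs_mul]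
  calc _ ≤ ((m : ℝ) ^ (i + 1) * C) * |chainCoeff j (i + 1)| :=
        mul_le_mul (abs_lapSeq_iterate_le (hC j) _ _) (abs_chain_le_coeff _ _ hz) (abs_nonneg _)
          (by positivity)
    _ = _ := by ring

/-- Families of planar functions like the tangential derivatives of a solution on the slice
orthogonal to the edge. -/
structure IsChainFamily (R : ℝ) (f : (Fin m →₀ ℕ) → ℂ → ℝ) : Prop where
  cont : ∀ α, ContinuousOn (f α) (closedBall 0 R)
  even : ∀ α, ∀ z ∈ closedBall (0 : ℂ) R, f α ((starRingEnd ℂ) z) = f α z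
  zero : ∀ α, ∀ z ∈ closedBall (0 : ℂ) R, z ∉ Complex.slitPlane → f α z = 0
  diff : ∀ α, ∀ z ∈ ball (0 : ℂ) R, z ∈ Complex.slitPlane → ContDiffAt ℝ 2 (f α) z
  lap : ∀ α, ∀ z ∈ ball (0 : ℂ) R, z ∈ Complex.slitPlane →
    Δ (f α) z = -∑ l, f (α + Finsupp.single l 2) z

/-- The order to which `f_α` can be expanded when `|α| ≤ S`. -/
noncomputable def chainOrder (S : ℕ) (α : Fin m →₀ ℕ) : ℕ := 2 * ((S - α.degree) / 2)

/-- One member of the family is expanded once the members of higher order are. -/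
theorem exists_chain_expansion_step (S s : ℕ) (hs : s + 2 ≤ S) {R : ℝ} (hR : 0 < R) (hR1 : R ≤ 1)
    (A : ℝ) (hA : 0 ≤ A) :
    ∃ C : ℝ, 0 ≤ C ∧ ∀ f : (Fin m →₀ ℕ) → ℂ → ℝ, IsChainFamily R f →
      ∀ c : ℕ → (Fin m →₀ ℕ) → ℝ, (∀ j α, |c j α| ≤ A) →
      ∀ α : Fin m →₀ ℕ, (∀ z ∈ closedBall (0 : ℂ) R, |f α z| ≤ A) →
      (∀ l, ∀ z ∈ closedBall (0 : ℂ) R, |f (α + Finsupp.single l 2) z -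
        chainSum S c S (α + Finsupp.single l 2) z| ≤ A * ‖z‖ ^ s) →
      ∃ c' : ℕ → ℝ, (∀ j, |c' j| ≤ C) ∧ (∀ j, s + 2 ≤ j → c' j = 0) ∧
        ∀ z ∈ closedBall (0 : ℂ) R, |f α z - (chainTail S c S α z +
          ∑ j ∈ Finset.range S, c' j * chain 0 j z)| ≤ C * ‖z‖ ^ (s + 2) := by
  obtain ⟨C, hC0, hC⟩ := exists_slitHarmonic_expansion s hR hR1
  set B : ℝ := ∑ i ∈ Finset.range S, ∑ j ∈ Finset.range S,
      (m : ℝ) ^ (i + 1) * |chainCoeff j (i + 1)| with hB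
  have hB0 : 0 ≤ B := Finset.sum_nonneg fun i _ => Finset.sum_nonneg fun j _ => by positivity
  set A' : ℝ := A + B * A + m * A + 1 with hA'
  have hA'0 : 0 < A' := by positivity
  refine ⟨C * A', by positivity, fun f hf c hc α hfα hfl => ?_⟩
  have hz1 : ∀ z ∈ closedBall (0 : ℂ) R, ‖z‖ ≤ 1 := fun z hz =>
    (mem_closedBall_zero_iff.1 hz).trans hR1
  -- After the tail is subtracted, the Laplacian is the sum over l of the expansion errors of
  -- f_{α+2e_l}, hence O(|z|^s). The remainder can then be expanded in the homogeneous solutions.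
  obtain ⟨c', h1, h2, h3⟩ := hC A' hA'0 (fun z => f α z - chainTail S c S α z)
    ((hf.cont α).sub (continuous_chainTail S c S α).continuousOn)
    (fun z hz => by
      simp only [hf.even α z hz, chainTail, chain_conj])
    (fun z hz hs => by
      simp only [hf.zero α z hz hs, chainTail, chain_eq_zero _ _ hs, mul_zero,
        Finset.sum_const_zero, sub_zero])
    (fun z hz hs => by
      refine ⟨(hf.diff α z hz hs).sub (contDiffAt_chainTail S c S α hs), ?_⟩
      rw [laplacian_sub' (hf.diff α z hz hs) (contDiffAt_chainTail S c S α hs), hf.lap α z hz hs,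
        laplacian_chainTail S c S α hs, neg_sub_neg, ← Finset.sum_sub_distrib]
      have h4 : ∀ l ∈ (Finset.univ : Finset (Fin m)), |chainSum S c S (α + Finsupp.single l 2) z -
          f (α + Finsupp.single l 2) z| ≤ A * ‖z‖ ^ s := fun l _ => by
        rw [abs_sub_comm]; exact hfl l z (ball_subset_closedBall hz)
      refine ((Finset.abs_sum_le_sum_abs _ _).trans (Finset.sum_le_sum h4)).trans ?_
      rw [Finset.sum_const, Finset.card_univ, Fintype.card_fin, nsmul_eq_mul, ← mul_assoc]
      refine mul_le_mul_of_nonneg_right ?_ (by positivity)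
      have : 0 ≤ B * A := by positivity
      linarith)
    (fun z hz => by
      have h4 := hfα z hz
      have h5 := abs_chainTail_le S hc S α (hz1 z hz)
      have h6 := abs_sub (f α z) (chainTail S c S α z)
      have : 0 ≤ m * A := by positivity
      rw [← hB] at h5
      linarith)
  refine ⟨c', h1, h2, fun z hz => ?_⟩
  have h4 : ∑ j ∈ Finset.range S, c' j * chain 0 j z =
      ∑ j ∈ Finset.range (s + 2), c' j * slitHarmonic j z := by
    symm
    rw [← Finset.sum_subset (Finset.range_mono hs) fun j _ hj => by
      rw [h2 j (by simpa using hj), zero_mul]]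
    exact Finset.sum_congr rfl fun j _ => by simp [chain, chainCoeff]
  rw [h4, ← sub_sub]
  exact h3 z hz

theorem chainSum_congr {S : ℕ} {c c' : ℕ → (Fin m →₀ ℕ) → ℝ} (I : ℕ) {α : Fin m →₀ ℕ}
    (h : ∀ j β, α.degree ≤ β.degree → c j β = c' j β) (z : ℂ) :
    chainSum S c I α z = chainSum S c' I α z :=
  Finset.sum_congr rfl fun i _ => Finset.sum_congr rfl fun j _ => by
    rw [lapSeq_iterate_congr i fun β hβ => h j β (by omega)]

/-- The tail at `α` involves only coefficients of degree at least |α| + 2. Those of degree |α| can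
therefore be chosen afterwards without disturbing it. -/
theorem chainTail_congr {S : ℕ} {c c' : ℕ → (Fin m →₀ ℕ) → ℝ} (I : ℕ) {α : Fin m →₀ ℕ}
    (h : ∀ j β, α.degree + 2 ≤ β.degree → c j β = c' j β) (z : ℂ) :
    chainTail S c I α z = chainTail S c' I α z :=
  Finset.sum_congr rfl fun i _ => Finset.sum_congr rfl fun j _ => by
    rw [lapSeq_iterate_congr (i + 1) fun β hβ => h j β (by omega)]

/-- The extra layer i = S involves coefficients of degree |α| + 2S ≥ S, where `chainOrder` is 0 and
all coefficients vanish. -/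
theorem chainSum_succ_eq {S : ℕ} {c : ℕ → (Fin m →₀ ℕ) → ℝ}
    (hc : ∀ j α, chainOrder S α ≤ j → c j α = 0) (α : Fin m →₀ ℕ) (z : ℂ) :
    chainSum S c (S + 1) α z = chainSum S c S α z := by
  rw [chainSum, Finset.sum_range_succ, ← chainSum, add_eq_left]
  refine Finset.sum_eq_zero fun j _ => ?_
  rw [lapSeq_iterate_eq_zero S fun β hβ => hc j β (by rw [chainOrder]; omega), zero_mul]

/-- Induction on the codegree S - |α|. For |α| ≥ S - 1 the order is 0, so boundedness suffices with
zero coefficients. Each further step fixes the coefficients of one lower degree from the expansions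
two degrees higher, gaining two orders. -/
theorem exists_chain_expansion_of_degree (S t : ℕ) {R : ℝ} (hR : 0 < R) (hR1 : R ≤ 1)
    (A : ℝ) (hA : 0 ≤ A) :
    ∃ C : ℝ, 0 ≤ C ∧ ∀ f : (Fin m →₀ ℕ) → ℂ → ℝ, IsChainFamily R f →
      (∀ α : Fin m →₀ ℕ, α.degree ≤ S → ∀ z ∈ closedBall (0 : ℂ) R, |f α z| ≤ A) →
      ∃ c : ℕ → (Fin m →₀ ℕ) → ℝ, (∀ j α, |c j α| ≤ C) ∧
        (∀ j α, chainOrder S α ≤ j → c j α = 0) ∧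
        ∀ α : Fin m →₀ ℕ, α.degree ≤ S → S ≤ α.degree + t + 1 → ∀ z ∈ closedBall (0 : ℂ) R,
          |f α z - chainSum S c S α z| ≤ C * ‖z‖ ^ chainOrder S α := by
  induction t with
  | zero =>
    refine ⟨A, hA, fun f _ hfA => ⟨fun _ _ => 0, by simpa using hA, fun _ _ _ => rfl,
      fun α h1 h2 z hz => ?_⟩⟩
    have h3 : chainOrder S α = 0 := by rw [chainOrder]; omega
    have h4 : chainSum S (fun _ (_ : Fin m →₀ ℕ) => (0 : ℝ)) S α z = 0 :=
      Finset.sum_eq_zero fun i _ => Finset.sum_eq_zero fun j _ => by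
        rw [lapSeq_iterate_zero, zero_mul]
    rw [h3, h4, pow_zero, mul_one, sub_zero]
    exact hfA α h1 z hz
  | succ t ih =>
    obtain ⟨C, hC0, hC⟩ := ih
    by_cases hSt : S < t + 2
    · refine ⟨C, hC0, fun f hf hfA => ?_⟩
      obtain ⟨c, h1, h2, h3⟩ := hC f hf hfA
      exact ⟨c, h1, h2, fun α hα _ => h3 α hα (by omega)⟩
    -- The new multi-indices have degree S - t - 2, so those of α + 2e_l have degree S - t and order
    -- 2(t/2). The bound on S guarantees that this degree exists without truncated subtraction.
    set s : ℕ := 2 * (t / 2) with hs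
    obtain ⟨C', hC'0, hC'⟩ := exists_chain_expansion_step (m := m) S s (by omega) hR hR1 (A + C)
      (by positivity)
    refine ⟨max C C', le_max_of_le_left hC0, fun f hf hfA => ?_⟩
    obtain ⟨c, h1, h2, h3⟩ := hC f hf hfA
    have key : ∀ α : Fin m →₀ ℕ, α.degree + (t + 2) = S → ∃ c' : ℕ → ℝ, (∀ j, |c' j| ≤ C') ∧
        (∀ j, s + 2 ≤ j → c' j = 0) ∧
        ∀ z ∈ closedBall (0 : ℂ) R, |f α z - (chainTail S c S α z +
          ∑ j ∈ Finset.range S, c' j * chain 0 j z)| ≤ C' * ‖z‖ ^ (s + 2) := fun α hα => by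
      refine hC' f hf c (fun j β => (h1 j β).trans (by linarith)) α
        (fun z hz => (hfA α (by omega) z hz).trans (by linarith)) fun l z hz => ?_
      have hdeg := degree_add_single α l 2
      refine (h3 _ (by omega) (by omega) z hz).trans ?_
      have h4 : chainOrder S (α + Finsupp.single l 2) = s := by rw [chainOrder, hdeg, hs]; omega
      rw [h4]
      exact mul_le_mul_of_nonneg_right (by linarith) (by positivity)
    choose! c' hc1 hc2 hc3 using key
    -- Only one degree is overwritten. The expansions already obtained depend on strictly higher
    -- degrees and stay valid.
    set d : ℕ → (Fin m →₀ ℕ) → ℝ := fun j α => if α.degree + (t + 2) = S then c' α j else c j α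
      with hd
    have hdc : ∀ j α, S < α.degree + (t + 2) → d j α = c j α := fun j α hα => by
      simp only [hd]; rw [if_neg (by omega)]
    have hdc' : ∀ j α, α.degree + (t + 2) = S → d j α = c' α j := fun j α hα => by
      simp only [hd]; rw [if_pos hα]
    have hd0 : ∀ j α, chainOrder S α ≤ j → d j α = 0 := fun j α hj => by
      simp only [hd]
      split_ifs with h
      · exact hc2 α h j (by rw [chainOrder] at hj; omega)
      · exact h2 j α hj
    refine ⟨d, fun j α => ?_, hd0, fun α hα hαt z hz => ?_⟩
    · simp only [hd]
      split_ifs with h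
      · exact (hc1 α h j).trans (le_max_right _ _)
      · exact (h1 j α).trans (le_max_left _ _)
    · rcases Nat.lt_or_ge S (α.degree + (t + 2)) with h | h
      · rw [chainSum_congr S (fun j β hβ => hdc j β (by omega)) z]
        exact (h3 α hα (by omega) z hz).trans
          (mul_le_mul_of_nonneg_right (le_max_left _ _) (by positivity))
      · have h4 : α.degree + (t + 2) = S := by omega
        have h5 : chainOrder S α = s + 2 := by rw [chainOrder, hs]; omega
        rw [← chainSum_succ_eq hd0, chainSum_succ,
          chainTail_congr S (fun j β hβ => hdc j β (by omega)) z, h5]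
        simp only [hdc' _ α h4]
        exact (hc3 α h4 z hz).trans
          (mul_le_mul_of_nonneg_right (le_max_right _ _) (by positivity))

theorem exists_chain_expansion (m S : ℕ) {R : ℝ} (hR : 0 < R) (hR1 : R ≤ 1)
    (A : ℝ) (hA : 0 ≤ A) :
    ∃ C : ℝ, 0 ≤ C ∧ ∀ f : (Fin m →₀ ℕ) → ℂ → ℝ, IsChainFamily R f →
      (∀ α : Fin m →₀ ℕ, α.degree ≤ S → ∀ z ∈ closedBall (0 : ℂ) R, |f α z| ≤ A) →
      ∃ c : ℕ → (Fin m →₀ ℕ) → ℝ, (∀ j α, |c j α| ≤ C) ∧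
        (∀ j α, chainOrder S α ≤ j → c j α = 0) ∧
        ∀ α : Fin m →₀ ℕ, α.degree ≤ S → ∀ z ∈ closedBall (0 : ℂ) R,
          |f α z - chainSum S c S α z| ≤ C * ‖z‖ ^ chainOrder S α := by
  obtain ⟨C, hC0, hC⟩ := exists_chain_expansion_of_degree (m := m) S S hR hR1 A hA
  refine ⟨C, hC0, fun f hf hfA => ?_⟩
  obtain ⟨c, h1, h2, h3⟩ := hC f hf hfA
  exact ⟨c, h1, h2, fun α hα => h3 α hα (by omega)⟩

/-- Harmonicity of `D α` equates the planar Laplacian on the slice with minus the tangential one.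
Each second tangential derivative is the member of the jet with index α + 2e_l. -/
theorem IsTangentialJet.isChainFamily {R R' : ℝ} {D : (Fin m →₀ ℕ) → Space m → ℝ}
    (hD : IsTangentialJet R D) (hR : R' < R) : IsChainFamily R' fun α z => D α (slice z) := by
  have hmem : ∀ z ∈ closedBall (0 : ℂ) R', (slice z : Space m) ∈ ball (0 : Space m) R :=
    fun z hz => by
    rw [mem_ball_zero_iff, norm_slice]
    exact (mem_closedBall_zero_iff.1 hz).trans_lt hR
  have hdiff : ∀ α, ∀ z ∈ ball (0 : ℂ) R', z ∈ Complex.slitPlane →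
      HarmonicAt (D α) (slice z : Space m) := fun α z hz hs =>
    (hD.sol α).harm _ (hmem z (ball_subset_closedBall hz)) (by simpa using hs)
  refine ⟨fun α => ((hD.sol α).cont).comp (by fun_prop) hmem, fun α z hz => ?_,
    fun α z hz hs => (hD.sol α).zero _ (hmem z hz) (by simpa using hs),
    fun α z hz hs => (hdiff α z hz hs).1.comp z slice.contDiff.contDiffAt, fun α z hz hs => ?_⟩
  · have h1 : (slice ((starRingEnd ℂ) z) : Space m) = reflect (slice z) :=
      space_ext (by simp [tang_reflect]) (by simp [planar_reflect])
    simp only [h1, (hD.sol α).even _ (hmem z hz)]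
  · rw [laplacian_comp_slice (hdiff α z hz hs).1, (hdiff α z hz hs).2.self_of_nhds, Pi.zero_apply,
      zero_sub]
    congr 1
    refine Finset.sum_congr rfl fun l _ => ?_
    have hX := hmem z (ball_subset_closedBall hz)
    have h2 : ∀ᶠ t : ℝ in 𝓝 0, (slice z : Space m) + t • tangent l ∈ ball (0 : Space m) R := by
      have hc : ContinuousAt (fun t : ℝ => (slice z : Space m) + t • tangent l) 0 := by fun_prop
      exact hc.eventually (isOpen_ball.mem_nhds (by simpa using hX))
    refine fderiv_fderiv_eq_of_hasDerivAt (hdiff α z hz hs).1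
      (g := fun t => D (α + Finsupp.single l 1) (slice z + t • tangent l)) ?_ ?_
    · filter_upwards [h2] with t ht
      have h3 := hD.deriv α l _ ht
      have h4 : HasDerivAt (fun s : ℝ => D α (slice z + t • tangent l + (s - t) • tangent l))
          (D (α + Finsupp.single l 1) (slice z + t • tangent l)) t := by
        have h5 := HasDerivAt.comp_sub_const (f := fun s : ℝ =>
          D α (slice z + t • tangent l + s • tangent l)) t t (by simpa using h3)
        exact h5
      refine h4.congr_of_eventuallyEq (Eventually.of_forall fun s => ?_)
      simp only [add_assoc, ← add_smul, add_sub_cancel]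
    · have h3 := hD.deriv (α + Finsupp.single l 1) l _ hX
      have h4 : α + Finsupp.single l 1 + Finsupp.single l 1 = α + Finsupp.single l 2 := by
        rw [add_assoc, ← Finsupp.single_add]
      rwa [h4] at h3

end ChainExpansion

/-! ### Taylor polynomials in the tangential variables. -/

section Taylor

open MvPolynomial

variable {m : ℕ}

/-- Multi-indices of degree at most `k`. -/
noncomputable def multiIndices (m k : ℕ) : Finset (Fin m →₀ ℕ) :=
  (Finsupp.finite_of_degree_le (σ := Fin m) k).toFinset

@[simp] theorem mem_multiIndices {k : ℕ} {β : Fin m →₀ ℕ} :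
    β ∈ multiIndices m k ↔ β.degree ≤ k := by
  simp [multiIndices]

/-- The factorial of a multi-index. -/
noncomputable def multiFactorial (β : Fin m →₀ ℕ) : ℝ := ∏ l, ((β l).factorial : ℝ)

theorem one_le_multiFactorial (β : Fin m →₀ ℕ) : 1 ≤ multiFactorial β := by
  unfold multiFactorial
  exact_mod_cast Nat.succ_le_of_lt (Finset.prod_pos fun l _ => Nat.factorial_pos (β l))

theorem multiFactorial_add_single (β : Fin m →₀ ℕ) (l : Fin m) :
    multiFactorial (β + Finsupp.single l 1) = (β l + 1) * multiFactorial β := by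
  unfold multiFactorial
  rw [← Finset.mul_prod_erase _ _ (Finset.mem_univ l), ← Finset.mul_prod_erase _ (fun l => ((β l).factorial : ℝ)) (Finset.mem_univ l), ← mul_assoc]
  congr 1
  · simp [Nat.factorial_succ]
  · refine Finset.prod_congr rfl fun i hi => ?_
    simp [(Finset.ne_of_mem_erase hi).symm]

/-- The Taylor polynomial of degree `k - s` with derivatives `c`. -/
noncomputable def taylor (k s : ℕ) (c : (Fin m →₀ ℕ) → ℝ) : MvPolynomial (Fin m) ℝ :=
  ∑ β ∈ multiIndices m k, if β.degree + s ≤ k then monomial β (c β / multiFactorial β) else 0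

theorem coeff_taylor (k s : ℕ) (c : (Fin m →₀ ℕ) → ℝ) (β : Fin m →₀ ℕ) :
    coeff β (taylor k s c) = if β.degree + s ≤ k then c β / multiFactorial β else 0 := by
  classical
  rw [taylor, coeff_sum, Finset.sum_eq_single β]
  · split_ifs <;> simp
  · intro γ _ hγ
    split_ifs
    · rw [coeff_monomial, if_neg hγ]
    · simp
  · intro hβ
    rw [mem_multiIndices] at hβ
    rw [if_neg (by omega)]; simp

theorem pderiv_taylor (k s : ℕ) (c : (Fin m →₀ ℕ) → ℝ) (l : Fin m) :
    pderiv l (taylor k s c) = taylor k (s + 1) fun β => c (β + Finsupp.single l 1) := by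
  ext β
  rw [coeff_pderiv, coeff_taylor, coeff_taylor, degree_add_single, multiFactorial_add_single]
  have h1 := (one_le_multiFactorial β).trans_lt' zero_lt_one
  by_cases h : β.degree + (s + 1) ≤ k
  · rw [if_pos (by omega), if_pos h]
    have : (β l + 1 : ℝ) ≠ 0 := by positivity
    field_simp
  · rw [if_neg (by omega), if_neg h, zero_mul]

theorem taylor_succ_succ (k s : ℕ) (c : (Fin m →₀ ℕ) → ℝ) :
    taylor (k + 1) (s + 1) c = taylor k s c := by
  ext β
  simp only [coeff_taylor, ← add_assoc, add_le_add_iff_right]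

/-- The cutoff |β| + s ≤ k, unlike |β| ≤ k - s with truncated subtraction, removes even the constant
term once s > k. This is what terminates the chain in `jetModel`. -/
theorem taylor_eq_zero {k s : ℕ} (h : k < s) (c : (Fin m →₀ ℕ) → ℝ) : taylor k s c = 0 := by
  ext β
  rw [coeff_taylor, if_neg (by omega), coeff_zero]

theorem taylor_sum {ι : Type*} (t : Finset ι) (k s : ℕ) (c : ι → (Fin m →₀ ℕ) → ℝ) :
    taylor k s (fun β => ∑ i ∈ t, c i β) = ∑ i ∈ t, taylor k s (c i) := by
  ext β
  rw [coeff_sum]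
  simp only [coeff_taylor]
  split_ifs
  · rw [Finset.sum_div]
  · simp

/-- The coefficients are derivatives at 0, so the tangential Laplacian acts on them as `lapSeq` and
lowers the degree bound by two. -/
theorem sum_pderiv_pderiv_taylor (k s : ℕ) (c : (Fin m →₀ ℕ) → ℝ) :
    ∑ l, pderiv l (pderiv l (taylor k s c)) = taylor k (s + 2) (lapSeq c) := by
  simp only [pderiv_taylor]
  rw [show lapSeq c = fun β => ∑ l, c (β + Finsupp.single l 2) from rfl, taylor_sum]
  refine Finset.sum_congr rfl fun l _ => ?_
  congr 1
  funext β
  rw [add_assoc, ← Finsupp.single_add]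

theorem totalDegree_taylor_le (k s : ℕ) (c : (Fin m →₀ ℕ) → ℝ) :
    (taylor k s c).totalDegree ≤ k - s := by
  refine totalDegree_finsetSum_le fun β _ => ?_
  split_ifs with h
  · refine (totalDegree_monomial_le _ _).trans ?_
    have : (β.sum fun _ => id) = β.degree := rfl
    omega
  · simp

/-- The monomial `y^β / β!`. -/
noncomputable def multiPow (β : Fin m →₀ ℕ) (y : Fin m → ℝ) : ℝ :=
  (β.prod fun l e => y l ^ e) / multiFactorial β

theorem eval_taylor {k K : ℕ} (hK : k ≤ K) (s : ℕ) (c : (Fin m →₀ ℕ) → ℝ) (y : Fin m → ℝ) :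
    eval y (taylor k s c) =
      ∑ β ∈ multiIndices m K, if β.degree + s ≤ k then c β * multiPow β y else 0 := by
  have hsub : multiIndices m k ⊆ multiIndices m K := fun β hβ => by
    rw [mem_multiIndices] at hβ ⊢; omega
  rw [← Finset.sum_subset hsub, taylor, map_sum]
  · refine Finset.sum_congr rfl fun β _ => ?_
    split_ifs
    · rw [eval_monomial, multiPow]; ring
    · simp
  · intro β _ hβ
    rw [mem_multiIndices] at hβ
    rw [if_neg (by omega)]

theorem abs_multiPow_le (β : Fin m →₀ ℕ) {y : Fin m → ℝ} {r : ℝ} (hy : ∀ l, |y l| ≤ r) :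
    |multiPow β y| ≤ r ^ β.degree := by
  have h1 := one_le_multiFactorial β
  have h2 : |β.prod fun l e => y l ^ e| ≤ r ^ β.degree := by
    rw [Finsupp.degree_apply, Finsupp.prod, Finset.abs_prod, ← Finset.prod_pow_eq_pow_sum]
    refine Finset.prod_le_prod (fun _ _ => abs_nonneg _) fun l _ => ?_
    rw [abs_pow]
    exact pow_le_pow_left₀ (abs_nonneg _) (hy l) _
  rw [multiPow, abs_div, abs_of_pos (zero_lt_one.trans_le h1)]
  exact (div_le_self (abs_nonneg _) h1).trans h2

theorem contDiff_eval (p : MvPolynomial (Fin m) ℝ) {n : WithTop ℕ∞} :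
    ContDiff ℝ n fun y : Fin m → ℝ => eval y p := by
  induction p using MvPolynomial.induction_on with
  | C a => simpa using contDiff_const
  | add p q hp hq => simpa using hp.add hq
  | mul_X p l hp => simpa using hp.mul (contDiff_apply ℝ ℝ l)

theorem hasDerivAt_eval_line (p : MvPolynomial (Fin m) ℝ) (y v : Fin m → ℝ) (t : ℝ) :
    HasDerivAt (fun t : ℝ => eval (y + t • v) p)
      (∑ l, v l * eval (y + t • v) (pderiv l p)) t := by
  classical
  induction p using MvPolynomial.induction_on with
  | C a => simpa using hasDerivAt_const t a
  | add p q hp hq =>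
    simp only [map_add, mul_add, Finset.sum_add_distrib]
    exact hp.add hq
  | mul_X p i hp =>
    have h1 : HasDerivAt (fun t : ℝ => y i + t * v i) (v i) t := by
      simpa using ((hasDerivAt_id t).mul_const (v i)).const_add (y i)
    have h2 := hp.mul h1
    simp only [map_mul, eval_X, Pi.add_apply, Pi.smul_apply, smul_eq_mul]
    refine h2.congr_deriv ?_
    have h3 : ∀ l, v l * eval (y + t • v) (pderiv l (p * X i)) =
        v l * (eval (y + t • v) p * eval (y + t • v) (pderiv l (X i))) +
          v l * eval (y + t • v) (pderiv l p) * (y i + t * v i) := fun l => by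
      simp only [Derivation.leibniz, smul_eq_mul, map_add, map_mul, eval_X, Pi.add_apply,
        Pi.smul_apply]
      ring
    simp only [h3, Finset.sum_add_distrib, ← Finset.sum_mul]
    rw [add_comm]
    congr 1
    rw [Finset.sum_eq_single i]
    · rw [pderiv_X_self, map_one]; ring
    · intro l _ hl
      rw [pderiv_X_of_ne hl.symm, map_zero, mul_zero, mul_zero]
    · simp

end Taylor

/-! ### Taylor's formula for jets around the slice. -/

section JetTaylor

open MvPolynomial

variable {m : ℕ} {R : ℝ} {D : (Fin m →₀ ℕ) → Space m → ℝ}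

theorem slice_add_shift_self (X : Space m) : slice (planar X) + shift (tang X) = X :=
  space_ext (by simp) (by simp)

theorem shift_eq_sum (y : Fin m → ℝ) : shift y = ∑ l, y l • (tangent l : Space m) := by
  refine space_ext ?_ (by simp)
  funext i
  simp [Pi.single_apply]

theorem IsTangentialJet.hasDerivAt_line (hD : IsTangentialJet R D) (α : Fin m →₀ ℕ) {X : Space m}
    (y : Fin m → ℝ) (t : ℝ) (hX : X + t • shift y ∈ ball (0 : Space m) R)
    (hs : planar X ∈ Complex.slitPlane) :
    HasDerivAt (fun t : ℝ => D α (X + t • shift y))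
      (∑ l, y l * D (α + Finsupp.single l 1) (X + t • shift y)) t := by
  have hs' : planar (X + t • shift y) ∈ Complex.slitPlane := by simpa using hs
  have hd : DifferentiableAt ℝ (D α) (X + t • shift y) :=
    ((hD.sol α).harm _ hX hs').1.differentiableAt (by norm_num)
  refine (FlatSlit.hasDerivAt_line hd).congr_deriv ?_
  nth_rw 2 [shift_eq_sum]
  rw [map_sum]
  refine Finset.sum_congr rfl fun l _ => ?_
  rw [map_smul, smul_eq_mul]
  congr 1
  have h2 := FlatSlit.hasDerivAt_line (f := D α) (x := X + t • shift y) (v := tangent l) (t := 0)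
    (by simpa using hd)
  simpa using h2.unique (hD.deriv α l _ hX)

theorem norm_slice_add_smul_shift_le (X : Space m) {t : ℝ} (ht : t ∈ Icc (0 : ℝ) 1) :
    ‖slice (planar X) + t • shift (tang X)‖ ≤ ‖X‖ := by
  refine abs_le_of_sq_le_sq' ?_ (norm_nonneg _) |>.2
  rw [norm_sq_eq, norm_sq_eq X]
  simp only [map_add, map_smul, tang_slice, tang_shift, planar_slice, planar_shift, zero_add,
    smul_zero, add_zero, Pi.smul_apply, smul_eq_mul, mul_pow]
  have h1 : t ^ 2 ≤ 1 := pow_le_one₀ ht.1 ht.2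
  gcongr with l
  exact mul_le_of_le_one_left (sq_nonneg _) h1

/-- Taylor's formula in the tangential directions. -/
theorem IsTangentialJet.abs_sub_taylor_le (hD : IsTangentialJet R D) {S : ℕ} {C : ℝ}
    (hC : ∀ α, α.degree ≤ S → ∀ X ∈ ball (0 : Space m) R, |D α X| ≤ C) (N : ℕ)
    (α : Fin m →₀ ℕ) (hα : α.degree + N ≤ S) {X : Space m} (hX : X ∈ ball (0 : Space m) R) :
    |D α X - eval (tang X) (taylor N 1 fun β => D (α + β) (slice (planar X)))| ≤
      C * (m * ‖X‖) ^ N := by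
  have hXR : ‖X‖ < R := by simpa using hX
  have hC0 : 0 ≤ C := (abs_nonneg _).trans (hC 0 (by simp) X hX)
  by_cases hs : planar X ∈ Complex.slitPlane
  swap
  · have hz : (slice (planar X) : Space m) ∈ ball (0 : Space m) R := by
      rw [mem_ball_zero_iff, norm_slice]; exact (norm_planar_le X).trans_lt hXR
    have h1 : ∀ β, D (α + β) (slice (planar X)) = 0 := fun β =>
      (hD.sol _).zero _ hz (by simpa using hs)
    have h2 : eval (tang X) (taylor N 1 fun β => D (α + β) (slice (planar X))) = 0 := by
      rw [eval_taylor le_rfl]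
      simp [h1]
    rw [h2, (hD.sol α).zero X hX hs]
    simp only [sub_zero, abs_zero]
    positivity
  induction N generalizing α X with
  | zero =>
    rw [taylor_eq_zero zero_lt_one]
    simpa using hC α (by omega) X hX
  | succ N ih =>
    set z := planar X with hz
    set y := tang X with hy
    set P : ℝ → Space m := fun t => slice z + t • shift y with hP
    have hPR : ∀ t ∈ Icc (0 : ℝ) 1, P t ∈ ball (0 : Space m) R := fun t ht => by
      rw [mem_ball_zero_iff]; exact (norm_slice_add_smul_shift_le X ht).trans_lt hXR
    have hPs : ∀ t, planar (P t) = z := fun t => by simp [hP]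
    have hPt : ∀ t, tang (P t) = t • y := fun t => by simp [hP]
    set T := taylor (N + 1) 1 fun β => D (α + β) (slice z) with hT
    have hpd : ∀ l, pderiv l T = taylor N 1 fun β => D (α + Finsupp.single l 1 + β) (slice z) :=
      fun l => by
      rw [hT, pderiv_taylor, taylor_succ_succ]
      congr 1
      funext β
      congr 1
      abel
    -- Along the segment from the slice to `X`, the derivative of the remainder for `α` is a
    -- combination of the remainders of order `N` for α + e_l. The mean value inequality adds one
    -- factor m‖X‖, the `m` counting the directions.
    have hderiv : ∀ t ∈ Icc (0 : ℝ) 1, HasDerivAt (fun t => D α (P t) - eval (0 + t • y) T)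
        (∑ l, y l * (D (α + Finsupp.single l 1) (P t) - eval (0 + t • y) (pderiv l T))) t :=
      fun t ht => by
      simp only [mul_sub, Finset.sum_sub_distrib]
      exact (hD.hasDerivAt_line α y t (hPR t ht) (by simpa using hs)).sub
        (hasDerivAt_eval_line T 0 y t)
    have hbound : ∀ t ∈ Icc (0 : ℝ) 1,
        ‖∑ l, y l * (D (α + Finsupp.single l 1) (P t) - eval (0 + t • y) (pderiv l T))‖ ≤
          C * (m * ‖X‖) ^ (N + 1) := fun t ht => by
      have h1 : ∀ l ∈ (Finset.univ : Finset (Fin m)),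
          ‖y l * (D (α + Finsupp.single l 1) (P t) - eval (0 + t • y) (pderiv l T))‖ ≤
            ‖X‖ * (C * (m * ‖X‖) ^ N) := fun l _ => by
        have h2 := ih (α + Finsupp.single l 1) (by rw [degree_add_single]; omega) (hPR t ht)
          (by simpa using hPR t ht) (by rw [hPs]; exact hs)
        rw [hPs, hPt, ← hpd] at h2
        rw [norm_mul, zero_add]
        refine mul_le_mul (abs_tang_le X l) (h2.trans ?_) (norm_nonneg _) (norm_nonneg _)
        gcongr
        exact norm_slice_add_smul_shift_le X ht
      refine (norm_sum_le_of_le _ h1).trans (le_of_eq ?_)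
      rw [Finset.sum_const, Finset.card_univ, Fintype.card_fin, nsmul_eq_mul, pow_succ]
      ring
    have key := (convex_Icc (0 : ℝ) 1).norm_image_sub_le_of_norm_hasDerivWithin_le
      (fun t ht => (hderiv t ht).hasDerivWithinAt) hbound
      (left_mem_Icc.2 zero_le_one) (right_mem_Icc.2 zero_le_one)
    have e1 : P 1 = X := by simp only [hP, one_smul]; exact slice_add_shift_self X
    have e0 : D α (P 0) - eval (0 + (0 : ℝ) • y) T = 0 := by
      have : constantCoeff T = D α (slice z) := by
        rw [constantCoeff_eq, hT, coeff_taylor, if_pos (by simp)]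
        simp [multiFactorial]
      simp [hP, this]
    rw [e0, e1] at key
    simpa using key

end JetTaylor

/-! ### The harmonic model and its distance to a jet. -/

section JetModel

open MvPolynomial

variable {m : ℕ}

theorem contDiffAt_planar_mul_tang {F : ℂ → ℝ} (p : MvPolynomial (Fin m) ℝ) {X : Space m}
    (hF : ContDiffAt ℝ 2 F (planar X)) :
    ContDiffAt ℝ 2 (fun Y : Space m => F (planar Y) * eval (tang Y) p) X :=
  (contDiffAt_comp_planar hF).mul ((contDiff_eval p).comp tang.contDiff).contDiffAt

theorem laplacian_planar_mul_tang {F : ℂ → ℝ} (p : MvPolynomial (Fin m) ℝ) {X : Space m}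
    (hF : ContDiffAt ℝ 2 F (planar X)) :
    Δ (fun Y : Space m => F (planar Y) * eval (tang Y) p) X =
      Δ F (planar X) * eval (tang X) p +
        F (planar X) * eval (tang X) (∑ l, pderiv l (pderiv l p)) := by
  have hc := contDiffAt_planar_mul_tang p hF
  have hline : ∀ (p : MvPolynomial (Fin m) ℝ) (l : Fin m) (t : ℝ),
      HasDerivAt (fun t : ℝ => F (planar (X + t • tangent l)) *
        eval (tang (X + t • tangent l)) p)
        (F (planar (X + t • tangent l)) * eval (tang (X + t • tangent l)) (pderiv l p)) t :=
    fun p l t => by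
    have h1 := hasDerivAt_eval_line p (tang X) (Pi.single l 1) t
    rw [Finset.sum_eq_single l (fun i _ hi => by rw [Pi.single_eq_of_ne hi, zero_mul])
      (fun h => absurd (Finset.mem_univ l) h), Pi.single_eq_same, one_mul] at h1
    have h2 : ∀ t : ℝ, tang (X + t • tangent l) = tang X + t • Pi.single l 1 := fun t => by
      rw [map_add, map_smul, tang_tangent]
    simp only [h2, map_add, map_smul, planar_tangent, smul_zero, add_zero]
    exact h1.const_mul _
  have htan : ∀ l, fderiv ℝ (fderiv ℝ fun Y : Space m => F (planar Y) * eval (tang Y) p) X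
      (tangent l) (tangent l) = F (planar X) * eval (tang X) (pderiv l (pderiv l p)) := fun l =>
    fderiv_fderiv_eq_of_hasDerivAt hc (Eventually.of_forall (hline p l)) (by
      simpa using hline (pderiv l p) l 0)
  have hpl : ∀ w : ℂ, fderiv ℝ (fderiv ℝ fun Y : Space m => F (planar Y) * eval (tang Y) p) X
      (point (0, w)) (point (0, w)) =
      fderiv ℝ (fderiv ℝ F) (planar X) w w * eval (tang X) p := fun w => by
    refine fderiv_fderiv_eq_of_hasDerivAt hc
      (g := fun t => fderiv ℝ F (planar X + t • w) w * eval (tang X) p) ?_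
      ((hasDerivAt_fderiv_line hF w w).mul_const _)
    have h1 : ContinuousAt (fun t : ℝ => planar X + t • w) 0 := by fun_prop
    have h2 := h1.eventually (p := fun y => DifferentiableAt ℝ F y)
      (by simpa using hF.eventually_differentiableAt)
    filter_upwards [h2] with t ht
    simp only [map_add, map_smul, planar_point, tang_point, smul_zero, add_zero]
    exact (hasDerivAt_line ht).mul_const _
  rw [laplacian_space, laplacian_complex, hpl, hpl]
  simp only [htan, map_sum, Finset.mul_sum]
  ring

/-- The harmonic function with edge coefficients `c`, truncated at homogeneity `k + 1/2`. -/
noncomputable def jetModel (k S : ℕ) (c : ℕ → (Fin m →₀ ℕ) → ℝ) (X : Space m) : ℝ :=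
  ∑ i ∈ Finset.range S, ∑ j ∈ Finset.range S,
    chain i j (planar X) * eval (tang X) (taylor k (j + 2 * i) (lapSeq^[i] (c j)))

/-- The Laplacian telescopes over i: layer i gives G i from the tangential variables and -G (i - 1)
from the plane. Only G (S - 1) is left, and its Taylor polynomials vanish because j + 2S > k. -/
theorem harmonicAt_jetModel {k S : ℕ} (hS : k < 2 * S) (c : ℕ → (Fin m →₀ ℕ) → ℝ) {X : Space m}
    (hX : planar X ∈ Complex.slitPlane) : HarmonicAt (jetModel k S c) X := by
  have hcd : ∀ (Y : Space m), planar Y ∈ Complex.slitPlane → ∀ i j, ContDiffAt ℝ 2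
      (fun Y : Space m => chain i j (planar Y) *
        eval (tang Y) (taylor k (j + 2 * i) (lapSeq^[i] (c j)))) Y := fun Y hY i j =>
    contDiffAt_planar_mul_tang _ (contDiffAt_chain i j hY)
  refine ⟨ContDiffAt.sum fun i _ => ContDiffAt.sum fun j _ => hcd X hX i j, ?_⟩
  filter_upwards [isOpen_planar_slitPlane.mem_nhds hX] with Y hY
  unfold jetModel
  rw [laplacian_finset_sum _ fun i _ => ContDiffAt.sum fun j _ => hcd Y hY i j]
  set G : ℕ → ℝ := fun i => ∑ j ∈ Finset.range S, chain i j (planar Y) *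
    eval (tang Y) (taylor k (j + 2 * (i + 1)) (lapSeq^[i + 1] (c j))) with hG
  have hi : ∀ i, Δ (fun Y : Space m => ∑ j ∈ Finset.range S, chain i j (planar Y) *
      eval (tang Y) (taylor k (j + 2 * i) (lapSeq^[i] (c j)))) Y =
      G i - if i = 0 then 0 else G (i - 1) := fun i => by
    rw [laplacian_finset_sum _ fun j _ => hcd Y hY i j]
    simp only [laplacian_planar_mul_tang _ (contDiffAt_chain i _ hY), sum_pderiv_pderiv_taylor,
      Finset.sum_add_distrib]
    have h1 : ∑ j ∈ Finset.range S, chain i j (planar Y) * eval (tang Y)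
        (taylor k (j + 2 * i + 2) (lapSeq (lapSeq^[i] (c j)))) = G i :=
      Finset.sum_congr rfl fun j _ => by
        rw [← Function.iterate_succ_apply' lapSeq]; rfl
    rw [h1]
    cases i with
    | zero => simp [laplacian_chain_zero _ hY]
    | succ i =>
      simp only [laplacian_chain_succ i _ hY, neg_mul, Finset.sum_neg_distrib, Nat.succ_ne_zero,
        if_false, Nat.add_sub_cancel]
      rw [hG]
      ring
  simp only [hi]
  have hsum : ∀ n, ∑ i ∈ Finset.range n, (G i - if i = 0 then 0 else G (i - 1)) =
      if n = 0 then 0 else G (n - 1) := fun n => by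
    induction n with
    | zero => simp
    | succ n ih => rw [Finset.sum_range_succ, ih]; simp
  rw [hsum]
  split_ifs with h
  · rfl
  · refine Finset.sum_eq_zero fun j _ => ?_
    rw [taylor_eq_zero (by omega), map_zero, mul_zero]

theorem isSolution_jetModel {k S : ℕ} (hS : k < 2 * S) (c : ℕ → (Fin m →₀ ℕ) → ℝ) (R : ℝ) :
    IsSolution R (jetModel k S c) := by
  refine ⟨Continuous.continuousOn ?_, fun X _ => ?_, fun X _ hX => harmonicAt_jetModel hS c hX,
    fun X _ hX => ?_⟩
  · refine continuous_finsetSum _ fun i _ => continuous_finsetSum _ fun j _ => ?_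
    exact ((continuous_chain i j).comp planar.continuous).mul
      ((contDiff_eval (n := 0) _).continuous.comp tang.continuous)
  · simp only [jetModel, planar_reflect, tang_reflect, chain_conj]
  · simp only [jetModel, chain_eq_zero _ _ hX, zero_mul, Finset.sum_const_zero]

theorem jetModel_eq {k S : ℕ} (c : ℕ → (Fin m →₀ ℕ) → ℝ) (X : Space m) {K : ℕ} (hK : k ≤ K) :
    jetModel k S c X = ∑ β ∈ multiIndices m K, ∑ i ∈ Finset.range S, ∑ j ∈ Finset.range S,
      if β.degree + (j + 2 * i) ≤ k then
        lapSeq^[i] (c j) β * chain i j (planar X) * multiPow β (tang X) else 0 := by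
  rw [jetModel, Finset.sum_comm (s := multiIndices m K)]
  refine Finset.sum_congr rfl fun i _ => ?_
  rw [Finset.sum_comm (s := multiIndices m K)]
  refine Finset.sum_congr rfl fun j _ => ?_
  rw [eval_taylor hK, Finset.mul_sum]
  refine Finset.sum_congr rfl fun β _ => ?_
  split_ifs
  · ring
  · rw [mul_zero]

/-- Sum of the constants arising in estimates of `jetModel`. -/
noncomputable def jetConst (m S K : ℕ) : ℝ :=
  ∑ _β ∈ multiIndices m K, ∑ i ∈ Finset.range S, ∑ j ∈ Finset.range S,
    (m : ℝ) ^ i * |chainCoeff j i|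

theorem jetConst_nonneg (m S K : ℕ) : 0 ≤ jetConst m S K :=
  Finset.sum_nonneg fun _ _ => Finset.sum_nonneg fun _ _ => Finset.sum_nonneg fun _ _ => by
    positivity

theorem abs_jetModel_term_le {c : ℕ → (Fin m →₀ ℕ) → ℝ} {C : ℝ} (hc : ∀ j α, |c j α| ≤ C)
    (i j : ℕ) (β : Fin m →₀ ℕ) (X : Space m) :
    |lapSeq^[i] (c j) β * chain i j (planar X) * multiPow β (tang X)| ≤
      (m : ℝ) ^ i * |chainCoeff j i| * C * (‖X‖ ^ (β.degree + (j + 2 * i)) * √‖X‖) := by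
  have hC0 : 0 ≤ C := (abs_nonneg _).trans (hc 0 0)
  rw [abs_mul, abs_mul]
  have h1 := abs_lapSeq_iterate_le (hc j) i β
  have h2 : |chain i j (planar X)| ≤ |chainCoeff j i| * (‖X‖ ^ (2 * i + j) * √‖X‖) := by
    refine (abs_chain_le i j _).trans ?_
    have := norm_planar_le X
    gcongr
  have h3 := abs_multiPow_le β (y := tang X) (r := ‖X‖) (abs_tang_le X)
  calc _ ≤ ((m : ℝ) ^ i * C) * (|chainCoeff j i| * (‖X‖ ^ (2 * i + j) * √‖X‖)) *
        ‖X‖ ^ β.degree := by gcongr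
    _ = _ := by ring

theorem abs_jetModel_le {k S : ℕ} {c : ℕ → (Fin m →₀ ℕ) → ℝ} {C : ℝ} (hc : ∀ j α, |c j α| ≤ C)
    {X : Space m} (hX : ‖X‖ ≤ 1) : |jetModel k S c X| ≤ jetConst m S k * C := by
  have hC0 : 0 ≤ C := (abs_nonneg _).trans (hc 0 0)
  rw [jetModel_eq c X le_rfl, jetConst]
  simp only [Finset.sum_mul]
  refine (Finset.abs_sum_le_sum_abs _ _).trans (Finset.sum_le_sum fun β _ => ?_)
  refine (Finset.abs_sum_le_sum_abs _ _).trans (Finset.sum_le_sum fun i _ => ?_)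
  refine (Finset.abs_sum_le_sum_abs _ _).trans (Finset.sum_le_sum fun j _ => ?_)
  split_ifs
  · refine (abs_jetModel_term_le hc i j β X).trans (mul_le_of_le_one_right (by positivity) ?_)
    exact mul_le_one₀ (pow_le_one₀ (norm_nonneg _) hX) (Real.sqrt_nonneg _) (Real.sqrt_le_one.2 hX)
  · rw [abs_zero]; positivity

theorem self_le_sqrt {x : ℝ} (h0 : 0 ≤ x) (h1 : x ≤ 1) : x ≤ √x :=
  Real.le_sqrt_of_sq_le (by nlinarith)

/-- A jet whose derivatives have been expanded on the slice is approximated by `jetModel`. -/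
theorem IsTangentialJet.abs_sub_jetModel_le {R ρ A C : ℝ} {D : (Fin m →₀ ℕ) → Space m → ℝ}
    (hD : IsTangentialJet R D) (hρ : ρ < R) (hρ1 : ρ ≤ 1) {k : ℕ}
    (hA : ∀ α, α.degree ≤ k + 3 → ∀ X ∈ ball (0 : Space m) R, |D α X| ≤ A)
    {c : ℕ → (Fin m →₀ ℕ) → ℝ} (hc : ∀ j α, |c j α| ≤ C)
    (hexp : ∀ α : Fin m →₀ ℕ, α.degree ≤ k + 3 → ∀ z ∈ closedBall (0 : ℂ) ρ,
      |D α (slice z) - chainSum (k + 3) c (k + 3) α z| ≤ C * ‖z‖ ^ chainOrder (k + 3) α)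
    {X : Space m} (hX : ‖X‖ ≤ ρ) :
    |D 0 X - jetModel k (k + 3) c X| ≤
      (A * m ^ (k + 2) + (multiIndices m (k + 2)).card * C + jetConst m (k + 3) (k + 2) * C) *
        (‖X‖ ^ (k + 1) * √‖X‖) := by
  have hC0 : 0 ≤ C := (abs_nonneg _).trans (hc 0 0)
  have hX1 : ‖X‖ ≤ 1 := hX.trans hρ1
  have hsq : ‖X‖ ≤ √‖X‖ := self_le_sqrt (norm_nonneg _) hX1
  have hXR : X ∈ ball (0 : Space m) R := by
    rw [mem_ball_zero_iff]; exact hX.trans_lt hρ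
  have hA0 : 0 ≤ A := (abs_nonneg _).trans (hA 0 (by simp) X hXR)
  -- Errors of integer order k + 2 are more than is needed; half a power is given up to match the
  -- homogeneity of the terms dropped from the model.
  have hpow : ‖X‖ ^ (k + 2) ≤ ‖X‖ ^ (k + 1) * √‖X‖ := by
    rw [pow_succ ‖X‖ (k + 1)]; gcongr
  set z := planar X with hz
  have hzX : ‖z‖ ≤ ‖X‖ := norm_planar_le X
  set T₁ : ℝ := ∑ β ∈ multiIndices m (k + 2),
    if β.degree + 1 ≤ k + 2 then D β (slice z) * multiPow β (tang X) else 0 with hT₁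
  set T₂ : ℝ := ∑ β ∈ multiIndices m (k + 2),
    if β.degree + 1 ≤ k + 2 then chainSum (k + 3) c (k + 3) β z * multiPow β (tang X) else 0
    with hT₂
  have h1 : |D 0 X - T₁| ≤ A * m ^ (k + 2) * (‖X‖ ^ (k + 1) * √‖X‖) := by
    have h := hD.abs_sub_taylor_le hA (k + 2) 0 (by simp) hXR
    rw [eval_taylor le_rfl] at h
    simp only [zero_add] at h
    refine h.trans ?_
    rw [mul_pow, ← mul_assoc]
    gcongr
  -- Since `chainOrder` rounds k + 3 - |β| down to an even number, its sum with |β| is at least k +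
  -- 2. This parity loss is why the expansion is taken to order k + 3.
  have h2 : |T₁ - T₂| ≤ (multiIndices m (k + 2)).card * C * (‖X‖ ^ (k + 1) * √‖X‖) := by
    rw [hT₁, hT₂, ← Finset.sum_sub_distrib, mul_assoc, ← nsmul_eq_mul, ← Finset.sum_const]
    refine (Finset.abs_sum_le_sum_abs _ _).trans (Finset.sum_le_sum fun β _ => ?_)
    split_ifs with hβ
    · rw [← sub_mul, abs_mul]
      have h3 := hexp β (by omega) z (mem_closedBall_zero_iff.2 (hzX.trans hX))
      have h4 := abs_multiPow_le β (y := tang X) (r := ‖X‖) (abs_tang_le X)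
      calc _ ≤ C * ‖X‖ ^ chainOrder (k + 3) β * ‖X‖ ^ β.degree := by
            refine mul_le_mul (h3.trans ?_) h4 (abs_nonneg _) (by positivity)
            gcongr
        _ = C * ‖X‖ ^ (chainOrder (k + 3) β + β.degree) := by rw [pow_add]; ring
        _ ≤ C * ‖X‖ ^ (k + 2) := by
            refine mul_le_mul_of_nonneg_left (pow_le_pow_of_le_one (norm_nonneg _) hX1 ?_) hC0
            rw [chainOrder]; omega
        _ ≤ _ := by gcongr
    · rw [sub_zero, abs_zero]; positivity
  -- The model keeps exactly the terms with |β| + j + 2i ≤ k. Every other term has homogeneity at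
  -- least k + 3/2.
  have h3 : |T₂ - jetModel k (k + 3) c X| ≤
      jetConst m (k + 3) (k + 2) * C * (‖X‖ ^ (k + 1) * √‖X‖) := by
    rw [hT₂, jetModel_eq c X (show k ≤ k + 2 by omega), ← Finset.sum_sub_distrib, jetConst]
    simp only [Finset.sum_mul]
    refine (Finset.abs_sum_le_sum_abs _ _).trans (Finset.sum_le_sum fun β _ => ?_)
    have h4 : (if β.degree + 1 ≤ k + 2 then chainSum (k + 3) c (k + 3) β z * multiPow β (tang X)
        else 0) = ∑ i ∈ Finset.range (k + 3), ∑ j ∈ Finset.range (k + 3),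
        if β.degree + 1 ≤ k + 2 then lapSeq^[i] (c j) β * chain i j z * multiPow β (tang X)
        else 0 := by
      split_ifs
      · simp only [chainSum, Finset.sum_mul]
      · simp
    rw [h4, ← Finset.sum_sub_distrib]
    refine (Finset.abs_sum_le_sum_abs _ _).trans (Finset.sum_le_sum fun i _ => ?_)
    rw [← Finset.sum_sub_distrib]
    refine (Finset.abs_sum_le_sum_abs _ _).trans (Finset.sum_le_sum fun j _ => ?_)
    have h5 := abs_jetModel_term_le hc i j β X
    have h6 : 0 ≤ (m : ℝ) ^ i * |chainCoeff j i| * C * (‖X‖ ^ (k + 1) * √‖X‖) := by positivity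
    rw [← hz] at h5
    split_ifs with ha hb hb
    · rw [← hz, sub_self, abs_zero]; exact h6
    · rw [sub_zero]
      refine h5.trans (mul_le_mul_of_nonneg_left ?_ (by positivity))
      exact mul_le_mul_of_nonneg_right
        (pow_le_pow_of_le_one (norm_nonneg _) hX1 (by omega)) (Real.sqrt_nonneg _)
    · omega
    · simpa using h6
  have h4 := abs_sub_le (D 0 X) T₁ (jetModel k (k + 3) c X)
  have h5 := abs_sub_le T₁ T₂ (jetModel k (k + 3) c X)
  rw [add_mul, add_mul]
  linarith

end JetModel

/-! ### The model as U₀ times a polynomial in x and r. -/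

section ModelPolynomial

open MvPolynomial

variable {m : ℕ}

theorem evalXR_X_castSucc (i : Fin (m + 1)) (X : Space m) :
    evalXR (MvPolynomial.X i.castSucc) X = X i.castSucc := by
  rw [evalXR, eval_X, Fin.snoc_castSucc]

theorem evalXR_X_last (X : Space m) :
    evalXR (MvPolynomial.X (Fin.last (m + 1))) X = ‖planar X‖ := by
  rw [evalXR, eval_X, Fin.snoc_last, radius_eq]

/-- The polynomial in `x_n` and `r` which multiplied by `U₀` gives the planar harmonic function of
homogeneity `j + 1/2`. -/
noncomputable def edgePoly (m : ℕ) : ℕ → MvPolynomial (Fin (m + 1 + 1)) ℝ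
  | 0 => 1
  | 1 => C 2 * MvPolynomial.X (Fin.last m).castSucc - MvPolynomial.X (Fin.last (m + 1))
  | j + 2 => C 2 * MvPolynomial.X (Fin.last m).castSucc * edgePoly m (j + 1) -
      MvPolynomial.X (Fin.last (m + 1)) ^ 2 * edgePoly m j

theorem totalDegree_edgePoly_le (j : ℕ) : (edgePoly m j).totalDegree ≤ j := by
  have hx : (C 2 * MvPolynomial.X (Fin.last m).castSucc :
      MvPolynomial (Fin (m + 1 + 1)) ℝ).totalDegree ≤ 1 :=
    (totalDegree_mul _ _).trans (by rw [totalDegree_C, totalDegree_X])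
  induction j using Nat.twoStepInduction with
  | zero => simp [edgePoly]
  | one =>
    refine (totalDegree_sub _ _).trans (max_le hx ?_)
    rw [totalDegree_X]
  | more j h1 h2 =>
    refine (totalDegree_sub _ _).trans (max_le ?_ ?_)
    · exact (totalDegree_mul _ _).trans (by omega)
    · refine (totalDegree_mul _ _).trans ?_
      rw [totalDegree_X_pow]; omega

theorem slitHarmonic_planar (j : ℕ) (X : Space m) :
    slitHarmonic j (planar X) = U₀ X * evalXR (edgePoly m j) X := by
  have hx : evalXR (MvPolynomial.X (Fin.last m).castSucc) X = (planar X).re := by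
    rw [evalXR_X_castSucc, planar_re, signedDist_eq]
  have hr := evalXR_X_last X
  unfold evalXR at hx hr ⊢
  induction j using Nat.twoStepInduction with
  | zero => simp [edgePoly, U₀_eq_slitHarmonic]
  | one =>
    rw [slitHarmonic_one_eq, edgePoly, map_sub, map_mul, hx, hr, eval_C, U₀_eq_slitHarmonic]
    ring
  | more j h1 h2 =>
    rw [slitHarmonic_add_two, h1, h2, edgePoly, map_sub, map_mul, map_mul, map_mul, map_pow, hx, hr,
      eval_C]
    ring

/-- The polynomial factor of `jetModel`. -/
noncomputable def modelPoly (k S : ℕ) (c : ℕ → (Fin m →₀ ℕ) → ℝ) :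
    MvPolynomial (Fin (m + 1 + 1)) ℝ :=
  ∑ i ∈ Finset.range S, ∑ j ∈ Finset.range S,
    C (chainCoeff j i) * MvPolynomial.X (Fin.last (m + 1)) ^ (2 * i) * edgePoly m j *
      rename (fun l : Fin m => l.castSucc.castSucc) (taylor k (j + 2 * i) (lapSeq^[i] (c j)))

/-- A term has degree at most 2i from r, j from `edgePoly` and k - j - 2i from the Taylor factor,
which is zero when j + 2i > k. -/
theorem totalDegree_modelPoly_le (k S : ℕ) (c : ℕ → (Fin m →₀ ℕ) → ℝ) :
    (modelPoly k S c).totalDegree ≤ k := by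
  refine totalDegree_finsetSum_le fun i _ => totalDegree_finsetSum_le fun j _ => ?_
  rcases Nat.lt_or_ge k (j + 2 * i) with h | h
  · rw [taylor_eq_zero h]; simp
  · have h1 := (totalDegree_rename_le (fun l : Fin m => l.castSucc.castSucc)
      (taylor k (j + 2 * i) (lapSeq^[i] (c j)))).trans (totalDegree_taylor_le _ _ _)
    have h2 := totalDegree_edgePoly_le (m := m) j
    refine (totalDegree_mul _ _).trans ?_
    have h3 := totalDegree_mul (C (chainCoeff j i) *
      MvPolynomial.X (Fin.last (m + 1)) ^ (2 * i)) (edgePoly m j)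
    have h4 := totalDegree_mul (C (chainCoeff j i) : MvPolynomial (Fin (m + 1 + 1)) ℝ)
      (MvPolynomial.X (Fin.last (m + 1)) ^ (2 * i))
    rw [totalDegree_C, totalDegree_X_pow] at h4
    omega

theorem jetModel_eq_U₀_mul (k S : ℕ) (c : ℕ → (Fin m →₀ ℕ) → ℝ) (X : Space m) :
    jetModel k S c X = U₀ X * evalXR (modelPoly k S c) X := by
  simp only [jetModel, modelPoly]
  have hr := evalXR_X_last X
  have hs := fun j => slitHarmonic_planar j X
  unfold evalXR at hr hs ⊢
  simp only [map_sum, map_mul, map_pow, eval_C, eval_rename, hr, Finset.mul_sum]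
  refine Finset.sum_congr rfl fun i _ => Finset.sum_congr rfl fun j _ => ?_
  have h1 : (Fin.snoc (α := fun _ => ℝ) (fun i : Fin (m + 1) => X i.castSucc) (radius X)) ∘
      (fun l : Fin m => l.castSucc.castSucc) = tang X := by
    funext l
    rw [Function.comp_apply, Fin.snoc_castSucc, tang_apply]
  rw [h1, chain, hs, pow_mul]
  ring

/-- At a fixed point only finitely many coefficients enter, each linearly, so the product topology
suffices for the limit passage. -/
theorem continuous_jetModel_coeff (k S : ℕ) (X : Space m) :
    Continuous fun c : ℕ → (Fin m →₀ ℕ) → ℝ => jetModel k S c X := by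
  have h1 : ∀ (i j : ℕ) (β : Fin m →₀ ℕ),
      Continuous fun c : ℕ → (Fin m →₀ ℕ) → ℝ => lapSeq^[i] (c j) β := fun i j => by
    induction i with
    | zero => exact fun β => (continuous_apply β).comp (continuous_apply j)
    | succ i ih =>
      intro β
      simp only [lapSeq_iterate_succ]
      exact continuous_finsetSum _ fun l _ => ih _
  simp only [jetModel_eq _ X le_rfl]
  refine continuous_finsetSum _ fun β _ => continuous_finsetSum _ fun i _ =>
    continuous_finsetSum _ fun j _ => ?_
  split_ifs
  · exact ((h1 i j β).mul continuous_const).mul continuous_const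
  · exact continuous_const

end ModelPolynomial

/-! ### Weighted estimate, removal of the mollification, and the final bound. -/

section Expansion

variable {m : ℕ}

/-- Upgrade of an estimate for a solution near the origin to one with the weight `U₀`. -/
theorem IsSolution.abs_le_pow_mul_U₀ {ρ C : ℝ} {w : Space m → ℝ} {k : ℕ}
    (hw : IsSolution ρ w) (hC : ∀ X : Space m, ‖X‖ < ρ → |w X| ≤ C * (‖X‖ ^ (k + 1) * √‖X‖))
    (hC0 : 0 ≤ C) {Y : Space m} (hY : 4 * ‖Y‖ < ρ) :
    |w Y| ≤ 32 * (m + 2) * C * 4 ^ (k + 1) * ‖Y‖ ^ (k + 1) * U₀ Y := by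
  rcases (norm_nonneg Y).eq_or_lt with h0 | h0
  · have h1 := hC Y (by linarith [norm_nonneg Y])
    rw [← h0, zero_pow (Nat.succ_ne_zero k), zero_mul, mul_zero] at h1
    rw [← h0, zero_pow (Nat.succ_ne_zero k), mul_zero, zero_mul]
    exact h1
  -- The barrier estimate on the ball of radius `t` divides the supremum bound C t^(k+1) √t by √t.
  -- The half power is thereby exchanged for U₀.
  · set t := 4 * ‖Y‖ with ht
    have ht0 : 0 < t := by positivity
    have hs : 0 < √t := Real.sqrt_pos.2 ht0
    have h1 := (hw.mono hY.le).abs_le_U₀ (M := C * (t ^ (k + 1) * √t)) ht0 (fun X hX => by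
      rw [mem_ball_zero_iff] at hX
      refine (hC X (hX.trans hY)).trans ?_
      gcongr) (Y := Y) (by linarith)
    refine h1.trans (le_of_eq ?_)
    congr 1
    rw [ht, mul_pow] at *
    field_simp

theorem U₀_nonneg (X : Space m) : 0 ≤ U₀ X := by
  rw [U₀_eq]; positivity

/-- Expansion near the origin of a solution which is smooth in the tangential directions. -/
theorem exists_jetModel_of_isTangentialJet (m k : ℕ) :
    ∃ ρ C : ℝ, 0 < ρ ∧ ρ ≤ 1 / 2 ∧ 0 ≤ C ∧ ∀ D : (Fin m →₀ ℕ) → Space m → ℝ,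
      IsTangentialJet (1 / 2) D → (∀ X ∈ ball (0 : Space m) (1 / 2), |D 0 X| ≤ 1) →
      ∃ c : ℕ → (Fin m →₀ ℕ) → ℝ, (∀ j α, |c j α| ≤ C) ∧ ∀ X : Space m, ‖X‖ < ρ →
        |D 0 X - jetModel k (k + 3) c X| ≤ C * ‖X‖ ^ (k + 1) * U₀ X := by
  obtain ⟨A, hA0, hA⟩ := exists_bound_jet m (k + 3)
  set R : ℝ := 1 / 2 * (1 / 8) ^ (k + 3) with hR
  have hR0 : 0 < R := by positivity
  have hR12 : R ≤ 1 / 2 :=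
    mul_le_of_le_one_right (by norm_num) (pow_le_one₀ (by norm_num) (by norm_num))
  obtain ⟨C, hC0, hC⟩ := exists_chain_expansion m (k + 3) (R := R / 2) (by linarith) (by linarith)
    A hA0
  set B : ℝ := A * m ^ (k + 2) + (multiIndices m (k + 2)).card * C +
    jetConst m (k + 3) (k + 2) * C with hB
  have hB0 : 0 ≤ B := by
    have := jetConst_nonneg m (k + 3) (k + 2)
    positivity
  -- The slice expansion is valid up to R/2, and the weighted estimate at `X` uses the ball of
  -- radius 4‖X‖.
  refine ⟨R / 8, max C (32 * (m + 2) * B * 4 ^ (k + 1)), by linarith, by linarith,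
    le_max_of_le_left hC0, fun D hD hD1 => ?_⟩
  have hDR := hD.mono hR12
  have hbd := hA D hD hD1
  have hmem : ∀ z ∈ closedBall (0 : ℂ) (R / 2), (slice z : Space m) ∈ ball (0 : Space m) R :=
    fun z hz => by
    rw [mem_ball_zero_iff, norm_slice]
    linarith [mem_closedBall_zero_iff.1 hz]
  obtain ⟨c, h1, -, h3⟩ := hC (fun α z => D α (slice z)) (hDR.isChainFamily (by linarith))
    fun α hα z hz => hbd α hα _ (hmem z hz)
  refine ⟨c, fun j α => (h1 j α).trans (le_max_left _ _), fun X hX => ?_⟩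
  have hw : IsSolution (R / 2) fun X => D 0 X - jetModel k (k + 3) c X :=
    ((hDR.sol 0).mono (by linarith)).sub (isSolution_jetModel (by omega) c _)
  have h4 := hw.abs_le_pow_mul_U₀ (C := B) (k := k) (fun X hX =>
    hDR.abs_sub_jetModel_le (by linarith) (by linarith) hbd h1 h3 hX.le) hB0 (Y := X)
    (by linarith)
  refine h4.trans ?_
  have := U₀_nonneg X
  gcongr
  exact le_max_right _ _

/-- The coefficients lie in a product of compact intervals, compact by Tychonoff's theorem;
countability of the index sets makes it sequentially compact. -/
theorem exists_tendsto_subseq_of_abs_le {ι κ : Type*} [Countable ι] [Countable κ] {C : ℝ}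
    (c : ℕ → ι → κ → ℝ) (hc : ∀ n j α, |c n j α| ≤ C) :
    ∃ (d : ι → κ → ℝ) (φ : ℕ → ℕ), StrictMono φ ∧ (∀ j α, |d j α| ≤ C) ∧
      Tendsto (c ∘ φ) atTop (𝓝 d) := by
  have hK : IsCompact (Set.pi univ fun _ : ι => Set.pi univ fun _ : κ => Icc (-C) C) :=
    isCompact_univ_pi fun _ => isCompact_univ_pi fun _ => isCompact_Icc
  obtain ⟨d, hd, φ, hφ, hlim⟩ := hK.tendsto_subseq (x := c)
    fun n j _ α _ => abs_le.1 (hc n j α)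
  exact ⟨d, φ, hφ, fun j α => abs_le.2 (hd j (mem_univ j) α (mem_univ α)), hlim⟩

/-- Expansion near the origin of an arbitrary solution. -/
theorem exists_jetModel_near (m k : ℕ) :
    ∃ ρ C : ℝ, 0 < ρ ∧ ρ ≤ 1 / 2 ∧ 0 ≤ C ∧ ∀ u : Space m → ℝ,
      IsSolution 1 u → (∀ X ∈ ball (0 : Space m) 1, |u X| ≤ 1) →
      ∃ c : ℕ → (Fin m →₀ ℕ) → ℝ, (∀ j α, |c j α| ≤ C) ∧ ∀ X : Space m, ‖X‖ < ρ →
        |u X - jetModel k (k + 3) c X| ≤ C * ‖X‖ ^ (k + 1) * U₀ X := by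
  obtain ⟨ρ, C, hρ, hρ2, hC0, hC⟩ := exists_jetModel_of_isTangentialJet m k
  refine ⟨ρ, C, hρ, hρ2, hC0, fun u hu hu1 => ?_⟩
  set h : ℕ → ℝ := fun n => 1 / (4 * (m + 1)) / (n + 1) with hh
  have hh0 : ∀ n, 0 < h n := fun n => by positivity
  have hhle : ∀ n, 2 * (m + 1) * h n ≤ 1 / 2 := fun n => by
    have h1 : h n ≤ 1 / (4 * (m + 1)) := div_le_self (by positivity) (by simp)
    calc 2 * (m + 1) * h n ≤ 2 * (m + 1) * (1 / (4 * (m + 1))) := by gcongr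
      _ = 1 / 2 := by field_simp; norm_num
  have hhlim : Tendsto h atTop (𝓝 0) := by
    have := (tendsto_one_div_add_atTop_nhds_zero_nat (𝕜 := ℝ)).const_mul (1 / (4 * ((m : ℝ) + 1)))
    simpa [hh, div_eq_mul_inv] using this
  choose D hD hDu using fun n => exists_isTangentialJet hu (hh0 n) (hhle n)
  have hmem : ∀ n, ∀ X ∈ ball (0 : Space m) (1 / 2), ∀ y ∈ closedBall (0 : Fin m → ℝ) (h n),
      X - shift y ∈ ball (0 : Space m) 1 := fun n X hX y hy => by
    rw [mem_ball_zero_iff] at hX ⊢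
    have h1 := norm_sub_le X (shift y)
    have h2 := norm_shift_le y
    have h3 : (m + 1) * ‖y‖ ≤ (m + 1) * h n := by
      gcongr; simpa using hy
    have := hhle n
    linarith
  -- The averaging property with a = 0 and ε = 1 keeps the bound on `u`; with a = u X it gives
  -- pointwise convergence below.
  have hD1 : ∀ n, ∀ X ∈ ball (0 : Space m) (1 / 2), |D n 0 X| ≤ 1 := fun n X hX => by
    simpa using hDu n X hX 0 1 fun y hy => by simpa using hu1 _ (hmem n X hX y hy)
  have hDlim : ∀ X ∈ ball (0 : Space m) (1 / 2), Tendsto (fun n => D n 0 X) atTop (𝓝 (u X)) :=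
    fun X hX => by
    have hX1 : X ∈ ball (0 : Space m) 1 := ball_subset_ball (by norm_num) hX
    have hcont : ContinuousAt (fun y => u (X - shift y)) (0 : Fin m → ℝ) := by
      have h1 : ContinuousAt u (X - shift (0 : Fin m → ℝ)) := by
        rw [map_zero, sub_zero]; exact hu.cont.continuousAt (isOpen_ball.mem_nhds hX1)
      exact ContinuousAt.comp (f := fun y : Fin m → ℝ => X - shift y) h1 (by fun_prop)
    rw [Metric.tendsto_atTop]
    intro ε hε
    obtain ⟨δ, hδ, h2⟩ := Metric.continuousAt_iff.1 hcont (ε / 2) (by linarith)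
    obtain ⟨N, hN⟩ := (hhlim.eventually (gt_mem_nhds hδ)).exists_forall_of_atTop
    refine ⟨N, fun n hn => ?_⟩
    rw [Real.dist_eq]
    refine (hDu n X hX (u X) (ε / 2) fun y hy => ?_).trans_lt (by linarith)
    have h3 : dist y 0 < δ := (mem_closedBall.1 hy).trans_lt (hN n hn)
    simpa [Real.dist_eq] using (h2 h3).le
  choose c hc1 hc2 using fun n => hC (D n) (hD n) (hD1 n)
  -- The constant does not depend on the mollification, so a subsequence of coefficients converges
  -- and the estimate passes to the limit at each point.
  obtain ⟨d, φ, hφ, hd, hlim⟩ := exists_tendsto_subseq_of_abs_le c hc1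
  refine ⟨d, hd, fun X hX => ?_⟩
  have hX2 : X ∈ ball (0 : Space m) (1 / 2) := by
    rw [mem_ball_zero_iff]; exact hX.trans_le hρ2
  have h1 : Tendsto (fun n => jetModel k (k + 3) (c (φ n)) X) atTop
      (𝓝 (jetModel k (k + 3) d X)) :=
    ((continuous_jetModel_coeff k (k + 3) X).tendsto d).comp hlim
  have h2 := (((hDlim X hX2).comp hφ.tendsto_atTop).sub h1).abs
  exact le_of_tendsto h2 (Eventually.of_forall fun n => hc2 (φ n) X hX)

/-- Near the origin this is the local expansion. For ρ ≤ ‖X‖ < 1/2 the difference is a solution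
bounded by a constant on the unit ball, so the barrier bounds it by a multiple of U₀, and ‖X‖^(k+1)
≥ ρ^(k+1) pays for the missing power. -/
theorem exists_jetModel (m k : ℕ) :
    ∃ C : ℝ, ∀ u : Space m → ℝ, IsSolution 1 u → (∀ X ∈ ball (0 : Space m) 1, |u X| ≤ 1) →
      ∃ c : ℕ → (Fin m →₀ ℕ) → ℝ, ∀ X ∈ ball (0 : Space m) (1 / 2),
        |u X - jetModel k (k + 3) c X| ≤ C * ‖X‖ ^ (k + 1) * U₀ X := by
  obtain ⟨ρ, C, hρ, hρ2, hC0, hC⟩ := exists_jetModel_near m k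
  set M : ℝ := 1 + jetConst m (k + 3) k * C with hM
  have hM0 : 0 ≤ M := by
    have := jetConst_nonneg m (k + 3) k
    positivity
  refine ⟨max C (32 * (m + 2) * M / ρ ^ (k + 1)), fun u hu hu1 => ?_⟩
  obtain ⟨c, hc, h1⟩ := hC u hu hu1
  refine ⟨c, fun X hX => ?_⟩
  have hU := U₀_nonneg X
  rcases lt_or_ge ‖X‖ ρ with h | h
  · refine (h1 X h).trans ?_
    gcongr
    exact le_max_left _ _
  · have h2 := (hu.sub (isSolution_jetModel (k := k) (S := k + 3) (by omega) c 1)).abs_le_U₀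
      (M := M) one_pos (fun Y hY => (abs_sub _ _).trans (add_le_add (hu1 Y hY)
        (abs_jetModel_le hc (mem_ball_zero_iff.1 hY).le))) (Y := X) (by simpa using hX)
    rw [Real.sqrt_one, div_one] at h2
    refine h2.trans (mul_le_mul_of_nonneg_right ?_ hU)
    calc 32 * (m + 2) * M = 32 * (m + 2) * M / ρ ^ (k + 1) * ρ ^ (k + 1) := by field_simp
      _ ≤ max C (32 * (m + 2) * M / ρ ^ (k + 1)) * ‖X‖ ^ (k + 1) := by
        gcongr
        exact le_max_right _ _

end Expansion

end FlatSlit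

theorem theorem4p5 (n : ℕ) (hn : 1 ≤ n) (k : ℕ) :
    ∃ C : ℝ, ∀ u : EuclideanSpace ℝ (Fin (n + 1)) → ℝ,
      ContinuousOn u (Metric.ball 0 1) →
      (∀ X ∈ Metric.ball 0 1, u (FlatSlit.reflect X) = u X) →
      (∀ X ∈ Metric.ball 0 1, |u X| ≤ 1) →
      InnerProductSpace.HarmonicOnNhd u (Metric.ball 0 1 \ FlatSlit.slit n) →
      (∀ X ∈ FlatSlit.slit n, u X = 0) →
      ∃ P₀ : MvPolynomial (Fin (n + 1)) ℝ,
        P₀.totalDegree ≤ k ∧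
        InnerProductSpace.HarmonicOnNhd (fun X => FlatSlit.U₀ X * FlatSlit.evalXR P₀ X)
          (Metric.ball 0 1 \ FlatSlit.slit n) ∧
        ∀ X ∈ Metric.ball 0 (1 / 2),
          |u X - FlatSlit.U₀ X * FlatSlit.evalXR P₀ X| ≤ C * ‖X‖ ^ (k + 1) * FlatSlit.U₀ X := by
  obtain ⟨m, rfl⟩ : ∃ m, n = m + 1 := ⟨n - 1, by omega⟩
  obtain ⟨C, hC⟩ := FlatSlit.exists_jetModel m k
  refine ⟨C, fun u hu heven hu1 hharm hzero => ?_⟩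
  have hsol : FlatSlit.IsSolution 1 u := ⟨hu, heven,
    fun X hX hs => hharm X ⟨hX, fun h => ((FlatSlit.mem_slit_iff X).1 h).2 hs⟩,
    fun X hX hs => hzero X ((FlatSlit.mem_slit_iff X).2 ⟨hX, hs⟩)⟩
  obtain ⟨c, hc⟩ := hC u hsol hu1
  refine ⟨FlatSlit.modelPoly k (k + 3) c, FlatSlit.totalDegree_modelPoly_le _ _ _, ?_, ?_⟩
  · intro X hX
    have hs : FlatSlit.planar X ∈ Complex.slitPlane := by
      by_contra h
      exact hX.2 ((FlatSlit.mem_slit_iff X).2 ⟨hX.1, h⟩)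
    simpa only [← FlatSlit.jetModel_eq_U₀_mul] using
      FlatSlit.harmonicAt_jetModel (k := k) (S := k + 3) (by omega) c hs
  · intro X hX
    simpa only [← FlatSlit.jetModel_eq_U₀_mul] using hc X hX
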